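/- \textbf{Conventions.} For a smooth finite-dimensional manifold $M$ let $\mathbb{T}M=TM\oplus T^*M$, with the inner product $\langle X+\alpha,Y+\beta\rangle=\tfrac12(\alpha(Y)+\beta(X))$ and the Dorfman bracket $[X+\alpha,Y+\beta]=[X,Y]+\mathcal L_X\beta-\iota_Yd\alpha$ on sections, both extended $\mathbb{C}$-bilinearly to $\mathbb{T}M\otimes\mathbb{C}$. A \emph{split structure} on $M$ is a subbundle $E\subseteq\mathbb{T}M$ of some rank $2k$ on which $\langle\,,\rangle$ is nondegenerate of signature $(k,k)$. A \emph{framing} of $E$ is a real subspace $V\subseteq\Gamma(E)$ with $\dim V=\operatorname{rk}E$ which generates $\Gamma(E)$ over $C^\infty(M)$; a \emph{local framing} on an open set $U$ is a framing of $E|_U$. $\mathrm{SGF}(E)$ is the set of bundle endomorphisms $J$ of $E$ that are skew-symmetric and orthogonal with respect to $\langle\,,\rangle$; for such $J$, $L_J=\{x-\sqrt{-1}Jx: x\in E\}\subseteq E\otimes\mathbb{C}$ is its $\sqrt{-1}$-eigenbundle. $\mathrm{CRF}(E)$ is the set of $J\in\mathrm{SGF}(E)$ for which $\Gamma(L_J)$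 is closed under the Dorfman bracket. For a set $S$ of sections of $\mathbb{T}M\otimes\mathbb{C}$, $\mathbb{I}(S)$ is the set of sections $x$ of $\mathbb{T}M\otimes\mathbb{C}$ with $[x,S]\subseteq S$; for a subbundle $T$ of $\mathbb{T}M\otimes\mathbb{C}$ put $\mathbb{I}(T)=\mathbb{I}(\Gamma(T))$, write $\mathbb{I}_U(T)$ for the same notion over an open set $U$, and put $\mathbb{I}(J)=\mathbb{I}(L_J)$. If $E,E'$ are orthogonal split structures, $J\in\mathrm{SGF}(E)$ and $V$ is a framing of $E'$, then $(J,V)$ is a \emph{normal pair} if $J\in\mathrm{CRF}(E)$ and $V\subseteq\mathbb{I}(J)\cap\mathbb{I}(E')$. Let $M_1,M_2$ be non-empty smooth finite-dimensional manifolds, $N=M_1\times M_2$, with projections $\pi_i:N\to M_i$, and let $\pi_i^*$ denote the pull-back to $N$ of (sections of) $\mathbb{T}M_i$, of its subbundles and of their endomorphisms, by horizontal lift of tangent vectors with respect to the product structure and pull-back of covectors. For $F_i\subseteq\mathbb{T}M_i$ write $F_1\boxplus F_2=\pi_1^*F_1\oplus\pi_2^*F_2\subseteq\mathbb{T}N$.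 For $i=1,2$ let $E_i,E_i'$ be orthogonal split structures on $M_i$, $E_i''=E_i\oplus E_i'$, $E''=E_1''\boxplus E_2''$, $J_i\in\mathrm{SGF}(E_i)$, $V_i$ a framing of $E_i'$, and let $\Psi\in\mathrm{SGF}(E_1'\boxplus E_2')$. The tuple $(J_1,J_2,V_1,V_2,\Psi)$ is an \emph{adaptable external Morimoto datum} if \begin{enumerate} \item[1)] $V_i\subseteq\mathbb{I}(E_i'')$ for $i=1,2$; \item[2)] for $i=1,2$, each point of $M_i$ has an open neighbourhood $U$ with a local framing $W_i\subseteq\mathbb{I}_U(E_i'')$ of $E_i$ on $U$ such that $d\langle w,J_iz\rangle\in\Gamma_U(E_i'')$ for all $w,z\in W_i$; \item[3)] $(\pi_1^*V_1,\pi_2^*V_2,\Psi)$ is admissible: there is an isomorphism $\phi:\Gamma(\pi_1^*E_1'\otimes\mathbb{C})\to\Gamma(\pi_2^*E_2'\otimes\mathbb{C})$ of $C^\infty(N,\mathbb{C})$-modules with $\phi(\pi_1^*V_1\otimes\mathbb{C})=\pi_2^*V_2\otimes\mathbb{C}$ and $\Gamma(L_\Psi)=\{e+\phi(e): e\in\Gamma(\pi_1^*E_1'\otimes\mathbb{C})\}$.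 \end{enumerate} \textbf{Theorem (Morimoto products).} Let $(J_1,J_2,V_1,V_2,\Psi)$ be an adaptable external Morimoto datum on $M_1\times M_2$, and let $J_1\boxplus_\Psi J_2=\pi_1^*J_1\oplus\pi_2^*J_2\oplus\Psi$ be the Morimoto product. Then $J_1\boxplus_\Psi J_2\in\mathrm{CRF}(E'')$ if and only if \begin{enumerate} \item[i)] $(J_1,V_1)$ and $(J_2,V_2)$ are normal pairs, and \item[ii)] $\Psi\in\mathrm{CRF}(E_1'\boxplus E_2')$. \end{enumerate} -/

import Mathlib

open Set Bundle
open scoped Manifold ContDiff TensorProduct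

noncomputable section

namespace GenGeom

/-- The restriction of the symmetric bilinear form `B` to the subspace `S` has `k` positive and `l`
negative squares in a diagonal form. -/
def HasSignature {W : Type*} [AddCommGroup W] [Module ℝ W] (B : LinearMap.BilinForm ℝ W)
    (S : Submodule ℝ W) (k l : ℕ) : Prop :=
  sigPos (B.toQuadraticMap.restrict S) = k ∧ sigNeg (B.toQuadraticMap.restrict S) = l

section Basic

variable {E : Type*} [NormedAddCommGroup E] [NormedSpace ℝ E]
  {H : Type*} [TopologicalSpace H] (I : ModelWithCorners ℝ E H)
  {M : Type*} [TopologicalSpace M] [ChartedSpace H M]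

/-! ### The generalized tangent bundle -/

/-- The fibre `T_pM ⊕ T_p^*M` of the generalized tangent bundle `𝕋M`. -/
abbrev GT (p : M) : Type _ := TangentSpace I p × (TangentSpace I p →L[ℝ] ℝ)

/-- The fibre `𝕋_pM ⊗ ℂ` of the complexified generalized tangent bundle. -/
abbrev CGT (p : M) : Type _ := ℂ ⊗[ℝ] GT I p

variable (M) in
/-- Not necessarily smooth sections of `𝕋M`.  A section over an open set `U` is encoded by its
extension by zero to `M`. -/
abbrev GSec : Type _ := ∀ p : M, GT I p

variable (M) in
/-- Not necessarily smooth sections of `𝕋M ⊗ ℂ`, with the same convention. -/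
abbrev CSec : Type _ := ∀ p : M, CGT I p

variable (M) in
/-- A family of real subspaces of the fibres of `𝕋M` (no smoothness yet). -/
abbrev Fib : Type _ := ∀ p : M, Submodule ℝ (GT I p)

variable (M) in
/-- A family of endomorphisms of the fibres of `𝕋M` (no smoothness yet). -/
abbrev EndFib : Type _ := ∀ p : M, Module.End ℝ (GT I p)

/-- The tautological inner product `⟨X + α, Y + β⟩ = (α(Y) + β(X)) / 2`. -/
def inn (p : M) : LinearMap.BilinForm ℝ (GT I p) :=
  LinearMap.mk₂ ℝ (fun x y => (1 / 2 : ℝ) * (x.2 y.1 + y.2 x.1))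
    (by intro x x' y; simp; ring) (by intro c x y; simp; ring)
    (by intro x y y'; simp; ring) (by intro c x y; simp; ring)

/-- The real part of an element of `𝕋_pM ⊗ ℂ`. -/
def rePart (p : M) : CGT I p →ₗ[ℝ] GT I p :=
  (TensorProduct.lid ℝ (GT I p)).toLinearMap ∘ₗ LinearMap.rTensor (GT I p) Complex.reLm

/-- The imaginary part of an element of `𝕋_pM ⊗ ℂ`. -/
def imPart (p : M) : CGT I p →ₗ[ℝ] GT I p :=
  (TensorProduct.lid ℝ (GT I p)).toLinearMap ∘ₗ LinearMap.rTensor (GT I p) Complex.imLm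

lemma rePart_smul (p : M) (c : ℂ) (z : CGT I p) :
    rePart I p (c • z) = c.re • rePart I p z - c.im • imPart I p z := by
  induction z using TensorProduct.induction_on with
  | zero => simp
  | tmul a x =>
    simp [rePart, imPart, TensorProduct.smul_tmul', sub_smul, mul_smul]
  | add z w hz hw => rw [smul_add, map_add, hz, hw, map_add, map_add]; module

lemma imPart_smul (p : M) (c : ℂ) (z : CGT I p) :
    imPart I p (c • z) = c.re • imPart I p z + c.im • rePart I p z := by
  induction z using TensorProduct.induction_on with
  | zero => simp
  | tmul a x =>
    simp [rePart, imPart, TensorProduct.smul_tmul', add_smul, mul_smul]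
  | add z w hz hw => rw [smul_add, map_add, hz, hw, map_add, map_add]; module

variable (M) in
/-- The inclusion of real sections into complex sections. -/
def toC : GSec I M →ₗ[ℝ] CSec I M where
  toFun x p := 1 ⊗ₜ[ℝ] x p
  map_add' x y := by funext p; simp [TensorProduct.tmul_add]
  map_smul' c x := by funext p; simp

/-! ### Smooth sections and the Dorfman bracket -/

variable (A : Type*) [NormedRing A] [NormedAlgebra ℝ A] in
/-- The ring `C^∞(U, A)`, used for `A = ℝ` and `A = ℂ`; only the values on `U` matter for the
modules below. -/
def smoothFun (U : Set M) : Subring (M → A) where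
  carrier := {f | ContMDiffOn I 𝓘(ℝ, A) ∞ f U}
  mul_mem' hf hg := (contDiff_mul.contMDiff (n := ∞)).comp_contMDiffOn (hf.prodMk_space hg)
  one_mem' := contMDiffOn_const
  add_mem' hf hg := ContMDiffOn.add hf hg
  zero_mem' := contMDiffOn_const
  neg_mem' hf := ContMDiffOn.neg hf

section Forms

variable {I}

/-- The expression of a 1-form `α` in the preferred chart at `p`. -/
def formInChart (α : ∀ q : M, TangentSpace I q →L[ℝ] ℝ) (p : M) : E → E →L[ℝ] ℝ :=
  fun u => (α ((extChartAt I p).symm u)).comp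
    (mfderivWithin 𝓘(ℝ, E) I (extChartAt I p).symm (range I) u)

/-- The exterior derivative of a 1-form, as `v ↦ dα_p(v, ·)`, computed in the preferred chart at `p`:
there `dα(v, w) = D_v α(w) - D_w α(v)`. -/
def extD (α : ∀ q : M, TangentSpace I q →L[ℝ] ℝ) (p : M) (v : TangentSpace I p) :
    TangentSpace I p →L[ℝ] ℝ :=
  let D : E →L[ℝ] E →L[ℝ] ℝ :=
    fderivWithin ℝ (formInChart α p) (range I) (extChartAt I p p)
  let T : TangentSpace I p →L[ℝ] E := mfderiv I 𝓘(ℝ, E) (extChartAt I p) p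
  ((D - D.flip) (T v)).comp T

/-- The Lie derivative of a 1-form, `ℒ_X β = ι_X dβ + d(ι_X β)`. -/
def lieDForm (X : ∀ q : M, TangentSpace I q) (β : ∀ q : M, TangentSpace I q →L[ℝ] ℝ) (p : M) :
    TangentSpace I p →L[ℝ] ℝ :=
  extD β p (X p) + mvfderiv I (fun q => β q (X q)) p

/-- The Dorfman bracket `[X + α, Y + β] = [X, Y] + ℒ_X β - ι_Y dα`. -/
def dorfman (x y : GSec I M) (p : M) : GT I p :=
  (VectorField.mlieBracket I (fun q => (x q).1) (fun q => (y q).1) p,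
    lieDForm (fun q => (x q).1) (fun q => (y q).2) p - extD (fun q => (x q).2) p (y p).1)

/-- The `ℂ`-bilinear extension of the Dorfman bracket to complex sections. -/
def cdorfman (s t : CSec I M) (p : M) : CGT I p :=
  let a : GSec I M := fun q => rePart I q (s q)
  let b : GSec I M := fun q => imPart I q (s q)
  let c : GSec I M := fun q => rePart I q (t q)
  let d : GSec I M := fun q => imPart I q (t q)
  (1 : ℂ) ⊗ₜ[ℝ] (dorfman a c p - dorfman b d p)
    + Complex.I ⊗ₜ[ℝ] (dorfman a d p + dorfman b c p)

open Classical in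
/-- The Dorfman bracket of two complex sections over the open set `U`. -/
def cdorfmanOn (U : Set M) (s t : CSec I M) : CSec I M :=
  fun p => if p ∈ U then cdorfman s t p else 0

variable (I) in
open Classical in
/-- The section `df` of `T^*M ⊆ 𝕋M` over the open set `U`. -/
def dSec (U : Set M) (f : M → ℝ) : GSec I M :=
  fun p => if p ∈ U then (0, mvfderiv I f p) else 0

end Forms

variable [IsManifold I ∞ M]

variable {I} in
/-- Smoothness on `U` of a section `X + α` of `𝕋M`: both `X` (as a map into `TM`) and `α` (as a map
into `T^*M`) are smooth on `U`. -/
def SmoothOn (U : Set M) (x : GSec I M) : Prop :=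
  ContMDiffOn I (I.prod 𝓘(ℝ, E)) ∞
      (fun p => (TotalSpace.mk' E p (x p).1 : TotalSpace E (TangentSpace I : M → Type _))) U ∧
    ContMDiffOn I (I.prod 𝓘(ℝ, E →L[ℝ] ℝ)) ∞
      (fun p => (TotalSpace.mk' (E →L[ℝ] ℝ) p (x p).2 :
        TotalSpace (E →L[ℝ] ℝ) (fun p : M => TangentSpace I p →L[ℝ] Trivial M ℝ p))) U

lemma SmoothOn.zero (U : Set M) : SmoothOn U (0 : GSec I M) :=
  ⟨(contMDiff_zeroSection ℝ (TangentSpace I : M → Type _)).contMDiffOn,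
    (contMDiff_zeroSection ℝ
      (fun p : M => TangentSpace I p →L[ℝ] Trivial M ℝ p)).contMDiffOn⟩

variable {I} in
lemma SmoothOn.add {U : Set M} {x y : GSec I M} (hx : SmoothOn U x) (hy : SmoothOn U y) :
    SmoothOn U (x + y) :=
  ⟨ContMDiffOn.add_section hx.1 hy.1, ContMDiffOn.add_section hx.2 hy.2⟩

variable {I} in
lemma SmoothOn.sub {U : Set M} {x y : GSec I M} (hx : SmoothOn U x) (hy : SmoothOn U y) :
    SmoothOn U (x - y) :=
  ⟨ContMDiffOn.sub_section hx.1 hy.1, ContMDiffOn.sub_section hx.2 hy.2⟩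

variable {I} in
lemma SmoothOn.smul {U : Set M} {x : GSec I M} {f : M → ℝ}
    (hf : ContMDiffOn I 𝓘(ℝ, ℝ) ∞ f U) (hx : SmoothOn U x) : SmoothOn U (f • x) :=
  ⟨ContMDiffOn.smul_section hf hx.1, ContMDiffOn.smul_section hf hx.2⟩

/-- `Γ_U(F)`: smooth sections over `U` with values in `F`, as a `C^∞(U)`-module. -/
def secs (U : Set M) (F : Fib I M) : Submodule (smoothFun (M := M) I ℝ U) (GSec I M) where
  carrier := {x | SmoothOn U x ∧ (∀ p ∈ U, x p ∈ F p) ∧ ∀ p ∉ U, x p = 0}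
  zero_mem' := ⟨SmoothOn.zero I U, fun p _ => (F p).zero_mem, fun _ _ => rfl⟩
  add_mem' {x y} hx hy := ⟨hx.1.add hy.1, fun p hp => (F p).add_mem (hx.2.1 p hp) (hy.2.1 p hp),
    fun p hp => by simp [hx.2.2 p hp, hy.2.2 p hp]⟩
  smul_mem' c x hx := ⟨hx.1.smul c.2, fun p hp => (F p).smul_mem (c.1 p) (hx.2.1 p hp),
    fun p hp => by
      change c.1 p • x p = 0
      rw [hx.2.2 p hp, smul_zero]⟩

/-- `Γ_U(T)` for a family `T` of complex subspaces of `𝕋M ⊗ ℂ`, as a `C^∞(U, ℂ)`-module. -/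
def csecs (U : Set M) (T : ∀ p : M, Submodule ℂ (CGT I p)) :
    Submodule (smoothFun (M := M) I ℂ U) (CSec I M) where
  carrier := {s | (SmoothOn U (fun p => rePart I p (s p) : GSec I M) ∧
    SmoothOn U (fun p => imPart I p (s p) : GSec I M)) ∧
    (∀ p ∈ U, s p ∈ T p) ∧ ∀ p ∉ U, s p = 0}
  zero_mem' := by
    refine ⟨⟨?_, ?_⟩, fun p _ => (T p).zero_mem, fun _ _ => rfl⟩
    · convert SmoothOn.zero (M := M) I U using 1
      funext p; simp
    · convert SmoothOn.zero (M := M) I U using 1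
      funext p; simp
  add_mem' {s t} hs ht := by
    refine ⟨⟨?_, ?_⟩, fun p hp => (T p).add_mem (hs.2.1 p hp) (ht.2.1 p hp),
      fun p hp => by simp [hs.2.2 p hp, ht.2.2 p hp]⟩
    · convert hs.1.1.add ht.1.1 using 1
      funext p; simp
    · convert hs.1.2.add ht.1.2 using 1
      funext p; simp
  smul_mem' c s hs := by
    have hre : ContMDiffOn I 𝓘(ℝ, ℝ) ∞ (fun p => (c.1 p).re) U :=
      Complex.reCLM.contMDiff.comp_contMDiffOn c.2
    have him : ContMDiffOn I 𝓘(ℝ, ℝ) ∞ (fun p => (c.1 p).im) U :=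
      Complex.imCLM.contMDiff.comp_contMDiffOn c.2
    refine ⟨⟨?_, ?_⟩, fun p hp => (T p).smul_mem (c.1 p) (hs.2.1 p hp), fun p hp => by
      change c.1 p • s p = 0
      rw [hs.2.2 p hp, smul_zero]⟩
    · convert (hs.1.1.smul hre).sub (hs.1.2.smul him) using 1
      funext p; exact rePart_smul I p (c.1 p) (s p)
    · convert (hs.1.2.smul hre).add (hs.1.1.smul him) using 1
      funext p; exact imPart_smul I p (c.1 p) (s p)

/-- `I_U(S)`: the smooth complex sections `x` over `U` such that `[x, S] ⊆ S`. -/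
def normalizer (U : Set M) (S : Set (CSec I M)) : Set (CSec I M) :=
  {x | x ∈ csecs I U (fun _ => ⊤) ∧ ∀ y ∈ S, cdorfmanOn U x y ∈ S}

/-- `I_U(F) = I_U(Γ_U(F))` for a real subbundle `F` of `𝕋M ⊆ 𝕋M ⊗ ℂ`. -/
def normalizerFib (U : Set M) (F : Fib I M) : Set (CSec I M) :=
  normalizer I U (toC I M '' {y | y ∈ secs I U F})

/-! ### Split structures, framings and split generalized `F`-structures -/

/-- `F` is a split structure of rank `2k`: a smooth subbundle of rank `2k` of `𝕋M` on which the
tautological inner product has signature `(k, k)` (and so is nondegenerate). -/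
structure IsSplitOfRank (k : ℕ) (F : Fib I M) : Prop where
  frame : ∀ p : M, ∃ U : Set M, IsOpen U ∧ p ∈ U ∧ ∃ e : Fin (2 * k) → GSec I M,
    (∀ i, SmoothOn U (e i)) ∧
      ∀ q ∈ U, LinearIndependent ℝ (fun i => e i q) ∧
        Submodule.span ℝ (range fun i => e i q) = F q
  signature : ∀ p : M, HasSignature (inn I p) (F p) k k

/-- `F` is a split structure on `M`. -/
def IsSplit (F : Fib I M) : Prop := ∃ k, IsSplitOfRank I k F

variable {I} in
/-- `F` and `F'` are orthogonal. -/
def Orthogonal (F F' : Fib I M) : Prop := ∀ p, ∀ x ∈ F p, ∀ y ∈ F' p, inn I p x y = 0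

/-- `V` is a framing of `F` on `U`: a real subspace of `Γ_U(F)` whose dimension is the rank of `F`
and which generates `Γ_U(F)` over `C^∞(U)`. -/
structure IsFraming (U : Set M) (F : Fib I M) (V : Submodule ℝ (GSec I M)) : Prop where
  le : ∀ v ∈ V, v ∈ secs I U F
  finite : Module.Finite ℝ V
  rank : ∀ p ∈ U, Module.finrank ℝ V = Module.finrank ℝ (F p)
  span : Submodule.span (smoothFun (M := M) I ℝ U) (V : Set (GSec I M)) = secs I U F

/-- `J ∈ SGF(F)`.  An endomorphism of the split structure `F` is encoded by its extension by zero on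
the orthogonal complement of `F`; so the direct sum of endomorphisms of mutually orthogonal split
structures is the sum of the encodings. -/
structure IsSGF (F : Fib I M) (J : EndFib I M) : Prop where
  split : IsSplit I F
  mem : ∀ p x, J p x ∈ F p
  zero : ∀ p x, (∀ y ∈ F p, inn I p x y = 0) → J p x = 0
  skew : ∀ p, ∀ x ∈ F p, ∀ y ∈ F p, inn I p (J p x) y = - inn I p x (J p y)
  orth : ∀ p, ∀ x ∈ F p, ∀ y ∈ F p, inn I p (J p x) (J p y) = inn I p x y
  smooth : ∀ U : Set M, IsOpen U → ∀ x : GSec I M, SmoothOn U x →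
    SmoothOn U (fun p => J p (x p) : GSec I M)

variable {I} in
/-- The `√-1`-eigenbundle `L_J ⊆ 𝕋M ⊗ ℂ` of `J`. -/
def eigL (J : EndFib I M) (p : M) : Submodule ℂ (CGT I p) :=
  Module.End.eigenspace (LinearMap.baseChange ℂ (J p)) Complex.I

/-- `J ∈ CRF(F)`: `J ∈ SGF(F)` and `Γ(L_J)` is closed under the Dorfman bracket. -/
structure IsCRF (F : Fib I M) (J : EndFib I M) : Prop extends IsSGF I F J where
  closed : ∀ s ∈ csecs I univ (eigL J), ∀ t ∈ csecs I univ (eigL J),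
    cdorfmanOn univ s t ∈ csecs I univ (eigL J)

/-- `I(J) = I(Γ(L_J))`. -/
def normalizerSGF (J : EndFib I M) : Set (CSec I M) :=
  normalizer I univ {s | s ∈ csecs I univ (eigL J)}

/-- `(J, V)` is a normal pair, where `J` is an endomorphism of `F` and `V` a framing of `F'`. -/
structure IsNormalPair (F F' : Fib I M) (J : EndFib I M) (V : Submodule ℝ (GSec I M)) :
    Prop where
  split : IsSplit I F'
  orthogonal : Orthogonal F F'
  crf : IsCRF I F J
  framing : IsFraming I univ F' V
  normalizes : ∀ v ∈ V, toC I M v ∈ normalizerSGF I J ∩ normalizerFib I univ F'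

/-! ### Admissible triples -/

/-- `F ⊗ ℂ`. -/
def fibC (F : Fib I M) (p : M) : Submodule ℂ (CGT I p) := (F p).baseChange ℂ

/-- `V ⊗ ℂ` as a complex subspace of the space of complex sections. -/
def framC (V : Submodule ℝ (GSec I M)) : Submodule ℂ (CSec I M) :=
  Submodule.span ℂ (toC I M '' (V : Set (GSec I M)))

/-- `(V₁, V₂, Ψ)` is an admissible triple, where `V_i` is a framing of `F_i`: there is an
isomorphism `φ : Γ(F₁ ⊗ ℂ) → Γ(F₂ ⊗ ℂ)` of `C^∞(M, ℂ)`-modules which maps `V₁ ⊗ ℂ` onto `V₂ ⊗ ℂ` and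
whose graph is `Γ(L_Ψ)`. -/
def IsAdmissible (F₁ F₂ : Fib I M) (V₁ V₂ : Submodule ℝ (GSec I M)) (Ψ : EndFib I M) : Prop :=
  ∃ φ : csecs I univ (fibC I F₁) ≃ₗ[smoothFun (M := M) I ℂ univ] csecs I univ (fibC I F₂),
    {s : CSec I M | ∃ e : csecs I univ (fibC I F₁), (e : CSec I M) ∈ framC I V₁ ∧ (φ e : CSec I M) = s} =
        {s | s ∈ framC I V₂} ∧
      {s : CSec I M | s ∈ csecs I univ (eigL Ψ)} =
        {s | ∃ e : csecs I univ (fibC I F₁), s = (e : CSec I M) + (φ e : CSec I M)}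

/-! ### Local framings -/

/-- Around each point there is a local framing `W` of `F` which normalizes `F ⊕ F'`. -/
def HasNormalizingFramings (F F' : Fib I M) : Prop :=
  ∀ p : M, ∃ U : Set M, IsOpen U ∧ p ∈ U ∧ ∃ W : Submodule ℝ (GSec I M),
    IsFraming I U F W ∧
      ∀ w ∈ W, toC I M w ∈ normalizerFib I U (fun q => F q ⊔ F' q)

/-- Around each point there is a local framing `W` of `F` which normalizes `F ⊕ F'` and satisfies
`d⟨W, J W⟩ ⊆ Γ(F ⊕ F')`. -/
def HasAdaptedFramings (F F' : Fib I M) (J : EndFib I M) : Prop :=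
  ∀ p : M, ∃ U : Set M, IsOpen U ∧ p ∈ U ∧ ∃ W : Submodule ℝ (GSec I M),
    IsFraming I U F W ∧
      (∀ w ∈ W, toC I M w ∈ normalizerFib I U (fun q => F q ⊔ F' q)) ∧
      ∀ w ∈ W, ∀ z ∈ W,
        dSec I U (fun q => inn I q (w q) (J q (z q))) ∈ secs I U (fun q => F q ⊔ F' q)

end Basic

/-! ### Products -/

section Product

variable {E₁ : Type*} [NormedAddCommGroup E₁] [NormedSpace ℝ E₁]
  {H₁ : Type*} [TopologicalSpace H₁] (I₁ : ModelWithCorners ℝ E₁ H₁)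
  {M₁ : Type*} [TopologicalSpace M₁] [ChartedSpace H₁ M₁]
  {E₂ : Type*} [NormedAddCommGroup E₂] [NormedSpace ℝ E₂]
  {H₂ : Type*} [TopologicalSpace H₂] (I₂ : ModelWithCorners ℝ E₂ H₂)
  {M₂ : Type*} [TopologicalSpace M₂] [ChartedSpace H₂ M₂]

/-- The map `(X, α) ↦ (A X, α ∘ B)` between fibres of generalized tangent bundles. -/
def transport {p : M₁} {q : M₂} (A : TangentSpace I₁ p →L[ℝ] TangentSpace I₂ q)
    (B : TangentSpace I₂ q →L[ℝ] TangentSpace I₁ p) : GT I₁ p →ₗ[ℝ] GT I₂ q where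
  toFun x := (A x.1, x.2.comp B)
  map_add' x y := by simp
  map_smul' c x := by simp

/-- The horizontal lift `T_{q₁}M₁ → T_q(M₁ × M₂)`, the differential of `p ↦ (p, q₂)`. -/
def lift₁ (q : M₁ × M₂) : TangentSpace I₁ q.1 →L[ℝ] TangentSpace (I₁.prod I₂) q :=
  mfderiv I₁ (I₁.prod I₂) (fun p : M₁ => (p, q.2)) q.1

/-- The horizontal lift `T_{q₂}M₂ → T_q(M₁ × M₂)`, the differential of `p ↦ (q₁, p)`. -/
def lift₂ (q : M₁ × M₂) : TangentSpace I₂ q.2 →L[ℝ] TangentSpace (I₁.prod I₂) q :=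
  mfderiv I₂ (I₁.prod I₂) (fun p : M₂ => (q.1, p)) q.2

/-- `Tπ₁`. -/
def proj₁ (q : M₁ × M₂) : TangentSpace (I₁.prod I₂) q →L[ℝ] TangentSpace I₁ q.1 :=
  mfderiv (I₁.prod I₂) I₁ Prod.fst q

/-- `Tπ₂`. -/
def proj₂ (q : M₁ × M₂) : TangentSpace (I₁.prod I₂) q →L[ℝ] TangentSpace I₂ q.2 :=
  mfderiv (I₁.prod I₂) I₂ Prod.snd q

/-- `π₁^* : 𝕋_{q₁}M₁ → 𝕋_q(M₁ × M₂)`: horizontal lift of vectors, pull-back of covectors. -/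
def pull₁ (q : M₁ × M₂) : GT I₁ q.1 →ₗ[ℝ] GT (I₁.prod I₂) q :=
  transport I₁ (I₁.prod I₂) (lift₁ I₁ I₂ q) (proj₁ I₁ I₂ q)

/-- `π₂^* : 𝕋_{q₂}M₂ → 𝕋_q(M₁ × M₂)`. -/
def pull₂ (q : M₁ × M₂) : GT I₂ q.2 →ₗ[ℝ] GT (I₁.prod I₂) q :=
  transport I₂ (I₁.prod I₂) (lift₂ I₁ I₂ q) (proj₂ I₁ I₂ q)

/-- The projection `𝕋_q(M₁ × M₂) → 𝕋_{q₁}M₁`, the left inverse of `π₁^*` which vanishes on the image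
of `π₂^*`. -/
def push₁ (q : M₁ × M₂) : GT (I₁.prod I₂) q →ₗ[ℝ] GT I₁ q.1 :=
  transport (I₁.prod I₂) I₁ (proj₁ I₁ I₂ q) (lift₁ I₁ I₂ q)

/-- The projection `𝕋_q(M₁ × M₂) → 𝕋_{q₂}M₂`. -/
def push₂ (q : M₁ × M₂) : GT (I₁.prod I₂) q →ₗ[ℝ] GT I₂ q.2 :=
  transport (I₁.prod I₂) I₂ (proj₂ I₁ I₂ q) (lift₂ I₁ I₂ q)

/-- `π₁^* F`. -/
def pullFib₁ (F : Fib I₁ M₁) : Fib (I₁.prod I₂) (M₁ × M₂) :=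
  fun q => (F q.1).map (pull₁ I₁ I₂ q)

/-- `π₂^* F`. -/
def pullFib₂ (F : Fib I₂ M₂) : Fib (I₁.prod I₂) (M₁ × M₂) :=
  fun q => (F q.2).map (pull₂ I₁ I₂ q)

/-- The external sum `F₁ ⊞ F₂ = π₁^* F₁ ⊕ π₂^* F₂`. -/
def boxSum (F₁ : Fib I₁ M₁) (F₂ : Fib I₂ M₂) : Fib (I₁.prod I₂) (M₁ × M₂) :=
  fun q => pullFib₁ I₁ I₂ F₁ q ⊔ pullFib₂ I₁ I₂ F₂ q

/-- `π₁^* J`, extended by zero. -/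
def pullEnd₁ (J : EndFib I₁ M₁) : EndFib (I₁.prod I₂) (M₁ × M₂) :=
  fun q => pull₁ I₁ I₂ q ∘ₗ J q.1 ∘ₗ push₁ I₁ I₂ q

/-- `π₂^* J`, extended by zero. -/
def pullEnd₂ (J : EndFib I₂ M₂) : EndFib (I₁.prod I₂) (M₁ × M₂) :=
  fun q => pull₂ I₁ I₂ q ∘ₗ J q.2 ∘ₗ push₂ I₁ I₂ q

/-- `π₁^*` on sections. -/
def pullSec₁ : GSec I₁ M₁ →ₗ[ℝ] GSec (I₁.prod I₂) (M₁ × M₂) where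
  toFun x q := pull₁ I₁ I₂ q (x q.1)
  map_add' x y := by funext q; simp
  map_smul' c x := by funext q; simp

/-- `π₂^*` on sections. -/
def pullSec₂ : GSec I₂ M₂ →ₗ[ℝ] GSec (I₁.prod I₂) (M₁ × M₂) where
  toFun x q := pull₂ I₁ I₂ q (x q.2)
  map_add' x y := by funext q; simp
  map_smul' c x := by funext q; simp

/-- The Morimoto product `J₁ ⊞_Ψ J₂ = π₁^* J₁ ⊕ π₂^* J₂ ⊕ Ψ`. -/
def morimotoProduct (J₁ : EndFib I₁ M₁) (J₂ : EndFib I₂ M₂)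
    (Ψ : EndFib (I₁.prod I₂) (M₁ × M₂)) : EndFib (I₁.prod I₂) (M₁ × M₂) :=
  fun q => pullEnd₁ I₁ I₂ J₁ q + pullEnd₂ I₁ I₂ J₂ q + Ψ q

variable [IsManifold I₁ ∞ M₁] [IsManifold I₂ ∞ M₂]

/-- `(J₁, J₂, V₁, V₂, Ψ)` is an external Morimoto datum on `M₁ × M₂`, with underlying split structures
`F_i` and `F_i'` on `M_i`. -/
structure IsExternalMorimotoDatum
    (F₁ F₁' : Fib I₁ M₁) (F₂ F₂' : Fib I₂ M₂) (J₁ : EndFib I₁ M₁) (J₂ : EndFib I₂ M₂)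
    (V₁ : Submodule ℝ (GSec I₁ M₁)) (V₂ : Submodule ℝ (GSec I₂ M₂))
    (Ψ : EndFib (I₁.prod I₂) (M₁ × M₂)) : Prop where
  split₁ : IsSplit I₁ F₁
  split₂ : IsSplit I₂ F₂
  split₁' : IsSplit I₁ F₁'
  split₂' : IsSplit I₂ F₂'
  orthogonal₁ : Orthogonal F₁ F₁'
  orthogonal₂ : Orthogonal F₂ F₂'
  sgf₁ : IsSGF I₁ F₁ J₁
  sgf₂ : IsSGF I₂ F₂ J₂
  framing₁ : IsFraming I₁ univ F₁' V₁
  framing₂ : IsFraming I₂ univ F₂' V₂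
  sgf : IsSGF (I₁.prod I₂) (boxSum I₁ I₂ F₁' F₂') Ψ
  normalizes₁ : ∀ v ∈ V₁, toC I₁ M₁ v ∈ normalizerFib I₁ univ (fun p => F₁ p ⊔ F₁' p)
  normalizes₂ : ∀ v ∈ V₂, toC I₂ M₂ v ∈ normalizerFib I₂ univ (fun p => F₂ p ⊔ F₂' p)
  local₁ : HasNormalizingFramings I₁ F₁ F₁'
  local₂ : HasNormalizingFramings I₂ F₂ F₂'
  admissible : IsAdmissible (I₁.prod I₂) (pullFib₁ I₁ I₂ F₁') (pullFib₂ I₁ I₂ F₂')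
    (V₁.map (pullSec₁ I₁ I₂)) (V₂.map (pullSec₂ I₁ I₂)) Ψ

/-- An adaptable external Morimoto datum. -/
structure IsAdaptableExternalMorimotoDatum
    (F₁ F₁' : Fib I₁ M₁) (F₂ F₂' : Fib I₂ M₂) (J₁ : EndFib I₁ M₁) (J₂ : EndFib I₂ M₂)
    (V₁ : Submodule ℝ (GSec I₁ M₁)) (V₂ : Submodule ℝ (GSec I₂ M₂))
    (Ψ : EndFib (I₁.prod I₂) (M₁ × M₂)) : Prop
    extends IsExternalMorimotoDatum I₁ I₂ F₁ F₁' F₂ F₂' J₁ J₂ V₁ V₂ Ψ where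
  adapted₁ : HasAdaptedFramings I₁ F₁ F₁' J₁
  adapted₂ : HasAdaptedFramings I₂ F₂ F₂' J₂

end Product

end GenGeom

end

/-!
Integrability of a Morimoto product `J = π₁^* J₁ ⊕ π₂^* J₂ ⊕ Ψ` is a condition on Dorfman brackets
of sections of `L_J`. Since `J` is skew, `L_J` is isotropic, so that the bracket is skew on its
sections and the terms by which it fails to be bilinear over functions are again combinations of
the given sections. It is therefore enough to know the brackets of local generators
(`IsSGF.br_mem`). Complex sections are treated as pairs of real ones.

Here there are three kinds of generators: pull-backs of sections of `L_{J₁}`, pull-backs of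
sections of `L_{J₂}`, and sections of `L_Ψ` (`IsMorimoto.exists_span`). On a product, the Dorfman
bracket of pull-backs from one factor is the pull-back of the bracket, and the bracket of
pull-backs from different factors vanishes (`Factor.IsCompl.dorfman_pullSec`,
`Factor.IsCompl.dorfman_pullSec_pullSec`). Both are read off from a formula for `⟨[x, y], z⟩` in
terms of Lie brackets and derivatives of functions (`inn_dorfman`), which also gives the invariance
of the inner product and the Leibniz rules. Admissibility says that `L_Ψ` is the graph of an
isomorphism `φ` which takes `V₁ ⊗ ℂ` to `V₂ ⊗ ℂ`. Thus `L_Ψ` is generated by the `v + φ(v)` with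
`v ∈ V₁`, and contains no non-zero element pulled back from one of the factors
(`IsAdmissible.isTransversal`); consequently a pull-back from the first factor which lies in `L_J`
comes from `L_{J₁}` (`IsMorimoto.eigPair_of_pull`).

If `J` is integrable, brackets of pull-backs of sections of `L_{J₁}` show that `L_{J₁}` is closed,
and brackets of `v + φ(v)` with such pull-backs, which are the pull-backs of `[v, ·]`, show that
`V₁` normalizes `L_{J₁}`, and hence `F₁`. By hypothesis `V₁` normalizes `F₁ ⊕ F₁'`, so by
invariance of the inner product it normalizes the orthogonal complement `F₁'` of `F₁` in it
(`IsMorimoto.isNormalPair_left`). Brackets of the generators of `L_Ψ` now remain in `F₁' ⊞ F₂'`,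
where `L_J` is `L_Ψ`, so `Ψ` is integrable (`IsMorimoto.isCRF_psi`).

Conversely, let both pairs be normal and `Ψ` be integrable. Brackets of generators of the same kind
are in `L_J` by integrability of `J₁`, `J₂` and `Ψ`, those of pull-backs from different factors
vanish, and those of a generator of `L_Ψ` with a pull-back from the first factor are pull-backs of
`[v, t]` with `v ∈ V₁ ⊗ ℂ` and `t` a section of `L_{J₁}`, hence in `L_J` by normality
(`IsMorimoto.isCRF_morimoto`).
-/

noncomputable section

namespace GenGeom

/-! ### Differential calculus in charts -/

section Calculus

variable {E : Type*} [NormedAddCommGroup E] [NormedSpace ℝ E]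
  {H : Type*} [TopologicalSpace H] {I : ModelWithCorners ℝ E H}
  {M : Type*} [TopologicalSpace M] [ChartedSpace H M]

/-- The derivative of a function, read in the preferred chart at the base point. -/
lemma mvfderiv_eq_fderivWithin {f : M → ℝ} {p : M} (hf : MDifferentiableAt I 𝓘(ℝ, ℝ) f p)
    (v : TangentSpace I p) :
    mvfderiv I f p v =
      fderivWithin ℝ (f ∘ (extChartAt I p).symm) (range I) (extChartAt I p p) v := by
  rw [hf.mvfderiv]
  rfl

variable [IsManifold I ∞ M]

/-- On a neighbourhood of the base point, the chart expression of a 1-form is its expression in the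
trivialization of the tangent bundle, so that smoothness as a section can be transferred to it. -/
lemma formInChart_eventuallyEq (α : ∀ q : M, TangentSpace I q →L[ℝ] ℝ) (p : M) :
    ∀ᶠ u in nhdsWithin (extChartAt I p p) (range I), formInChart α p u =
      ContinuousLinearMap.inCoordinates E (TangentSpace I : M → Type _) ℝ (Trivial M ℝ) p
        ((extChartAt I p).symm u) p ((extChartAt I p).symm u) (α ((extChartAt I p).symm u)) := by
  filter_upwards [extChartAt_target_mem_nhdsWithin (I := I) p] with u hu
  have hs : (extChartAt I p).symm u ∈ (chartAt H p).source := by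
    simpa using (extChartAt I p).map_target hu
  ext v
  simp only [formInChart, ContinuousLinearMap.inCoordinates, ContinuousLinearMap.comp_apply]
  rw [TangentBundle.symmL_trivializationAt hs, (extChartAt I p).right_inv hu]
  simp
  rfl

/-- A 1-form which is differentiable as a section has a differentiable chart expression. -/
lemma differentiableWithinAt_formInChart {α : ∀ q : M, TangentSpace I q →L[ℝ] ℝ} {p : M}
    (hα : MDifferentiableAt I (I.prod 𝓘(ℝ, E →L[ℝ] ℝ))
      (fun p => (TotalSpace.mk' (E →L[ℝ] ℝ) p (α p) :
        TotalSpace (E →L[ℝ] ℝ) (fun p : M => TangentSpace I p →L[ℝ] Trivial M ℝ p))) p) :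
    DifferentiableWithinAt ℝ (formInChart α p) (range I) (extChartAt I p p) := by
  rw [mdifferentiableAt_hom_bundle] at hα
  have h := hα.2
  have h2 : MDifferentiableWithinAt 𝓘(ℝ, E) I (extChartAt I p).symm (range I) (extChartAt I p p) :=
    mdifferentiableWithinAt_extChartAt_symm (mem_extChartAt_target p)
  have h4 := (MDifferentiableAt.comp_mdifferentiableWithinAt_of_eq (extChartAt I p p) h h2
    (extChartAt_to_inv (I := I) p)).differentiableWithinAt
  refine h4.congr_of_eventuallyEq (formInChart_eventuallyEq α p) ?_
  exact (formInChart_eventuallyEq α p).self_of_nhdsWithin (mem_range_self _)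

/-- The expression of a vector field `X` in the preferred chart at `p`. -/
def vecInChart (X : ∀ q : M, TangentSpace I q) (p : M) : E → E :=
  VectorField.mpullbackWithin 𝓘(ℝ, E) I (extChartAt I p).symm X (range I)

lemma vecInChart_self (X : ∀ q : M, TangentSpace I q) (p : M) :
    vecInChart X p (extChartAt I p p) = X p := by
  have h := mfderivWithin_extChartAt_symm_inverse_apply (I := I) (x := p)
  simp only [vecInChart, VectorField.mpullbackWithin]
  refine Eq.trans (h _) ?_
  have := extChartAt_to_inv (I := I) p
  exact congrArg (fun q => (X q : E)) this

lemma formInChart_self (α : ∀ q : M, TangentSpace I q →L[ℝ] ℝ) (p : M) (v : E) :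
    formInChart α p (extChartAt I p p) v = α p v := by
  have h : (mfderivWithin 𝓘(ℝ, E) I (extChartAt I p).symm (range I) (extChartAt I p p) v : E) = v :=
    congrArg (fun A : E →L[ℝ] E => A v) (mfderivWithin_range_extChartAt_symm (I := I) (x := p))
  let α' : M → E →L[ℝ] ℝ := α
  have h' := congrArg α' (extChartAt_to_inv (I := I) p)
  change (α ((extChartAt I p).symm (extChartAt I p p)) : E →L[ℝ] ℝ) (mfderivWithin 𝓘(ℝ, E) I
    (extChartAt I p).symm (range I) (extChartAt I p p) v : E) = (α p : E →L[ℝ] ℝ) v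
  exact (congrArg (α ((extChartAt I p).symm (extChartAt I p p)) : E →L[ℝ] ℝ) h).trans
    (congrArg (fun A : E →L[ℝ] ℝ => A v) h')

/-- The Lie bracket `[X, Y] = D_X Y - D_Y X` in the preferred chart at the base point, where the
differential of the chart is the identity. -/
lemma mlieBracket_eq_chart (X Y : ∀ q : M, TangentSpace I q) (p : M) :
    VectorField.mlieBracket I X Y p =
      fderivWithin ℝ (vecInChart Y p) (range I) (extChartAt I p p) (X p)
      - fderivWithin ℝ (vecInChart X p) (range I) (extChartAt I p p) (Y p) := by
  have h : ∀ w : E, ((mfderiv I 𝓘(ℝ, E) (extChartAt I p) p).inverse w : E) = w := fun w =>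
    ((isInvertible_mfderiv_extChartAt (mem_extChartAt_source p)).inverse_apply_eq).2
      (congrArg (fun A : E →L[ℝ] E => A w) (mfderiv_extChartAt_self (I := I) (x := p))).symm
  rw [VectorField.mlieBracket, VectorField.mlieBracketWithin_apply, ← vecInChart_self X p,
    ← vecInChart_self Y p, preimage_univ, univ_inter]
  exact h _

lemma extD_eq_chart (α : ∀ q : M, TangentSpace I q →L[ℝ] ℝ) (p : M) (v w : TangentSpace I p) :
    extD α p v w = fderivWithin ℝ (formInChart α p) (range I) (extChartAt I p p) v w
      - fderivWithin ℝ (formInChart α p) (range I) (extChartAt I p p) w v := by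
  simp only [extD, mfderiv_extChartAt_self]
  rfl

/-- Cartan's formula `dα(X, Y) = X(α(Y)) - Y(α(X)) - α([X, Y])`. -/
theorem extD_apply [CompleteSpace E] {α : ∀ q : M, TangentSpace I q →L[ℝ] ℝ}
    {X Y : ∀ q : M, TangentSpace I q} {p : M}
    (hα : MDifferentiableAt I (I.prod 𝓘(ℝ, E →L[ℝ] ℝ))
      (fun p => (TotalSpace.mk' (E →L[ℝ] ℝ) p (α p) :
        TotalSpace (E →L[ℝ] ℝ) (fun p : M => TangentSpace I p →L[ℝ] Trivial M ℝ p))) p)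
    (hX : MDifferentiableAt I (I.prod 𝓘(ℝ, E))
      (fun p => (TotalSpace.mk' E p (X p) : TotalSpace E (TangentSpace I : M → Type _))) p)
    (hY : MDifferentiableAt I (I.prod 𝓘(ℝ, E))
      (fun p => (TotalSpace.mk' E p (Y p) : TotalSpace E (TangentSpace I : M → Type _))) p) :
    extD α p (X p) (Y p) = mvfderiv I (fun q => α q (Y q)) p (X p)
      - mvfderiv I (fun q => α q (X q)) p (Y p) - α p (VectorField.mlieBracket I X Y p) := by
  -- in the chart at `p`, `v(α(Z)) = (D_v α)(Z) + α(D_v Z)`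
  have key : ∀ {Z : ∀ q : M, TangentSpace I q}, MDifferentiableAt I (I.prod 𝓘(ℝ, E))
      (fun p => (TotalSpace.mk' E p (Z p) : TotalSpace E (TangentSpace I : M → Type _))) p →
      ∀ v : TangentSpace I p, mvfderiv I (fun q => α q (Z q)) p v =
        fderivWithin ℝ (formInChart α p) (range I) (extChartAt I p p) v (Z p)
        + α p (fderivWithin ℝ (vecInChart Z p) (range I) (extChartAt I p p) v) := by
    intro Z hZ v
    have hαZ : MDifferentiableAt I 𝓘(ℝ, ℝ) (fun q => α q (Z q)) p := by
      have := MDifferentiableAt.clm_bundle_apply hα hZ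
      rw [mdifferentiableAt_totalSpace] at this
      exact this.2
    rw [mvfderiv_eq_fderivWithin hαZ]
    have hZ' : DifferentiableWithinAt ℝ (vecInChart Z p) (range I) (extChartAt I p p) := by
      have := MDifferentiableWithinAt.differentiableWithinAt_mpullbackWithin_vectorField
        (mdifferentiableWithinAt_univ.2 hZ)
      rw [preimage_univ, univ_inter] at this
      exact this
    have e : (fun q => α q (Z q)) ∘ (extChartAt I p).symm
        =ᶠ[nhdsWithin (extChartAt I p p) (range I)]
        fun u => formInChart α p u (vecInChart Z p u) := by
      filter_upwards [extChartAt_target_mem_nhdsWithin (I := I) p] with u hu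
      exact congrArg (α ((extChartAt I p).symm u))
        ((isInvertible_mfderivWithin_extChartAt_symm hu).self_apply_inverse _).symm
    have hd := fderivWithin_clm_apply (s := range I) (x := extChartAt I p p)
      (I.uniqueDiffOn _ (mem_range_self _)) (differentiableWithinAt_formInChart hα) hZ'
    -- the identification of `T_pM` with the model space by the chart at `p` is the identity
    rw [e.fderivWithin_eq (e.self_of_nhdsWithin (mem_range_self _))]
    refine (congrArg (fun A : E →L[ℝ] ℝ => A v) hd).trans ?_
    have hv := vecInChart_self Z p
    have ha := formInChart_self α p
      (fderivWithin ℝ (vecInChart Z p) (range I) (extChartAt I p p) v)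
    rw [add_comm]
    exact congrArg₂ (· + ·)
      (congrArg (fderivWithin ℝ (formInChart α p) (range I) (extChartAt I p p) v) hv) ha
  rw [key hY, key hX, mlieBracket_eq_chart, extD_eq_chart]
  have alg : ∀ (D : E →L[ℝ] E →L[ℝ] ℝ) (a : E →L[ℝ] ℝ) (A B : E →L[ℝ] E) (x y : E),
      D x y - D y x = D x y + a (A x) - (D y x + a (B y)) - a (A x - B y) := by
    intro D a A B x y
    rw [map_sub]; ring
  exact alg _ _ _ _ _ _

/-- The differential of a smooth function is a smooth section of `T^*M`. -/
lemma contMDiff_mvfderiv {f : M → ℝ} (hf : ContMDiff I 𝓘(ℝ, ℝ) ∞ f) :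
    ContMDiff I (I.prod 𝓘(ℝ, E →L[ℝ] ℝ)) ∞
      (fun p => (TotalSpace.mk' (E →L[ℝ] ℝ) p (mvfderiv I f p) :
        TotalSpace (E →L[ℝ] ℝ) (fun p : M => TangentSpace I p →L[ℝ] Trivial M ℝ p))) := by
  intro p
  rw [contMDiffAt_hom_bundle]
  refine ⟨contMDiffAt_id, ?_⟩
  have h := (hf p).mfderiv_const (m := ∞) (by simp)
  refine h.congr_of_eventuallyEq ?_
  filter_upwards [(chartAt H p).open_source.mem_nhds (mem_chart_source H p)] with q hq
  ext v
  simp [inTangentCoordinates, ContinuousLinearMap.inCoordinates]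
  rfl

/-- `d(df) = 0`. -/
lemma extD_mvfderiv [I.Boundaryless] {f : M → ℝ} (hf : ContMDiff I 𝓘(ℝ, ℝ) ∞ f) (p : M)
    (v w : TangentSpace I p) : extD (mvfderiv I f) p v w = 0 := by
  rw [extD_eq_chart, sub_eq_zero]
  have hc : ContDiffAt ℝ ∞ (f ∘ (extChartAt I p).symm) (extChartAt I p p) := by
    have h0 : ContMDiffAt 𝓘(ℝ, E) I ∞ (extChartAt I p).symm (extChartAt I p p) := by
      have := contMDiffWithinAt_extChartAt_symm_range (n := ∞) (I := I) p
        (mem_extChartAt_target p)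
      rwa [I.range_eq_univ, contMDiffWithinAt_univ] at this
    exact (ContMDiffAt.comp (extChartAt I p p) (hf _) h0).contDiffAt
  -- in the chart, `df` is the derivative of `f ∘ chart⁻¹`; conclude by symmetry of the second one
  have e : formInChart (mvfderiv I f) p =ᶠ[nhdsWithin (extChartAt I p p) (range I)]
      fderiv ℝ (f ∘ (extChartAt I p).symm) := by
    filter_upwards [extChartAt_target_mem_nhdsWithin (I := I) p] with u hu
    have h1 := mvfderiv_comp_mfderivWithin (g := f) (f := (extChartAt I p).symm) (s := range I) u
      ((hf _).mdifferentiableAt (by simp)) (mdifferentiableWithinAt_extChartAt_symm hu)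
      (I.uniqueMDiffOn u (extChartAt_target_subset_range p hu))
    have h2 : mvfderivWithin 𝓘(ℝ, E) (f ∘ (extChartAt I p).symm) (range I) u =
        fderiv ℝ (f ∘ (extChartAt I p).symm) u := by
      rw [I.range_eq_univ, mvfderivWithin_univ, ← mfderiv_eq_fderiv]
      rfl
    exact h1.symm.trans h2
  rw [I.range_eq_univ, nhdsWithin_univ] at e
  have := (hc.isSymmSndFDerivAt (by simp; norm_cast)).eq v w
  rw [I.range_eq_univ, fderivWithin_univ, e.fderiv_eq]
  exact this

/-- The Lie bracket acts on functions as the commutator of derivations. -/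
lemma mvfderiv_mlieBracket [CompleteSpace E] [I.Boundaryless] {f : M → ℝ}
    (hf : ContMDiff I 𝓘(ℝ, ℝ) ∞ f)
    {X Y : ∀ q : M, TangentSpace I q} {p : M}
    (hX : MDifferentiableAt I (I.prod 𝓘(ℝ, E))
      (fun p => (TotalSpace.mk' E p (X p) : TotalSpace E (TangentSpace I : M → Type _))) p)
    (hY : MDifferentiableAt I (I.prod 𝓘(ℝ, E))
      (fun p => (TotalSpace.mk' E p (Y p) : TotalSpace E (TangentSpace I : M → Type _))) p) :
    mvfderiv I f p (VectorField.mlieBracket I X Y p) =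
      mvfderiv I (fun q => mvfderiv I f q (Y q)) p (X p)
      - mvfderiv I (fun q => mvfderiv I f q (X q)) p (Y p) := by
  have h := extD_apply ((contMDiff_mvfderiv hf p).mdifferentiableAt (by simp)) hX hY
  rw [extD_mvfderiv hf] at h
  linarith

end Calculus

/-! ### Smooth sections and local frames of `𝕋M` -/

section Frames

variable {E : Type*} [NormedAddCommGroup E] [NormedSpace ℝ E]
  {H : Type*} [TopologicalSpace H] {I : ModelWithCorners ℝ E H}
  {M : Type*} [TopologicalSpace M] [ChartedSpace H M]

lemma inn_apply (p : M) (x y : GT I p) : inn I p x y = (1 / 2 : ℝ) * (x.2 y.1 + y.2 x.1) := rfl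

lemma inn_comm (p : M) (x y : GT I p) : inn I p x y = inn I p y x := by
  rw [inn_apply, inn_apply, add_comm]

variable [IsManifold I ∞ M]

lemma SmoothOn.mono {U V : Set M} {x : GSec I M} (hx : SmoothOn U x) (h : V ⊆ U) : SmoothOn V x :=
  ⟨hx.1.mono h, hx.2.mono h⟩

lemma SmoothOn.contMDiffOn_inn {U : Set M} {x y : GSec I M} (hx : SmoothOn U x)
    (hy : SmoothOn U y) :
    ContMDiffOn I 𝓘(ℝ, ℝ) ∞ (fun p => inn I p (x p) (y p)) U := by
  have key : ∀ {x y : GSec I M}, SmoothOn U x → SmoothOn U y →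
      ContMDiffOn I 𝓘(ℝ, ℝ) ∞ (fun p => (x p).2 (y p).1) U := by
    intro x y hx hy p hp
    have := ContMDiffWithinAt.clm_bundle_apply (hx.2 p hp) (hy.1 p hp)
    rw [contMDiffWithinAt_totalSpace] at this
    exact this.2
  exact contMDiffOn_const.mul ((key hx hy).add (key hy hx))

/-- Smoothness is a local property, tested by comparison with globally smooth sections. -/
lemma smoothOn_of_local {U : Set M} {x : GSec I M}
    (h : ∀ p ∈ U, ∃ y : GSec I M, SmoothOn univ y ∧ ∀ᶠ q in nhds p, x q = y q) : SmoothOn U x := by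
  constructor
  · intro p hp
    obtain ⟨y, hy, e⟩ := h p hp
    refine ContMDiffAt.contMDiffWithinAt ?_
    refine ((contMDiffOn_univ.1 hy.1) p).congr_of_eventuallyEq ?_
    filter_upwards [e] with q hq
    rw [hq]
  · intro p hp
    obtain ⟨y, hy, e⟩ := h p hp
    refine ContMDiffAt.contMDiffWithinAt ?_
    refine ((contMDiffOn_univ.1 hy.2) p).congr_of_eventuallyEq ?_
    filter_upwards [e] with q hq
    rw [hq]

/-- A section over `U`, cut off by a function supported in `U`, is globally smooth. -/
lemma SmoothOn.cutoff {U : Set M} (hU : IsOpen U) {x : GSec I M} {χ : M → ℝ}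
    (hχ : ContMDiff I 𝓘(ℝ, ℝ) ∞ χ) (hs : tsupport χ ⊆ U) (hx : SmoothOn U x) :
    SmoothOn univ (χ • x) := by
  have h1 := hx.smul hχ.contMDiffOn
  have h0 := SmoothOn.zero (M := M) I univ
  have hz : ∀ p ∉ U, ∀ᶠ q in nhds p, (χ • x) q = (0 : GSec I M) q := by
    intro p hp
    filter_upwards [(isClosed_tsupport χ).isOpen_compl.mem_nhds (fun h => hp (hs h))] with q hq
    simp [image_eq_zero_of_notMem_tsupport hq]
  constructor
  · intro p _
    refine ContMDiffAt.contMDiffWithinAt ?_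
    by_cases hp : p ∈ U
    · exact (h1.1 p hp).contMDiffAt (hU.mem_nhds hp)
    · refine ((contMDiffOn_univ.1 h0.1) p).congr_of_eventuallyEq ?_
      filter_upwards [hz p hp] with q hq
      rw [hq]
  · intro p _
    refine ContMDiffAt.contMDiffWithinAt ?_
    by_cases hp : p ∈ U
    · exact (h1.2 p hp).contMDiffAt (hU.mem_nhds hp)
    · refine ((contMDiffOn_univ.1 h0.2) p).congr_of_eventuallyEq ?_
      filter_upwards [hz p hp] with q hq
      rw [hq]

/-- Smooth cut-off functions which are `1` near `p`. -/
lemma exists_bump [FiniteDimensional ℝ E] [T2Space M] {U : Set M} {p : M} (hU : U ∈ nhds p) :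
    ∃ χ : M → ℝ, ContMDiff I 𝓘(ℝ, ℝ) ∞ χ ∧ (∀ᶠ q in nhds p, χ q = 1) ∧ tsupport χ ⊆ U := by
  obtain ⟨χ, h, -⟩ := (SmoothBumpFunction.nhds_basis_support (I := I) hU).mem_iff.1 hU
  exact ⟨χ, χ.contMDiff, χ.eventuallyEq_one, h⟩

lemma smoothOn_vec {U : Set M} {X : ∀ p : M, TangentSpace I p}
    (hX : ContMDiffOn I (I.prod 𝓘(ℝ, E)) ∞
      (fun p => (TotalSpace.mk' E p (X p) : TotalSpace E (TangentSpace I : M → Type _))) U) :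
    SmoothOn U (fun p => (X p, 0) : GSec I M) :=
  ⟨hX, (SmoothOn.zero I U).2⟩

variable (I) in
/-- The differential of a function as a section of `𝕋M`. -/
def diffSec (f : M → ℝ) : GSec I M := fun p => (0, mvfderiv I f p)

lemma smoothOn_diffSec {f : M → ℝ} (hf : ContMDiff I 𝓘(ℝ, ℝ) ∞ f) : SmoothOn univ (diffSec I f) :=
  ⟨(SmoothOn.zero I univ).1, (contMDiff_mvfderiv hf).contMDiffOn⟩

/-- Coordinate functions near `p` and the coordinate vector fields, cut off to global objects. The
cut-off function is `1` near `p`, so the duality between them persists there. -/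
lemma exists_coordinates [FiniteDimensional ℝ E] [T2Space M] (p : M) :
    ∃ (f : Fin (Module.finrank ℝ E) → M → ℝ)
      (X : Fin (Module.finrank ℝ E) → ∀ q : M, TangentSpace I q),
      (∀ i, ContMDiff I 𝓘(ℝ, ℝ) ∞ (f i)) ∧ (∀ i, SmoothOn univ (fun q => (X i q, 0) : GSec I M)) ∧
      ∀ᶠ q in nhds p, ∀ v : TangentSpace I q, v = ∑ i, mvfderiv I (f i) q v • X i q := by
  let b := Module.finBasis ℝ E
  let e := trivializationAt E (TangentSpace I : M → Type _) p
  have hU := (chartAt H p).open_source.mem_nhds (mem_chart_source H p)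
  obtain ⟨χ, hχ, h1, hs⟩ := exists_bump (I := I) hU
  have hc : ∀ i, ContMDiffOn I 𝓘(ℝ, ℝ) ∞ (fun q => b.coord i (extChartAt I p q))
      (chartAt H p).source := by
    intro i
    exact (LinearMap.toContinuousLinearMap (b.coord i)).contMDiff.comp_contMDiffOn
      contMDiffOn_extChartAt
  refine ⟨fun i q => χ q * b.coord i (extChartAt I p q),
    fun i q => χ q • e.symmL ℝ q (b i), ?_, ?_, ?_⟩
  · intro i
    refine contMDiff_of_tsupport fun q hq => ?_
    have hq' : q ∈ (chartAt H p).source := hs (tsupport_mul_subset_left hq)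
    exact (hχ q).mul ((hc i).contMDiffAt ((chartAt H p).open_source.mem_nhds hq'))
  · intro i
    have : SmoothOn (chartAt H p).source (fun q => (e.symmL ℝ q (b i), 0) : GSec I M) := by
      apply smoothOn_vec
      intro q hq
      have h := e.contMDiffOn_symmL (IB := I) (n := ∞) q hq
      refine h.clm_bundle_apply (v := fun _ => b i) ?_
      rw [contMDiffWithinAt_totalSpace]
      exact ⟨contMDiffWithinAt_id, contMDiffWithinAt_const⟩
    have := this.cutoff (chartAt H p).open_source hχ hs
    convert this using 2 with q
    simp
  · filter_upwards [h1.eventually_nhds, hU] with q hq hq' v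
    have hd : ∀ i, mvfderiv I (fun q => χ q * b.coord i (extChartAt I p q)) q v =
        b.coord i (e.continuousLinearMapAt ℝ q v) := by
      intro i
      have e1 : (fun q => χ q * b.coord i (extChartAt I p q)) =ᶠ[nhds q]
          (LinearMap.toContinuousLinearMap (b.coord i)) ∘ (extChartAt I p) := by
        filter_upwards [hq] with r hr
        simp [hr]
      have e2 : mvfderiv I (fun q => χ q * b.coord i (extChartAt I p q)) q =
          mvfderiv I ((LinearMap.toContinuousLinearMap (b.coord i)) ∘ (extChartAt I p)) q :=
        e1.mfderiv_eq
      rw [e2, mvfderiv_comp_apply q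
        (LinearMap.toContinuousLinearMap (b.coord i)).mdifferentiableAt
        (mdifferentiableAt_extChartAt hq'),
        TangentBundle.continuousLinearMapAt_trivializationAt hq']
      exact congrArg (fun A : E →L[ℝ] ℝ => A (mfderiv I 𝓘(ℝ, E) (extChartAt I p) q v))
        ((mfderiv_eq_fderiv (f := LinearMap.toContinuousLinearMap (b.coord i))).trans
          (LinearMap.toContinuousLinearMap (b.coord i)).fderiv)
    simp only [hd, hq.self_of_nhds, one_smul]
    have := e.symmL_continuousLinearMapAt (R := ℝ) (b := q) hq' v
    rw [← this]
    conv_lhs => rw [← b.sum_repr (e.continuousLinearMapAt ℝ q v)]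
    rw [map_sum]
    refine Finset.sum_congr rfl fun i _ => ?_
    rw [map_smul]
    congr 1
    rw [e.continuousLinearMapAt_symmL (R := ℝ) (b := q) hq']
    rfl

lemma SmoothOn.const_smul {U : Set M} {x : GSec I M} (c : ℝ) (hx : SmoothOn U x) :
    SmoothOn U (c • x) :=
  SmoothOn.smul (f := fun _ => c) contMDiffOn_const hx

lemma SmoothOn.neg {U : Set M} {x : GSec I M} (hx : SmoothOn U x) : SmoothOn U (-x) := by
  rw [← neg_one_smul ℝ x]
  exact hx.const_smul (-1)

lemma SmoothOn.sum {U : Set M} {ι : Type*} (s : Finset ι) {x : ι → GSec I M}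
    (hx : ∀ i, SmoothOn U (x i)) : SmoothOn U (∑ i ∈ s, x i) := by
  classical
  induction s using Finset.induction_on with
  | empty => simpa using SmoothOn.zero I U
  | insert i s hi ih => rw [Finset.sum_insert hi]; exact (hx i).add ih

/-- Near each point, `𝕋M` has a finite family of generators with a dual family: both consist of
coordinate vector fields and differentials of coordinates. -/
lemma exists_frame [FiniteDimensional ℝ E] [T2Space M] (p : M) :
    ∃ (ι : Type) (_ : Fintype ι) (g h : ι → GSec I M),
      (∀ k, SmoothOn univ (g k)) ∧ (∀ k, SmoothOn univ (h k)) ∧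
      ∀ᶠ q in nhds p, ∀ v : GT I q, v = ∑ k, inn I q v (h k q) • g k q := by
  obtain ⟨f, X, hf, hX, e⟩ := exists_coordinates (I := I) p
  -- the factors `2` compensate the factor `1 / 2` in the inner product
  refine ⟨Fin _ ⊕ Fin _, inferInstance,
    Sum.elim (fun i => (2 : ℝ) • (fun q => (X i q, 0) : GSec I M))
      (fun i => (2 : ℝ) • diffSec I (f i)),
    Sum.elim (fun i => diffSec I (f i)) (fun i => (fun q => (X i q, 0) : GSec I M)), ?_, ?_, ?_⟩
  · rintro (i | i)
    · exact (hX i).const_smul 2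
    · exact (smoothOn_diffSec (hf i)).const_smul 2
  · rintro (i | i)
    · exact smoothOn_diffSec (hf i)
    · exact hX i
  · filter_upwards [e] with q hq v
    rw [Fintype.sum_sum_type]
    refine Prod.ext ?_ ?_
    · rw [Prod.fst_add, Prod.fst_sum, Prod.fst_sum]
      conv_lhs => rw [hq v.1]
      simp [diffSec, inn_apply, smul_smul]
      exact Finset.sum_congr rfl fun i _ => by congr 1; ring
    · rw [Prod.snd_add, Prod.snd_sum, Prod.snd_sum]
      ext w
      conv_lhs => rw [hq w]
      simp [diffSec, inn_apply, smul_smul, mul_comm]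

/-- Every element of `𝕋_pM` is the value of a smooth section. -/
lemma exists_section [FiniteDimensional ℝ E] [T2Space M] (p : M) (v : GT I p) :
    ∃ x : GSec I M, SmoothOn univ x ∧ x p = v := by
  obtain ⟨ι, _, g, h, hg, hh, e⟩ := exists_frame (I := I) p
  refine ⟨∑ k, inn I p v (h k p) • g k, SmoothOn.sum _ fun k => (hg k).const_smul _, ?_⟩
  conv_rhs => rw [e.self_of_nhds v]
  simp [Finset.sum_apply]

/-- Elements of `𝕋_pM` are determined by their products with globally smooth sections; equations
between Dorfman brackets are tested in this way. -/
lemma eq_of_inn [FiniteDimensional ℝ E] [T2Space M] {p : M} {a b : GT I p}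
    (hab : ∀ z : GSec I M, SmoothOn univ z → inn I p a (z p) = inn I p b (z p)) : a = b := by
  obtain ⟨ι, _, g, h, hg, hh, e⟩ := exists_frame (I := I) p
  rw [e.self_of_nhds a, e.self_of_nhds b]
  exact Finset.sum_congr rfl fun k _ => by rw [hab _ (hh k)]

/-- A section is smooth if its products with smooth sections are smooth functions. -/
lemma smoothOn_of_inn [FiniteDimensional ℝ E] [T2Space M] {x : GSec I M}
    (hx : ∀ z : GSec I M, SmoothOn univ z → ContMDiff I 𝓘(ℝ, ℝ) ∞ (fun p => inn I p (x p) (z p))) :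
    SmoothOn univ x := by
  refine smoothOn_of_local fun p _ => ?_
  obtain ⟨ι, _, g, h, hg, hh, e⟩ := exists_frame (I := I) p
  refine ⟨∑ k, (fun q => inn I q (x q) (h k q)) • g k,
    SmoothOn.sum _ fun k => SmoothOn.smul (hx _ (hh k)).contMDiffOn (hg k), ?_⟩
  filter_upwards [e] with q hq
  conv_lhs => rw [hq (x q)]
  simp [Finset.sum_apply]

/-- A smooth section over an open set agrees near each point with a globally smooth one. -/
lemma SmoothOn.exists_global [FiniteDimensional ℝ E] [T2Space M] {U : Set M} (hU : IsOpen U)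
    {x : GSec I M} (hx : SmoothOn U x) {p : M} (hp : p ∈ U) :
    ∃ χ : M → ℝ, ContMDiff I 𝓘(ℝ, ℝ) ∞ χ ∧ SmoothOn univ (χ • x) ∧ tsupport χ ⊆ U ∧
      ∀ᶠ q in nhds p, χ q = 1 := by
  obtain ⟨χ, hχ, h1, hs⟩ := exists_bump (I := I) (hU.mem_nhds hp)
  exact ⟨χ, hχ, hx.cutoff hU hχ hs, hs, h1⟩

/-- A family of endomorphisms which preserves globally smooth sections preserves smoothness over
open sets. -/
lemma smoothOn_end [FiniteDimensional ℝ E] [T2Space M] {A : EndFib I M}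
    (hA : ∀ x : GSec I M, SmoothOn univ x → SmoothOn univ (fun p => A p (x p) : GSec I M))
    {U : Set M} (hU : IsOpen U) {x : GSec I M} (hx : SmoothOn U x) :
    SmoothOn U (fun p => A p (x p) : GSec I M) := by
  refine smoothOn_of_local fun p hp => ?_
  obtain ⟨χ, hχ, hχx, -, h1⟩ := hx.exists_global hU hp
  refine ⟨_, hA _ hχx, ?_⟩
  filter_upwards [h1] with q hq
  simp [hq]

end Frames

/-! ### The Dorfman bracket of smooth sections -/

section Dorfman

variable {E : Type*} [NormedAddCommGroup E] [NormedSpace ℝ E]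
  {H : Type*} [TopologicalSpace H] {I : ModelWithCorners ℝ E H}
  {M : Type*} [TopologicalSpace M] [ChartedSpace H M] [IsManifold I ∞ M]

lemma SmoothOn.mdifferentiableAt_fst {x : GSec I M} (hx : SmoothOn univ x) (p : M) :
    MDifferentiableAt I (I.prod 𝓘(ℝ, E)) (fun p => (TotalSpace.mk' E p (x p).1 :
      TotalSpace E (TangentSpace I : M → Type _))) p :=
  (contMDiffOn_univ.1 hx.1 p).mdifferentiableAt (by simp)

lemma SmoothOn.mdifferentiableAt_snd {x : GSec I M} (hx : SmoothOn univ x) (p : M) :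
    MDifferentiableAt I (I.prod 𝓘(ℝ, E →L[ℝ] ℝ)) (fun p => (TotalSpace.mk' (E →L[ℝ] ℝ) p (x p).2 :
      TotalSpace (E →L[ℝ] ℝ) (fun p : M => TangentSpace I p →L[ℝ] Trivial M ℝ p))) p :=
  (contMDiffOn_univ.1 hx.2 p).mdifferentiableAt (by simp)

lemma SmoothOn.contMDiff_pairing {x y : GSec I M} (hx : SmoothOn univ x) (hy : SmoothOn univ y) :
    ContMDiff I 𝓘(ℝ, ℝ) ∞ (fun p => (x p).2 (y p).1) := by
  intro p
  have := ContMDiffAt.clm_bundle_apply (contMDiffOn_univ.1 hx.2 p) (contMDiffOn_univ.1 hy.1 p)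
  rw [contMDiffAt_totalSpace] at this
  exact this.2

lemma SmoothOn.contMDiff_inn {x y : GSec I M} (hx : SmoothOn univ x) (hy : SmoothOn univ y) :
    ContMDiff I 𝓘(ℝ, ℝ) ∞ (fun p => inn I p (x p) (y p)) :=
  contMDiffOn_univ.1 (hx.contMDiffOn_inn hy)

/-- The derivative of a smooth function along a smooth section is smooth. -/
lemma SmoothOn.contMDiff_anchor {x : GSec I M} (hx : SmoothOn univ x) {f : M → ℝ}
    (hf : ContMDiff I 𝓘(ℝ, ℝ) ∞ f) : ContMDiff I 𝓘(ℝ, ℝ) ∞ (fun p => mvfderiv I f p (x p).1) :=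
  (smoothOn_diffSec hf).contMDiff_pairing hx

omit [IsManifold I ∞ M] in
lemma mdiffAt {f : M → ℝ} (hf : ContMDiff I 𝓘(ℝ, ℝ) ∞ f) {p : M} :
    MDifferentiableAt I 𝓘(ℝ, ℝ) f p :=
  (hf p).mdifferentiableAt (by simp)

omit [IsManifold I ∞ M] in
lemma mvfderiv_congr {f g : M → ℝ} {p : M} (h : ∀ᶠ q in nhds p, f q = g q) :
    mvfderiv I f p = mvfderiv I g p := by
  have h' : f =ᶠ[nhds p] g := h
  have := h'.self_of_nhds
  ext v
  simp only [mvfderiv]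
  rw [h'.mfderiv_eq]
  rfl

omit [IsManifold I ∞ M] in
lemma diffSec_add {f g : M → ℝ} (hf : ContMDiff I 𝓘(ℝ, ℝ) ∞ f)
    (hg : ContMDiff I 𝓘(ℝ, ℝ) ∞ g) (p : M) :
    diffSec I (f + g) p = diffSec I f p + diffSec I g p := by
  simp [diffSec, mvfderiv_add (mdiffAt hf) (mdiffAt hg)]

omit [IsManifold I ∞ M] in
lemma diffSec_mul {f g : M → ℝ} (hf : ContMDiff I 𝓘(ℝ, ℝ) ∞ f)
    (hg : ContMDiff I 𝓘(ℝ, ℝ) ∞ g) (p : M) :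
    diffSec I (f * g) p = f p • diffSec I g p + g p • diffSec I f p := by
  simp [diffSec, mvfderiv_mul (mdiffAt hf) (mdiffAt hg)]

/-- The differential of `⟨x, y⟩`, split into the differentials of the two pairings of vectors and
covectors. -/
lemma diffSec_inn {x y : GSec I M} (hx : SmoothOn univ x) (hy : SmoothOn univ y) (p : M) :
    diffSec I (fun q => inn I q (x q) (y q)) p = (1 / 2 : ℝ) •
      (diffSec I (fun q => (x q).2 (y q).1) p + diffSec I (fun q => (y q).2 (x q).1) p) := by
  have h1 := hx.contMDiff_pairing hy
  have h2 := hy.contMDiff_pairing hx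
  have h3 := diffSec_mul (I := I) (f := fun _ : M => (1 / 2 : ℝ)) contMDiff_const (h1.add h2) p
  rw [show (fun q => inn I q (x q) (y q)) = (fun _ : M => (1 / 2 : ℝ)) *
    ((fun q => (x q).2 (y q).1) + fun q => (y q).2 (x q).1) from rfl]
  rw [h3, diffSec_add h1 h2]
  simp [diffSec, mvfderiv_const]

/-- The exterior derivative is local. -/
lemma extD_congr {α β : ∀ q : M, TangentSpace I q →L[ℝ] ℝ} {p : M}
    (h : ∀ᶠ q in nhds p, α q = β q) (v : TangentSpace I p) : extD α p v = extD β p v := by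
  have e : formInChart α p =ᶠ[nhdsWithin (extChartAt I p p) (range I)] formInChart β p := by
    have ht : Filter.Tendsto (extChartAt I p).symm (nhdsWithin (extChartAt I p p) (range I))
        (nhds p) := by
      have := (continuousAt_extChartAt_symm (I := I) p).tendsto
      rw [extChartAt_to_inv] at this
      exact this.mono_left nhdsWithin_le_nhds
    filter_upwards [ht.eventually h] with u hu
    simp only [formInChart]
    rw [hu]
  ext w
  rw [extD_eq_chart, extD_eq_chart, e.fderivWithin_eq (e.self_of_nhdsWithin (mem_range_self _))]

/-- The Dorfman bracket is local. -/
lemma dorfman_congr {x x' y y' : GSec I M} {p : M} (hx : ∀ᶠ q in nhds p, x q = x' q)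
    (hy : ∀ᶠ q in nhds p, y q = y' q) : dorfman x y p = dorfman x' y' p := by
  have hx1 : ∀ᶠ q in nhds p, (x q).1 = (x' q).1 := hx.mono fun q h => by rw [h]
  have hx2 : ∀ᶠ q in nhds p, (x q).2 = (x' q).2 := hx.mono fun q h => by rw [h]
  have hy1 : ∀ᶠ q in nhds p, (y q).1 = (y' q).1 := hy.mono fun q h => by rw [h]
  have hy2 : ∀ᶠ q in nhds p, (y q).2 = (y' q).2 := hy.mono fun q h => by rw [h]
  have h1 : VectorField.mlieBracket I (fun q => (x q).1) (fun q => (y q).1) p =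
      VectorField.mlieBracket I (fun q => (x' q).1) (fun q => (y' q).1) p :=
    Filter.EventuallyEq.mlieBracket_vectorField_eq hx1 hy1
  have h2 : mvfderiv I (fun q => (y q).2 (x q).1) p = mvfderiv I (fun q => (y' q).2 (x' q).1) p :=
    mvfderiv_congr (by filter_upwards [hx, hy] with q h h'; rw [h, h'])
  simp only [dorfman, lieDForm]
  rw [h1, h2, extD_congr hx2, extD_congr hy2, hx.self_of_nhds, hy.self_of_nhds]

/-- The failure of the Dorfman bracket to be skew-symmetric: `[x, y] + [y, x] = 2 d⟨x, y⟩`. -/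
lemma dorfman_add_swap {x y : GSec I M} (hx : SmoothOn univ x) (hy : SmoothOn univ y) (p : M) :
    dorfman x y p + dorfman y x p = (2 : ℝ) • diffSec I (fun q => inn I q (x q) (y q)) p := by
  have h := VectorField.mlieBracket_swap_apply (I := I) (V := fun q => (x q).1)
    (W := fun q => (y q).1) (x := p)
  rw [diffSec_inn hx hy, smul_smul]
  refine Prod.ext ?_ ?_
  · simp only [dorfman, diffSec, Prod.fst_add, Prod.smul_fst]
    rw [h]
    simp
  · simp only [dorfman, diffSec, lieDForm, Prod.snd_add, Prod.smul_snd]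
    norm_num
    abel

variable [FiniteDimensional ℝ E]

/-- The Dorfman bracket paired with a third section, in terms of Lie brackets and derivatives of
functions only. -/
lemma inn_dorfman {x y z : GSec I M} (hx : SmoothOn univ x) (hy : SmoothOn univ y)
    (hz : SmoothOn univ z) (p : M) :
    2 * inn I p (dorfman x y p) (z p) =
      mvfderiv I (fun q => (y q).2 (z q).1) p (x p).1
      - (y p).2 (VectorField.mlieBracket I (fun q => (x q).1) (fun q => (z q).1) p)
      - mvfderiv I (fun q => (x q).2 (z q).1) p (y p).1
      + mvfderiv I (fun q => (x q).2 (y q).1) p (z p).1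
      + (x p).2 (VectorField.mlieBracket I (fun q => (y q).1) (fun q => (z q).1) p)
      + (z p).2 (VectorField.mlieBracket I (fun q => (x q).1) (fun q => (y q).1) p) := by
  have : CompleteSpace E := FiniteDimensional.complete ℝ E
  have h1 := extD_apply (hy.mdifferentiableAt_snd p) (hx.mdifferentiableAt_fst p)
    (hz.mdifferentiableAt_fst p)
  have h2 := extD_apply (hx.mdifferentiableAt_snd p) (hy.mdifferentiableAt_fst p)
    (hz.mdifferentiableAt_fst p)
  have h3 : (dorfman x y p).2 (z p).1 = extD (fun q => (y q).2) p (x p).1 (z p).1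
      + mvfderiv I (fun q => (y q).2 (x q).1) p (z p).1
      - extD (fun q => (x q).2) p (y p).1 (z p).1 := rfl
  rw [inn_apply, h3, h1, h2]
  simp only [dorfman]
  ring

/-- The tautological inner product is invariant under the Dorfman bracket: the derivative of
`⟨y, z⟩` along the vector part of `x` is `⟨[x, y], z⟩ + ⟨y, [x, z]⟩`. -/
lemma anchor_inn {x y z : GSec I M} (hx : SmoothOn univ x) (hy : SmoothOn univ y)
    (hz : SmoothOn univ z) (p : M) :
    mvfderiv I (fun q => inn I q (y q) (z q)) p (x p).1 =
      inn I p (dorfman x y p) (z p) + inn I p (y p) (dorfman x z p) := by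
  have h1 := inn_dorfman hx hy hz p
  have h2 := inn_dorfman hx hz hy p
  rw [inn_comm p (y p)]
  have h3 : mvfderiv I (fun q => inn I q (y q) (z q)) p (x p).1 =
      (1 / 2) * (mvfderiv I (fun q => (y q).2 (z q).1) p (x p).1 +
        mvfderiv I (fun q => (z q).2 (y q).1) p (x p).1) := by
    have := congrArg (fun w : GT I p => w.2 (x p).1) (diffSec_inn hy hz p)
    simpa [diffSec, mul_add] using this
  rw [h3]
  have h4 := VectorField.mlieBracket_swap_apply (I := I) (V := fun q => (y q).1)
    (W := fun q => (z q).1) (x := p)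
  rw [h4, map_neg] at h1
  linarith

variable [T2Space M]

/-- The Dorfman bracket of smooth sections is smooth: by `inn_dorfman`, its products with smooth
sections are smooth functions. -/
lemma SmoothOn.dorfman {x y : GSec I M} (hx : SmoothOn univ x) (hy : SmoothOn univ y) :
    SmoothOn univ (dorfman x y) := by
  have : CompleteSpace E := FiniteDimensional.complete ℝ E
  have hL : ∀ {x y : GSec I M}, SmoothOn univ x → SmoothOn univ y → SmoothOn univ
      (fun p => (VectorField.mlieBracket I (fun q => (x q).1) (fun q => (y q).1) p, 0) :
        GSec I M) := by
    intro x y hx hy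
    have : IsManifold I (((⊤ : ℕ∞) : WithTop ℕ∞) + 1) M := by
      simpa using (inferInstance : IsManifold I ∞ M)
    have : IsManifold I (minSmoothness ℝ 2) M := by
      simpa using (inferInstance : IsManifold I 2 M)
    refine smoothOn_vec (contMDiffOn_univ.2 ?_)
    exact ContDiff.mlieBracket_vectorField (n := ⊤) (m := ⊤) (contMDiffOn_univ.1 hx.1)
      (contMDiffOn_univ.1 hy.1) (by simp)
  refine smoothOn_of_inn fun z hz => ?_
  have h := fun p => inn_dorfman hx hy hz p
  have e : (fun p => inn I p (GenGeom.dorfman x y p) (z p)) = fun p => (1 / 2 : ℝ) * (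
      mvfderiv I (fun q => (y q).2 (z q).1) p (x p).1
      - (y p).2 (VectorField.mlieBracket I (fun q => (x q).1) (fun q => (z q).1) p)
      - mvfderiv I (fun q => (x q).2 (z q).1) p (y p).1
      + mvfderiv I (fun q => (x q).2 (y q).1) p (z p).1
      + (x p).2 (VectorField.mlieBracket I (fun q => (y q).1) (fun q => (z q).1) p)
      + (z p).2 (VectorField.mlieBracket I (fun q => (x q).1) (fun q => (y q).1) p)) := by
    funext p
    rw [← h p]; ring
  rw [e]
  exact contMDiff_const.mul ((((((hx.contMDiff_anchor (hy.contMDiff_pairing hz)).sub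
    (hy.contMDiff_pairing (hL hx hz))).sub (hy.contMDiff_anchor (hx.contMDiff_pairing hz))).add
    (hz.contMDiff_anchor (hx.contMDiff_pairing hy))).add (hx.contMDiff_pairing (hL hy hz))).add
    (hz.contMDiff_pairing (hL hx hy)))

/-- The Leibniz rule `[x, f y] = f [x, y] + x(f) y`, a consequence of the invariance of the inner
product. -/
lemma dorfman_smul_right {x y : GSec I M} (hx : SmoothOn univ x) (hy : SmoothOn univ y) {f : M → ℝ}
    (hf : ContMDiff I 𝓘(ℝ, ℝ) ∞ f) (p : M) :
    GenGeom.dorfman x (f • y) p = f p • GenGeom.dorfman x y p + mvfderiv I f p (x p).1 • y p := by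
  refine eq_of_inn fun z hz => ?_
  have h1 := anchor_inn hx (hy.smul hf.contMDiffOn) hz p
  have h2 := anchor_inn hx hy hz p
  have h3 := mvfderiv_mul (x := p) (mdiffAt hf) (mdiffAt (hy.contMDiff_inn hz))
  have h4 : (fun q => inn I q ((f • y) q) (z q)) = f * (fun q => inn I q (y q) (z q)) := by
    funext q; simp
  rw [h4, h3] at h1
  simp at h1 ⊢
  rw [h2] at h1
  linear_combination -h1

/-- The Leibniz rule `[f x, y] = f [x, y] - y(f) x + 2 ⟨x, y⟩ df`; its last term vanishes on
isotropic subbundles. -/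
lemma dorfman_smul_left {x y : GSec I M} (hx : SmoothOn univ x) (hy : SmoothOn univ y) {f : M → ℝ}
    (hf : ContMDiff I 𝓘(ℝ, ℝ) ∞ f) (p : M) :
    GenGeom.dorfman (f • x) y p = f p • GenGeom.dorfman x y p - mvfderiv I f p (y p).1 • x p
      + (2 * inn I p (x p) (y p)) • diffSec I f p := by
  have h1 := dorfman_add_swap (hx.smul hf.contMDiffOn) hy p
  have h2 := dorfman_add_swap hx hy p
  rw [dorfman_smul_right hy hx hf] at h1
  have h3 : (fun q => inn I q ((f • x) q) (y q)) = f * (fun q => inn I q (x q) (y q)) := by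
    funext q; simp
  rw [h3, diffSec_mul hf (hx.contMDiff_inn hy)] at h1
  rw [eq_sub_of_add_eq h1, eq_sub_of_add_eq h2]
  module

lemma dorfman_add_right {x y y' : GSec I M} (hx : SmoothOn univ x) (hy : SmoothOn univ y)
    (hy' : SmoothOn univ y') (p : M) :
    GenGeom.dorfman x (y + y') p = GenGeom.dorfman x y p + GenGeom.dorfman x y' p := by
  refine eq_of_inn fun z hz => ?_
  have h1 := anchor_inn hx (hy.add hy') hz p
  have h2 := anchor_inn hx hy hz p
  have h2' := anchor_inn hx hy' hz p
  have h3 := mvfderiv_add (x := p) (mdiffAt (hy.contMDiff_inn hz)) (mdiffAt (hy'.contMDiff_inn hz))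
  have h4 : (fun q => inn I q ((y + y') q) (z q)) =
    (fun q => inn I q (y q) (z q)) + (fun q => inn I q (y' q) (z q)) := by
    funext q; simp
  rw [h4, h3] at h1
  simp at h1 ⊢
  rw [h2, h2'] at h1
  linear_combination -h1

lemma dorfman_add_left {x x' y : GSec I M} (hx : SmoothOn univ x) (hx' : SmoothOn univ x')
    (hy : SmoothOn univ y) (p : M) :
    GenGeom.dorfman (x + x') y p = GenGeom.dorfman x y p + GenGeom.dorfman x' y p := by
  have h1 := dorfman_add_swap (hx.add hx') hy p
  rw [dorfman_add_right hy hx hx'] at h1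
  have h3 : (fun q => inn I q ((x + x') q) (y q)) =
      (fun q => inn I q (x q) (y q)) + (fun q => inn I q (x' q) (y q)) := by
    funext q; simp
  rw [h3, diffSec_add (hx.contMDiff_inn hy) (hx'.contMDiff_inn hy)] at h1
  rw [eq_sub_of_add_eq h1, eq_sub_of_add_eq (dorfman_add_swap hx hy p),
    eq_sub_of_add_eq (dorfman_add_swap hx' hy p)]
  module

end Dorfman

/-! ### Pull-back from the factors of a product manifold -/

section Factor

/-- A factor `M` of a product manifold `N`: the projection `base : N → M`, its differential and the
horizontal lift of tangent vectors. With the two projections in this form, everything proved for one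
factor of `M₁ × M₂` holds for the other. -/
structure Factor {E' : Type*} [NormedAddCommGroup E'] [NormedSpace ℝ E']
    {H' : Type*} [TopologicalSpace H'] (I' : ModelWithCorners ℝ E' H')
    (N : Type*) [TopologicalSpace N] [ChartedSpace H' N] [IsManifold I' ∞ N]
    {E : Type*} [NormedAddCommGroup E] [NormedSpace ℝ E]
    {H : Type*} [TopologicalSpace H] (I : ModelWithCorners ℝ E H)
    (M : Type*) [TopologicalSpace M] [ChartedSpace H M] [IsManifold I ∞ M] where
  /-- The projection. -/
  base : N → M
  /-- The horizontal lift. -/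
  lift : ∀ q : N, TangentSpace I (base q) →L[ℝ] TangentSpace I' q
  /-- The differential of the projection. -/
  proj : ∀ q : N, TangentSpace I' q →L[ℝ] TangentSpace I (base q)
  surjective : Function.Surjective base
  contMDiff : ContMDiff I' I ∞ base
  mfderiv_eq : ∀ q, mfderiv I' I base q = proj q
  proj_lift : ∀ q v, proj q (lift q v) = v
  contMDiff_lift : ∀ X : ∀ p : M, TangentSpace I p,
    ContMDiff I (I.prod 𝓘(ℝ, E)) ∞ (fun p => (TotalSpace.mk' E p (X p) :
      TotalSpace E (TangentSpace I : M → Type _))) →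
    ContMDiff I' (I'.prod 𝓘(ℝ, E')) ∞ (fun q => (TotalSpace.mk' E' q (lift q (X (base q))) :
      TotalSpace E' (TangentSpace I' : N → Type _)))

variable {E' : Type*} [NormedAddCommGroup E'] [NormedSpace ℝ E']
  {H' : Type*} [TopologicalSpace H'] {I' : ModelWithCorners ℝ E' H'}
  {N : Type*} [TopologicalSpace N] [ChartedSpace H' N] [IsManifold I' ∞ N]
  {E : Type*} [NormedAddCommGroup E] [NormedSpace ℝ E]
  {H : Type*} [TopologicalSpace H] {I : ModelWithCorners ℝ E H}
  {M : Type*} [TopologicalSpace M] [ChartedSpace H M] [IsManifold I ∞ M]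

namespace Factor

variable (P : Factor I' N I M)

/-- Pull-back of elements of `𝕋M` along the projection. -/
def pull (q : N) : GT I (P.base q) →ₗ[ℝ] GT I' q := transport I I' (P.lift q) (P.proj q)

/-- The left inverse of the pull-back, which is also its adjoint for the inner products. -/
def push (q : N) : GT I' q →ₗ[ℝ] GT I (P.base q) := transport I' I (P.proj q) (P.lift q)

/-- Pull-back of sections. -/
def pullSec : GSec I M →ₗ[ℝ] GSec I' N where
  toFun x q := P.pull q (x (P.base q))
  map_add' x y := by funext q; simp
  map_smul' c x := by funext q; simp

/-- Pull-back of families of subspaces. -/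
def pullFib (F : Fib I M) : Fib I' N := fun q => (F (P.base q)).map (P.pull q)

/-- Pull-back of endomorphisms, extended by zero. -/
def pullEnd (J : EndFib I M) : EndFib I' N := fun q => P.pull q ∘ₗ J (P.base q) ∘ₗ P.push q

lemma pullSec_apply (x : GSec I M) (q : N) : P.pullSec x q = P.pull q (x (P.base q)) := rfl

lemma pullEnd_apply (J : EndFib I M) (q : N) (x : GT I' q) :
    P.pullEnd J q x = P.pull q (J (P.base q) (P.push q x)) := rfl

lemma pull_fst (q : N) (x : GT I (P.base q)) : (P.pull q x).1 = P.lift q x.1 := rfl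
lemma pull_snd (q : N) (x : GT I (P.base q)) (v : TangentSpace I' q) :
    (P.pull q x).2 v = x.2 (P.proj q v) := rfl
lemma push_fst (q : N) (x : GT I' q) : (P.push q x).1 = P.proj q x.1 := rfl
lemma push_snd (q : N) (x : GT I' q) (v : TangentSpace I (P.base q)) :
    (P.push q x).2 v = x.2 (P.lift q v) := rfl

lemma push_pull (q : N) (x : GT I (P.base q)) : P.push q (P.pull q x) = x := by
  refine Prod.ext (P.proj_lift q x.1) ?_
  ext v
  rw [push_snd, pull_snd, P.proj_lift]

lemma pull_injective (q : N) : Function.Injective (P.pull q) :=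
  Function.LeftInverse.injective (P.push_pull q)

lemma inn_push (q : N) (x : GT I' q) (y : GT I (P.base q)) :
    inn I (P.base q) (P.push q x) y = inn I' q x (P.pull q y) := by
  rw [inn_apply, inn_apply, push_snd, push_fst, pull_fst, pull_snd]

lemma inn_pull (q : N) (x y : GT I (P.base q)) :
    inn I' q (P.pull q x) (P.pull q y) = inn I (P.base q) x y := by
  rw [← inn_push, push_pull]

lemma mvfderiv_comp {f : M → ℝ} (hf : ContMDiff I 𝓘(ℝ, ℝ) ∞ f) (q : N) (v : TangentSpace I' q) :
    mvfderiv I' (fun q => f (P.base q)) q v = mvfderiv I f (P.base q) (P.proj q v) := by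
  rw [← P.mfderiv_eq]
  exact mvfderiv_comp_apply q (mdiffAt hf) ((P.contMDiff q).mdifferentiableAt (by simp)) v

variable [FiniteDimensional ℝ E] [T2Space M]

/-- The pull-back of a smooth section is smooth. The vector part is the defining property of a
factor; the covector part is locally a combination of the differentials of `f ∘ base` with `f` a
coordinate function. -/
lemma smoothOn_pullSec {x : GSec I M} (hx : SmoothOn univ x) : SmoothOn univ (P.pullSec x) := by
  refine ⟨contMDiffOn_univ.2 (P.contMDiff_lift _ (contMDiffOn_univ.1 hx.1)), ?_⟩
  suffices h : SmoothOn univ (fun q => (0, (P.pullSec x q).2) : GSec I' N) from h.2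
  refine smoothOn_of_local fun q _ => ?_
  obtain ⟨f, X, hf, hX, e⟩ := exists_coordinates (I := I) (P.base q)
  refine ⟨∑ i, (fun q => (x (P.base q)).2 (X i (P.base q))) • diffSec I' (fun q => f i (P.base q)),
    SmoothOn.sum _ fun i => SmoothOn.smul ?_ ?_, ?_⟩
  · exact ((hx.contMDiff_pairing (hX i)).comp P.contMDiff).contMDiffOn
  · exact smoothOn_diffSec ((hf i).comp P.contMDiff)
  · filter_upwards [P.contMDiff.continuous.continuousAt.tendsto.eventually e] with r hr
    refine Prod.ext ?_ ?_
    · simp [diffSec, Finset.sum_apply, Prod.fst_sum]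
    · rw [Finset.sum_apply, Prod.snd_sum]
      ext v
      simp only [pullSec_apply, pull_snd]
      rw [hr (P.proj r v)]
      simp [diffSec, P.mvfderiv_comp (hf _), mul_comm]

end Factor

/-- `P` and `Q` are the two factors of a product: the horizontal lifts from one are vertical for the
other, and every tangent vector is the sum of the lifts of its projections. -/
structure Factor.IsCompl {E₂ : Type*} [NormedAddCommGroup E₂] [NormedSpace ℝ E₂]
    {H₂ : Type*} [TopologicalSpace H₂] {I₂ : ModelWithCorners ℝ E₂ H₂}
    {M₂ : Type*} [TopologicalSpace M₂] [ChartedSpace H₂ M₂] [IsManifold I₂ ∞ M₂]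
    (P : Factor I' N I M) (Q : Factor I' N I₂ M₂) : Prop where
  proj_lift : ∀ q v, Q.proj q (P.lift q v) = 0
  proj_lift' : ∀ q v, P.proj q (Q.lift q v) = 0
  add : ∀ q v, P.lift q (P.proj q v) + Q.lift q (Q.proj q v) = v

namespace Factor.IsCompl

variable {E₂ : Type*} [NormedAddCommGroup E₂] [NormedSpace ℝ E₂]
    {H₂ : Type*} [TopologicalSpace H₂] {I₂ : ModelWithCorners ℝ E₂ H₂}
    {M₂ : Type*} [TopologicalSpace M₂] [ChartedSpace H₂ M₂] [IsManifold I₂ ∞ M₂]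
    {P : Factor I' N I M} {Q : Factor I' N I₂ M₂}

lemma symm (h : P.IsCompl Q) : Q.IsCompl P :=
  ⟨h.proj_lift', h.proj_lift, fun q v => by rw [add_comm, h.add]⟩

/-- Pull-backs from one factor have no component in the other one. -/
lemma push_pull (h : P.IsCompl Q) (q : N) (x : GT I (P.base q)) : Q.push q (P.pull q x) = 0 := by
  refine Prod.ext (h.proj_lift q x.1) ?_
  ext v
  rw [Q.push_snd, P.pull_snd, h.proj_lift']
  simp

lemma pull_push_add (h : P.IsCompl Q) (q : N) (x : GT I' q) :
    P.pull q (P.push q x) + Q.pull q (Q.push q x) = x := by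
  refine Prod.ext (h.add q x.1) ?_
  ext v
  conv_rhs => rw [← h.add q v, map_add]
  rfl

lemma inn_pull (h : P.IsCompl Q) (q : N) (x : GT I (P.base q)) (y : GT I₂ (Q.base q)) :
    inn I' q (P.pull q x) (Q.pull q y) = 0 := by
  rw [← Q.inn_push, h.push_pull]; simp

variable [FiniteDimensional ℝ E] [T2Space M] [FiniteDimensional ℝ E₂] [T2Space M₂]
  [FiniteDimensional ℝ E'] [I'.Boundaryless] [I.Boundaryless]

omit [FiniteDimensional ℝ E'] [I'.Boundaryless] [I.Boundaryless] in
/-- A tangent vector of the product is determined by its action on functions pulled back from the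
two factors. -/
lemma eq_of_mvfderiv (h : P.IsCompl Q) {q : N} {v w : TangentSpace I' q}
    (h₁ : ∀ f : M → ℝ, ContMDiff I 𝓘(ℝ, ℝ) ∞ f →
      mvfderiv I' (fun q => f (P.base q)) q v = mvfderiv I' (fun q => f (P.base q)) q w)
    (h₂ : ∀ f : M₂ → ℝ, ContMDiff I₂ 𝓘(ℝ, ℝ) ∞ f →
      mvfderiv I' (fun q => f (Q.base q)) q v = mvfderiv I' (fun q => f (Q.base q)) q w) :
    v = w := by
  rw [← h.add q v, ← h.add q w]
  congr 2
  · obtain ⟨f, X, hf, hX, e⟩ := exists_coordinates (I := I) (P.base q)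
    rw [e.self_of_nhds (P.proj q v), e.self_of_nhds (P.proj q w)]
    refine Finset.sum_congr rfl fun i _ => ?_
    rw [← P.mvfderiv_comp (hf i), ← P.mvfderiv_comp (hf i), h₁ _ (hf i)]
  · obtain ⟨f, X, hf, hX, e⟩ := exists_coordinates (I := I₂) (Q.base q)
    rw [e.self_of_nhds (Q.proj q v), e.self_of_nhds (Q.proj q w)]
    refine Finset.sum_congr rfl fun i _ => ?_
    rw [← Q.mvfderiv_comp (hf i), ← Q.mvfderiv_comp (hf i), h₂ _ (hf i)]

/-- The horizontal lift commutes with the Lie bracket: both sides act in the same way on functions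
pulled back from the factors. -/
lemma mlieBracket_lift (h : P.IsCompl Q) {x y : GSec I M} (hx : SmoothOn univ x)
    (hy : SmoothOn univ y) (q : N) :
    VectorField.mlieBracket I' (fun q => (P.pullSec x q).1) (fun q => (P.pullSec y q).1) q =
      P.lift q (VectorField.mlieBracket I (fun p => (x p).1) (fun p => (y p).1) (P.base q)) := by
  have : CompleteSpace E := FiniteDimensional.complete ℝ E
  have : CompleteSpace E' := FiniteDimensional.complete ℝ E'
  have hx' := P.smoothOn_pullSec hx
  have hy' := P.smoothOn_pullSec hy
  refine h.eq_of_mvfderiv (fun f hf => ?_) (fun f hf => ?_)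
  · have e : ∀ {z : GSec I M}, SmoothOn univ z →
        (fun q => mvfderiv I' (fun q => f (P.base q)) q (P.pullSec z q).1) =
        fun q => mvfderiv I f (P.base q) (z (P.base q)).1 := by
      intro z hz; funext r
      rw [P.mvfderiv_comp hf, P.pullSec_apply, P.pull_fst, P.proj_lift]
    rw [mvfderiv_mlieBracket (f := fun q => f (P.base q)) (hf.comp P.contMDiff)
      (hx'.mdifferentiableAt_fst q) (hy'.mdifferentiableAt_fst q), e hx, e hy,
      P.mvfderiv_comp (hx.contMDiff_anchor hf), P.mvfderiv_comp (hy.contMDiff_anchor hf),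
      P.mvfderiv_comp hf, P.proj_lift, mvfderiv_mlieBracket hf
      (hx.mdifferentiableAt_fst _) (hy.mdifferentiableAt_fst _)]
    simp only [P.pullSec_apply, P.pull_fst, P.proj_lift]
  · have e : ∀ z : GSec I M,
        (fun q => mvfderiv I' (fun q => f (Q.base q)) q (P.pullSec z q).1) = fun _ => 0 := by
      intro z; funext r
      rw [Q.mvfderiv_comp hf, P.pullSec_apply, P.pull_fst, h.proj_lift, map_zero]
    rw [mvfderiv_mlieBracket (f := fun q => f (Q.base q)) (hf.comp Q.contMDiff)
      (hx'.mdifferentiableAt_fst q) (hy'.mdifferentiableAt_fst q), e, e,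
      Q.mvfderiv_comp hf, h.proj_lift]
    simp [mvfderiv_const]

omit [I.Boundaryless] in
/-- Lifts from different factors commute. -/
lemma mlieBracket_lift_lift (h : P.IsCompl Q) {x : GSec I M} {y : GSec I₂ M₂} (hx : SmoothOn univ x)
    (hy : SmoothOn univ y) (q : N) :
    VectorField.mlieBracket I' (fun q => (P.pullSec x q).1) (fun q => (Q.pullSec y q).1) q = 0 := by
  have : CompleteSpace E' := FiniteDimensional.complete ℝ E'
  have hx' := P.smoothOn_pullSec hx
  have hy' := Q.smoothOn_pullSec hy
  refine h.eq_of_mvfderiv (fun f hf => ?_) (fun f hf => ?_)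
  · rw [mvfderiv_mlieBracket (f := fun q => f (P.base q)) (hf.comp P.contMDiff)
      (hx'.mdifferentiableAt_fst q) (hy'.mdifferentiableAt_fst q)]
    simp only [P.pullSec_apply, P.pull_fst, Q.pullSec_apply, Q.pull_fst, P.mvfderiv_comp hf,
      P.proj_lift, h.proj_lift', map_zero]
    rw [P.mvfderiv_comp (hx.contMDiff_anchor hf), h.proj_lift']
    simp [mvfderiv_const]
  · rw [mvfderiv_mlieBracket (f := fun q => f (Q.base q)) (hf.comp Q.contMDiff)
      (hx'.mdifferentiableAt_fst q) (hy'.mdifferentiableAt_fst q)]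
    simp only [P.pullSec_apply, P.pull_fst, Q.pullSec_apply, Q.pull_fst, Q.mvfderiv_comp hf,
      Q.proj_lift, h.proj_lift, map_zero]
    rw [Q.mvfderiv_comp (hy.contMDiff_anchor hf), h.proj_lift]
    simp [mvfderiv_const]

omit [FiniteDimensional ℝ E] [T2Space M] [FiniteDimensional ℝ E₂] [T2Space M₂]
  [FiniteDimensional ℝ E'] [I'.Boundaryless] [I.Boundaryless] in
/-- Pull-backs from the two factors span the fibres of `𝕋N`. -/
lemma ext_inn (h : P.IsCompl Q) {q : N} {a b : GT I' q}
    (h₁ : ∀ z, inn I' q a (P.pull q z) = inn I' q b (P.pull q z))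
    (h₂ : ∀ z, inn I' q a (Q.pull q z) = inn I' q b (Q.pull q z)) (w : GT I' q) :
    inn I' q a w = inn I' q b w := by
  rw [← h.pull_push_add q w, map_add, map_add, h₁, h₂]

variable [T2Space N]

/-- Pull-back along a projection commutes with the Dorfman bracket: all the terms of `inn_dorfman`
for pulled-back sections are pull-backs, if the third section comes from the same factor, and
vanish, if it comes from the other one. -/
theorem dorfman_pullSec (h : P.IsCompl Q) {x y : GSec I M} (hx : SmoothOn univ x)
    (hy : SmoothOn univ y) (q : N) :
    dorfman (P.pullSec x) (P.pullSec y) q = P.pull q (dorfman x y (P.base q)) := by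
  have hx' := P.smoothOn_pullSec hx
  have hy' := P.smoothOn_pullSec hy
  refine eq_of_inn fun w _ => h.ext_inn (fun z => ?_) (fun z => ?_) (w q)
  · obtain ⟨z, hz, rfl⟩ := exists_section (P.base q) z
    have e : ∀ {x y : GSec I M}, (fun q => (P.pullSec x q).2 (P.pullSec y q).1) =
        fun q => (x (P.base q)).2 (y (P.base q)).1 := by
      intro x y; funext r
      simp only [P.pullSec_apply, P.pull_snd, P.pull_fst, P.proj_lift]
    have h1 := inn_dorfman hx' hy' (P.smoothOn_pullSec hz) q
    have h2 := inn_dorfman hx hy hz (P.base q)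
    rw [h.mlieBracket_lift hx hz, h.mlieBracket_lift hy hz, h.mlieBracket_lift hx hy, e, e, e,
      P.mvfderiv_comp (hy.contMDiff_pairing hz), P.mvfderiv_comp (hx.contMDiff_pairing hz),
      P.mvfderiv_comp (hx.contMDiff_pairing hy)] at h1
    simp only [P.pullSec_apply, P.pull_snd, P.pull_fst, P.proj_lift] at h1
    rw [P.inn_pull]
    linarith
  · obtain ⟨z, hz, rfl⟩ := exists_section (Q.base q) z
    have h1 := inn_dorfman hx' hy' (Q.smoothOn_pullSec hz) q
    rw [h.mlieBracket_lift_lift hx hz, h.mlieBracket_lift_lift hy hz,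
      h.mlieBracket_lift hx hy] at h1
    have e : (fun q => (P.pullSec x q).2 (P.pullSec y q).1) =
        fun q => (x (P.base q)).2 (y (P.base q)).1 := by
      funext r
      simp only [P.pullSec_apply, P.pull_snd, P.pull_fst, P.proj_lift]
    rw [e, P.mvfderiv_comp (hx.contMDiff_pairing hy)] at h1
    simp only [P.pullSec_apply, Q.pullSec_apply, P.pull_snd, P.pull_fst, Q.pull_snd, Q.pull_fst,
      h.proj_lift, h.proj_lift', map_zero, mvfderiv_const] at h1
    rw [h.inn_pull]
    simpa using h1

/-- The Dorfman bracket of pull-backs from different factors vanishes. -/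
theorem dorfman_pullSec_pullSec [I₂.Boundaryless] (h : P.IsCompl Q) {x : GSec I M} {y : GSec I₂ M₂}
    (hx : SmoothOn univ x) (hy : SmoothOn univ y) (q : N) :
    dorfman (P.pullSec x) (Q.pullSec y) q = 0 := by
  have hx' := P.smoothOn_pullSec hx
  have hy' := Q.smoothOn_pullSec hy
  refine eq_of_inn fun w _ => h.ext_inn (fun z => ?_) (fun z => ?_) (w q)
  · obtain ⟨z, hz, rfl⟩ := exists_section (P.base q) z
    have h1 := inn_dorfman hx' hy' (P.smoothOn_pullSec hz) q
    rw [h.symm.mlieBracket_lift_lift hy hz, h.mlieBracket_lift_lift hx hy,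
      h.mlieBracket_lift hx hz] at h1
    have e : (fun q => (P.pullSec x q).2 (P.pullSec z q).1) =
        fun q => (x (P.base q)).2 (z (P.base q)).1 := by
      funext r
      simp only [P.pullSec_apply, P.pull_snd, P.pull_fst, P.proj_lift]
    rw [e, P.mvfderiv_comp (hx.contMDiff_pairing hz)] at h1
    simp only [P.pullSec_apply, Q.pullSec_apply, P.pull_snd, P.pull_fst, Q.pull_snd, Q.pull_fst,
      h.proj_lift, h.proj_lift', map_zero, mvfderiv_const] at h1
    simpa using h1
  · obtain ⟨z, hz, rfl⟩ := exists_section (Q.base q) z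
    have h1 := inn_dorfman hx' hy' (Q.smoothOn_pullSec hz) q
    rw [h.mlieBracket_lift_lift hx hz, h.symm.mlieBracket_lift hy hz,
      h.mlieBracket_lift_lift hx hy] at h1
    have e : (fun q => (Q.pullSec y q).2 (Q.pullSec z q).1) =
        fun q => (y (Q.base q)).2 (z (Q.base q)).1 := by
      funext r
      simp only [Q.pullSec_apply, Q.pull_snd, Q.pull_fst, Q.proj_lift]
    rw [e, Q.mvfderiv_comp (hy.contMDiff_pairing hz)] at h1
    simp only [P.pullSec_apply, Q.pullSec_apply, P.pull_snd, P.pull_fst, Q.pull_snd, Q.pull_fst,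
      h.proj_lift, h.proj_lift', map_zero, mvfderiv_const] at h1
    simpa using h1

end Factor.IsCompl
end Factor

section Concrete

variable {E₁ : Type*} [NormedAddCommGroup E₁] [NormedSpace ℝ E₁]
  {H₁ : Type*} [TopologicalSpace H₁] (I₁ : ModelWithCorners ℝ E₁ H₁)
  (M₁ : Type*) [TopologicalSpace M₁] [ChartedSpace H₁ M₁] [IsManifold I₁ ∞ M₁]
  {E₂ : Type*} [NormedAddCommGroup E₂] [NormedSpace ℝ E₂]
  {H₂ : Type*} [TopologicalSpace H₂] (I₂ : ModelWithCorners ℝ E₂ H₂)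
  (M₂ : Type*) [TopologicalSpace M₂] [ChartedSpace H₂ M₂] [IsManifold I₂ ∞ M₂]

omit [IsManifold I₁ ∞ M₁] [IsManifold I₂ ∞ M₂] in
variable {M₁ M₂} in
lemma lift₁_apply (q : M₁ × M₂) (v : TangentSpace I₁ q.1) :
    lift₁ I₁ I₂ q v = ((v : E₁), (0 : E₂)) := by
  have h := mfderiv_prod_left (I := I₁) (I' := I₂) (x₀ := q.1) (y₀ := q.2)
  exact DFunLike.congr_fun h v

omit [IsManifold I₁ ∞ M₁] [IsManifold I₂ ∞ M₂] in
variable {M₁ M₂} in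
lemma lift₂_apply (q : M₁ × M₂) (v : TangentSpace I₂ q.2) :
    lift₂ I₁ I₂ q v = ((0 : E₁), (v : E₂)) := by
  have h := mfderiv_prod_right (I := I₁) (I' := I₂) (x₀ := q.1) (y₀ := q.2)
  exact DFunLike.congr_fun h v

omit [IsManifold I₁ ∞ M₁] [IsManifold I₂ ∞ M₂] in
variable {M₁ M₂} in
lemma proj₁_apply (q : M₁ × M₂) (v : TangentSpace (I₁.prod I₂) q) :
    proj₁ I₁ I₂ q v = (v : E₁ × E₂).1 :=
  DFunLike.congr_fun (mfderiv_fst (I := I₁) (I' := I₂) (x := q)) v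

omit [IsManifold I₁ ∞ M₁] [IsManifold I₂ ∞ M₂] in
variable {M₁ M₂} in
lemma proj₂_apply (q : M₁ × M₂) (v : TangentSpace (I₁.prod I₂) q) :
    proj₂ I₁ I₂ q v = (v : E₁ × E₂).2 :=
  DFunLike.congr_fun (mfderiv_snd (I := I₁) (I' := I₂) (x := q)) v

/-- The first factor of a product manifold. -/
def fstFactor [Nonempty M₂] : Factor (I₁.prod I₂) (M₁ × M₂) I₁ M₁ where
  base := Prod.fst
  lift := lift₁ I₁ I₂
  proj := proj₁ I₁ I₂
  surjective := Prod.fst_surjective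
  contMDiff := contMDiff_fst
  mfderiv_eq _ := rfl
  proj_lift q v := (proj₁_apply I₁ I₂ q _).trans
    (congrArg (fun w : E₁ × E₂ => w.1) (lift₁_apply I₁ I₂ q v))
  contMDiff_lift X hX := by
    have := IsManifold.of_le (I := I₁) (M := M₁) (n := ∞) (m := 1) (by simp)
    have := IsManifold.of_le (I := I₂) (M := M₂) (n := ∞) (m := 1) (by simp)
    have h2 : ContMDiff I₂ (I₂.prod 𝓘(ℝ, E₂)) ∞ (fun p => (TotalSpace.mk' E₂ p 0 :
      TotalSpace E₂ (TangentSpace I₂ : M₂ → Type _))) :=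
      contMDiff_zeroSection ℝ (TangentSpace I₂ : M₂ → Type _)
    have h := (contMDiff_equivTangentBundleProd_symm (I := I₁) (I' := I₂) (M := M₁) (M' := M₂)).comp
      ((hX.comp contMDiff_fst).prodMk (h2.comp contMDiff_snd))
    refine h.congr fun q => ?_
    exact congrArg (TotalSpace.mk' (E₁ × E₂) q) (lift₁_apply I₁ I₂ q _)

/-- The second factor of a product manifold. -/
def sndFactor [Nonempty M₁] : Factor (I₁.prod I₂) (M₁ × M₂) I₂ M₂ where
  base := Prod.snd
  lift := lift₂ I₁ I₂
  proj := proj₂ I₁ I₂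
  surjective := Prod.snd_surjective
  contMDiff := contMDiff_snd
  mfderiv_eq _ := rfl
  proj_lift q v := (proj₂_apply I₁ I₂ q _).trans
    (congrArg (fun w : E₁ × E₂ => w.2) (lift₂_apply I₁ I₂ q v))
  contMDiff_lift X hX := by
    have := IsManifold.of_le (I := I₁) (M := M₁) (n := ∞) (m := 1) (by simp)
    have := IsManifold.of_le (I := I₂) (M := M₂) (n := ∞) (m := 1) (by simp)
    have h2 : ContMDiff I₁ (I₁.prod 𝓘(ℝ, E₁)) ∞ (fun p => (TotalSpace.mk' E₁ p 0 :
      TotalSpace E₁ (TangentSpace I₁ : M₁ → Type _))) :=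
      contMDiff_zeroSection ℝ (TangentSpace I₁ : M₁ → Type _)
    have h := (contMDiff_equivTangentBundleProd_symm (I := I₁) (I' := I₂) (M := M₁) (M' := M₂)).comp
      ((h2.comp contMDiff_fst).prodMk (hX.comp contMDiff_snd))
    refine h.congr fun q => ?_
    exact congrArg (TotalSpace.mk' (E₁ × E₂) q) (lift₂_apply I₁ I₂ q _)

lemma isCompl_fst_snd [Nonempty M₁] [Nonempty M₂] :
    (fstFactor I₁ M₁ I₂ M₂).IsCompl (sndFactor I₁ M₁ I₂ M₂) where
  proj_lift q v := (proj₂_apply I₁ I₂ q _).trans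
    (congrArg (fun w : E₁ × E₂ => w.2) (lift₁_apply I₁ I₂ q v))
  proj_lift' q v := (proj₁_apply I₁ I₂ q _).trans
    (congrArg (fun w : E₁ × E₂ => w.1) (lift₂_apply I₁ I₂ q v))
  add q v := by
    have h1 := (lift₁_apply I₁ I₂ q (proj₁ I₁ I₂ q v)).trans
      (congrArg (fun w : E₁ => (w, (0 : E₂))) (proj₁_apply I₁ I₂ q v))
    have h2 := (lift₂_apply I₁ I₂ q (proj₂ I₁ I₂ q v)).trans
      (congrArg (fun w : E₂ => ((0 : E₁), w)) (proj₂_apply I₁ I₂ q v))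
    refine (congrArg₂ (fun a b : E₁ × E₂ => a + b) h1 h2).trans ?_
    exact Prod.ext (add_zero _) (zero_add _)

end Concrete

/-! ### Linear algebra of split subspaces -/

section LinAlg

variable {W : Type*} [AddCommGroup W] [Module ℝ W] {B : LinearMap.BilinForm ℝ W}
  {W' : Type*} [AddCommGroup W'] [Module ℝ W'] {B' : LinearMap.BilinForm ℝ W'}

/-- `S` has dimension `2k` and signature `(k, k)`. -/
structure IsSplitSub (B : LinearMap.BilinForm ℝ W) (k : ℕ) (S : Submodule ℝ W) : Prop where
  symm : ∀ x y, B x y = B y x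
  finite : FiniteDimensional ℝ S
  finrank : Module.finrank ℝ S = 2 * k
  signature : HasSignature B S k k

namespace IsSplitSub

variable {k l : ℕ} {S S' : Submodule ℝ W}

/-- The bilinear form is nondegenerate on `S`: the signature `(k, k)` exhausts the dimension `2k`,
so nothing is left for the radical. -/
lemma eq_zero (h : IsSplitSub B k S) {x : W} (hx : x ∈ S) (h0 : ∀ y ∈ S, B x y = 0) : x = 0 := by
  have := h.finite
  have h1 := QuadraticForm.sigPos_add_sigNeg_add_radical (Q := B.toQuadraticMap.restrict S)
  rw [h.signature.1, h.signature.2, h.finrank] at h1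
  have h2 : Module.finrank ℝ (B.toQuadraticMap.restrict S).radical = 0 := by omega
  have h3 := Submodule.finrank_eq_zero.1 h2
  have h4 : (⟨x, hx⟩ : S) ∈ (B.toQuadraticMap.restrict S).radical := by
    rw [QuadraticMap.mem_radical_iff']
    refine ⟨h0 x hx, fun n => ?_⟩
    change B (x + n) (x + n) = B n n
    have e := h0 n n.2
    have e' := h.symm x n
    simp only [map_add, LinearMap.add_apply, h0 x hx]
    rw [e, ← e', e]; ring
  rw [h3, Submodule.mem_bot] at h4
  exact congrArg Subtype.val h4

/-- Orthogonal projection to `S`. -/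
lemma exists_sub_orthogonal (h : IsSplitSub B k S) (x : W) :
    ∃ y ∈ S, ∀ z ∈ S, B (x - y) z = 0 := by
  have := h.finite
  let A : S →ₗ[ℝ] Module.Dual ℝ S := (LinearMap.domRestrict₁₂ B S S)
  have hA : Function.Injective A := by
    refine (injective_iff_map_eq_zero A).2 fun y hy => Subtype.ext ?_
    exact h.eq_zero y.2 fun z hz => DFunLike.congr_fun hy ⟨z, hz⟩
  have hs := (LinearMap.injective_iff_surjective_of_finrank_eq_finrank
    (Subspace.dual_finrank_eq (K := ℝ) (V := S)).symm).1 hA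
  obtain ⟨y, hy⟩ := hs ((B x).domRestrict S)
  refine ⟨y, y.2, fun z hz => ?_⟩
  have : B y z = B x z := DFunLike.congr_fun hy ⟨z, hz⟩
  rw [map_sub, LinearMap.sub_apply, this, sub_self]

/-- Isometric injections preserve split subspaces. -/
lemma map (h : IsSplitSub B k S) (hB : ∀ x y, B' x y = B' y x) (T : W →ₗ[ℝ] W')
    (hT : ∀ x y, B' (T x) (T y) = B x y) (hi : Function.Injective T) :
    IsSplitSub B' k (S.map T) := by
  have := h.finite
  let e : S ≃ₗ[ℝ] S.map T := S.equivMapOfInjective T hi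
  have he : QuadraticMap.Equivalent (B.toQuadraticMap.restrict S)
      (B'.toQuadraticMap.restrict (S.map T)) := by
    refine ⟨⟨e, fun x => ?_⟩⟩
    exact hT x x
  refine ⟨hB, inferInstance, e.finrank_eq.symm.trans h.finrank, ?_, ?_⟩
  · rw [← he.sigPos_eq]; exact h.signature.1
  · rw [← he.sigNeg_eq]; exact h.signature.2

lemma disjoint (h : IsSplitSub B k S) (ho : ∀ x ∈ S, ∀ y ∈ S', B x y = 0) :
    Disjoint S S' := by
  rw [Submodule.disjoint_def]
  intro x hx hx'
  exact h.eq_zero hx fun y hy => (h.symm _ _).trans (ho y hy x hx')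

/-- A `k`-dimensional subspace on which the form is positive (`ε = 1`) or negative (`ε = -1`)
definite. -/
lemma exists_posDef (h : IsSplitSub B k S) (ε : ℝ) (hε : ε = 1 ∨ ε = -1) :
    ∃ V : Submodule ℝ W, V ≤ S ∧ Module.finrank ℝ V = k ∧ ∀ x ∈ V, x ≠ 0 → 0 < ε * B x x := by
  have := h.finite
  rcases hε with rfl | rfl
  · obtain ⟨V, hV, hp⟩ := exists_finrank_eq_sigPos_and_posDef (B.toQuadraticMap.restrict S)
    refine ⟨V.map S.subtype, Submodule.map_subtype_le _ _, ?_, ?_⟩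
    · rw [← h.signature.1, ← hV]
      exact LinearEquiv.finrank_eq (V.equivMapOfInjective _ S.injective_subtype).symm
    · rintro _ ⟨x, hx, rfl⟩ h0
      rw [one_mul]
      exact hp ⟨x, hx⟩ fun e => h0 (by rw [show x = 0 from congrArg Subtype.val e]; simp)
  · obtain ⟨V, hV, hp⟩ := exists_finrank_eq_sigNeg_and_negDef (B.toQuadraticMap.restrict S)
    refine ⟨V.map S.subtype, Submodule.map_subtype_le _ _, ?_, ?_⟩
    · rw [← h.signature.2, ← hV]
      exact LinearEquiv.finrank_eq (V.equivMapOfInjective _ S.injective_subtype).symm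
    · rintro _ ⟨x, hx, rfl⟩ h0
      have := hp ⟨x, hx⟩ fun e => h0 (by rw [show x = 0 from congrArg Subtype.val e]; simp)
      rw [neg_one_mul]
      exact this

lemma finrank_sup_add {S S' : Submodule ℝ W} [FiniteDimensional ℝ S] [FiniteDimensional ℝ S']
    (h : Disjoint S S') :
    Module.finrank ℝ (S ⊔ S' : Submodule ℝ W) = Module.finrank ℝ S + Module.finrank ℝ S' := by
  have := Submodule.finrank_sup_add_finrank_inf_eq S S'
  rw [h.eq_bot, finrank_bot, add_zero] at this
  exact this

/-- The orthogonal direct sum of subspaces of split signature has split signature: sums of definite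
subspaces bound both indices from below by `k + l`, and the two indices add up to at most
`2 (k + l)`. -/
lemma sup (h : IsSplitSub B k S) (h' : IsSplitSub B l S') (ho : ∀ x ∈ S, ∀ y ∈ S', B x y = 0) :
    IsSplitSub B (k + l) (S ⊔ S') := by
  have := h.finite
  have := h'.finite
  have hd := h.disjoint ho
  have hr : Module.finrank ℝ (S ⊔ S' : Submodule ℝ W) = 2 * (k + l) := by
    rw [finrank_sup_add hd, h.finrank, h'.finrank]; ring
  have key : ∀ ε : ℝ, ε = 1 ∨ ε = -1 → ∃ V : Submodule ℝ (S ⊔ S' : Submodule ℝ W),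
      Module.finrank ℝ V = k + l ∧ ∀ x ∈ V, x ≠ 0 → 0 < ε * B (x : W) (x : W) := by
    intro ε hε
    obtain ⟨V, hV, hk, hp⟩ := h.exists_posDef ε hε
    obtain ⟨V', hV', hl, hp'⟩ := h'.exists_posDef ε hε
    have hle : V ⊔ V' ≤ S ⊔ S' := sup_le_sup hV hV'
    have := Submodule.finiteDimensional_of_le hV
    have := Submodule.finiteDimensional_of_le hV'
    refine ⟨(V ⊔ V').comap (S ⊔ S').subtype, ?_, ?_⟩
    · rw [← hk, ← hl, ← finrank_sup_add (hd.mono hV hV')]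
      exact LinearEquiv.finrank_eq (Submodule.comapSubtypeEquivOfLe hle)
    · rintro ⟨x, hx⟩ hxV h0
      obtain ⟨a, ha, b, hb, rfl⟩ := Submodule.mem_sup.1 (Submodule.mem_comap.1 hxV)
      have e : B (a + b) (a + b) = B a a + B b b := by
        have e1 := ho a (hV ha) b (hV' hb)
        have e2 := h.symm b a
        simp only [map_add, LinearMap.add_apply]
        rw [e2, e1]; ring
      change 0 < ε * B (a + b) (a + b)
      rw [e, mul_add]
      by_cases ha0 : a = 0
      · by_cases hb0 : b = 0
        · exact absurd (Subtype.ext (by simp [ha0, hb0])) h0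
        · have := hp' b hb hb0
          simpa [ha0] using this
      · have h1 := hp a ha ha0
        by_cases hb0 : b = 0
        · simpa [hb0] using h1
        · have := hp' b hb hb0
          linarith
  have h1 := QuadraticForm.sigPos_add_sigNeg_add_radical
    (Q := B.toQuadraticMap.restrict (S ⊔ S'))
  obtain ⟨V, hV, hp⟩ := key 1 (Or.inl rfl)
  obtain ⟨V', hV', hp'⟩ := key (-1) (Or.inr rfl)
  have h2 : k + l ≤ sigPos (B.toQuadraticMap.restrict (S ⊔ S')) := by
    rw [← hV]
    refine le_sigPos_of_posDef _ fun x hx => ?_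
    have := hp x x.2 (fun e => hx (Subtype.ext e))
    rw [one_mul] at this
    exact this
  have h3 : k + l ≤ sigNeg (B.toQuadraticMap.restrict (S ⊔ S')) := by
    rw [← hV']
    refine le_sigNeg_of_negDef _ fun x hx => ?_
    have := hp' x x.2 (fun e => hx (Subtype.ext e))
    rw [neg_one_mul] at this
    exact this
  exact ⟨h.symm, inferInstance, hr, by omega, by omega⟩

end IsSplitSub

/-- An endomorphism which is skew and orthogonal on a split subspace `S`, and vanishes on the
orthogonal complement. -/
structure IsSGFAt (B : LinearMap.BilinForm ℝ W) (S : Submodule ℝ W) (J : Module.End ℝ W) :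
    Prop where
  split : ∃ k, IsSplitSub B k S
  mem : ∀ x, J x ∈ S
  zero : ∀ x, (∀ y ∈ S, B x y = 0) → J x = 0
  skew_on : ∀ x ∈ S, ∀ y ∈ S, B (J x) y = - B x (J y)
  orth : ∀ x ∈ S, ∀ y ∈ S, B (J x) (J y) = B x y

namespace IsSGFAt

variable {S : Submodule ℝ W} {J : Module.End ℝ W}

/-- As `J` vanishes on the orthogonal complement of `S`, it is skew on the whole space. -/
lemma skew (h : IsSGFAt B S J) (x y : W) : B (J x) y = - B x (J y) := by
  obtain ⟨k, hk⟩ := h.split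
  obtain ⟨x', hx', ex⟩ := hk.exists_sub_orthogonal x
  obtain ⟨y', hy', ey⟩ := hk.exists_sub_orthogonal y
  have h1 : J x = J x' := by
    rw [← sub_eq_zero, ← map_sub]; exact h.zero _ ex
  have h2 : J y = J y' := by
    rw [← sub_eq_zero, ← map_sub]; exact h.zero _ ey
  have e1 : B (J x') y = B (J x') y' := by
    have := ey _ (h.mem x')
    rw [hk.symm, map_sub, sub_eq_zero] at this
    exact this
  have e2 : B x (J y') = B x' (J y') := by
    have := ex _ (h.mem y')
    rw [map_sub, LinearMap.sub_apply, sub_eq_zero] at this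
    exact this
  rw [h1, h2, e1, e2, h.skew_on _ hx' _ hy']

/-- A skew orthogonal endomorphism is a complex structure on `S`. -/
lemma sq (h : IsSGFAt B S J) {x : W} (hx : x ∈ S) : J (J x) = -x := by
  obtain ⟨k, hk⟩ := h.split
  rw [← sub_eq_zero, sub_neg_eq_add]
  refine hk.eq_zero (S.add_mem (h.mem _) hx) fun y hy => ?_
  rw [map_add, LinearMap.add_apply, h.skew, h.orth _ hx _ hy]
  ring

lemma cube (h : IsSGFAt B S J) (x : W) : J (J (J x)) = -J x := h.sq (h.mem x)

lemma zero_of_orthogonal (h : IsSGFAt B S J) {S' : Submodule ℝ W}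
    (ho : ∀ x ∈ S, ∀ y ∈ S', B x y = 0) {x : W} (hx : x ∈ S') : J x = 0 := by
  obtain ⟨k, hk⟩ := h.split
  exact h.zero _ fun y hy => (hk.symm _ _).trans (ho y hy x hx)

end IsSGFAt

/-- The `√-1`-eigenspace of `J`, an element `a + √-1 b` of the complexification being represented by
the pair `(a, b)`: `J(a + √-1 b) = √-1 (a + √-1 b)` means that `J a = -b` and `J b = a`. -/
def eigPair (J : Module.End ℝ W) : Submodule ℝ (W × W) where
  carrier := {u | J u.1 = -u.2 ∧ J u.2 = u.1}
  zero_mem' := by simp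
  add_mem' {u w} hu hw := by
    constructor
    · rw [Prod.fst_add, map_add, hu.1, hw.1, Prod.snd_add, neg_add]
    · rw [Prod.snd_add, map_add, hu.2, hw.2, Prod.fst_add]
  smul_mem' c u hu := by
    constructor
    · rw [Prod.smul_fst, map_smul, hu.1, Prod.smul_snd, smul_neg]
    · rw [Prod.smul_snd, map_smul, hu.2, Prod.smul_fst]

lemma mem_eigPair {J : Module.End ℝ W} {u : W × W} :
    u ∈ eigPair J ↔ J u.1 = -u.2 ∧ J u.2 = u.1 := Iff.rfl

/-- Multiplication by `√-1` is `(a, b) ↦ (-b, a)` on pairs. -/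
lemma eigPair_I_smul {J : Module.End ℝ W} {u : W × W} (hu : u ∈ eigPair J) :
    (-u.2, u.1) ∈ eigPair J :=
  ⟨by rw [map_neg, hu.2], hu.1⟩

lemma IsSGFAt.mem_of_mem_eigPair {S : Submodule ℝ W} {J : Module.End ℝ W} (h : IsSGFAt B S J)
    {u : W × W} (hu : u ∈ eigPair J) : u.1 ∈ S ∧ u.2 ∈ S := by
  refine ⟨hu.2 ▸ h.mem u.2, ?_⟩
  have := h.mem u.1
  rw [hu.1] at this
  exact neg_mem_iff.1 this

/-- The `√-1`-eigenspace is isotropic for the complex bilinear extension of `B`, in real and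
imaginary parts. -/
lemma IsSGFAt.isotropic {S : Submodule ℝ W} {J : Module.End ℝ W} (h : IsSGFAt B S J)
    {u w : W × W} (hu : u ∈ eigPair J) (hw : w ∈ eigPair J) :
    B u.1 w.1 = B u.2 w.2 ∧ B u.1 w.2 = - B u.2 w.1 := by
  constructor
  · rw [← hu.2, h.skew, hw.1, map_neg, neg_neg]
  · rw [← hu.2, h.skew, hw.2]

/-- `x ↦ -J(Jx) - √-1 Jx` takes values in the `√-1`-eigenspace, for all `x`: on `S` it is
`x ↦ x - √-1 Jx`, and it vanishes on the orthogonal complement. -/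
lemma IsSGFAt.mem_eigPair_map {S : Submodule ℝ W} {J : Module.End ℝ W} (h : IsSGFAt B S J) (x : W) :
    (-J (J x), -J x) ∈ eigPair J := by
  refine ⟨?_, ?_⟩
  · simp [h.cube]
  · simp

end LinAlg

/-! ### Complex sections as pairs of real sections -/

section Pairs

variable {E : Type*} [NormedAddCommGroup E] [NormedSpace ℝ E]
  {H : Type*} [TopologicalSpace H] {I : ModelWithCorners ℝ E H}
  {M : Type*} [TopologicalSpace M] [ChartedSpace H M]

/-- The value at `p` of a complex section `s.1 + √-1 s.2`, encoded by the pair `s`. -/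
def ev (s : GSec I M × GSec I M) (p : M) : GT I p × GT I p := (s.1 p, s.2 p)

lemma ev_add (s t : GSec I M × GSec I M) (p : M) : ev (s + t) p = ev s p + ev t p := rfl

/-- The complex-bilinear Dorfman bracket on pairs. -/
def br (s t : GSec I M × GSec I M) : GSec I M × GSec I M :=
  (dorfman s.1 t.1 - dorfman s.2 t.2, dorfman s.1 t.2 + dorfman s.2 t.1)

lemma tmul_rePart_add_imPart (p : M) (z : CGT I p) :
    (1 : ℂ) ⊗ₜ[ℝ] rePart I p z + Complex.I ⊗ₜ[ℝ] imPart I p z = z := by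
  induction z using TensorProduct.induction_on with
  | zero => simp
  | tmul a x =>
    simp only [rePart, imPart, LinearMap.comp_apply, LinearMap.rTensor_tmul,
      LinearEquiv.coe_coe, TensorProduct.lid_tmul, Complex.reLm_coe, Complex.imLm_coe]
    rw [← TensorProduct.smul_tmul, ← TensorProduct.smul_tmul, ← TensorProduct.add_tmul]
    congr 1
    simp
  | add z w hz hw =>
    conv_rhs => rw [← hz, ← hw]
    simp only [map_add, TensorProduct.tmul_add]
    abel

lemma rePart_tmul (p : M) (c : ℂ) (x : GT I p) : rePart I p (c ⊗ₜ[ℝ] x) = c.re • x := by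
  simp [rePart]

lemma imPart_tmul (p : M) (c : ℂ) (x : GT I p) : imPart I p (c ⊗ₜ[ℝ] x) = c.im • x := by
  simp [imPart]

lemma rePart_mk (p : M) (a b : GT I p) :
    rePart I p ((1 : ℂ) ⊗ₜ[ℝ] a + Complex.I ⊗ₜ[ℝ] b) = a := by
  rw [map_add, rePart_tmul, rePart_tmul]; simp

lemma imPart_mk (p : M) (a b : GT I p) :
    imPart I p ((1 : ℂ) ⊗ₜ[ℝ] a + Complex.I ⊗ₜ[ℝ] b) = b := by
  rw [map_add, imPart_tmul, imPart_tmul]; simp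

lemma CGT.ext {p : M} {z w : CGT I p} (hr : rePart I p z = rePart I p w)
    (hi : imPart I p z = imPart I p w) : z = w := by
  rw [← tmul_rePart_add_imPart p z, ← tmul_rePart_add_imPart p w, hr, hi]

lemma mem_eigL {J : EndFib I M} {p : M} {z : CGT I p} :
    z ∈ eigL J p ↔ (rePart I p z, imPart I p z) ∈ eigPair (J p) := by
  have h1 : LinearMap.baseChange ℂ (J p) z =
      (1 : ℂ) ⊗ₜ[ℝ] J p (rePart I p z) + Complex.I ⊗ₜ[ℝ] J p (imPart I p z) := by
    conv_lhs => rw [← tmul_rePart_add_imPart p z]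
    rw [map_add, LinearMap.baseChange_tmul, LinearMap.baseChange_tmul]
  have hr : rePart I p (Complex.I • z) = - imPart I p z := by simp [rePart_smul]
  have hi : imPart I p (Complex.I • z) = rePart I p z := by simp [imPart_smul]
  rw [eigL, Module.End.mem_eigenspace_iff, h1, mem_eigPair]
  constructor
  · intro h
    have e1 := congrArg (rePart I p) h
    have e2 := congrArg (imPart I p) h
    rw [rePart_mk, hr] at e1
    rw [imPart_mk, hi] at e2
    exact ⟨e1, e2⟩
  · rintro ⟨e1, e2⟩
    refine CGT.ext ?_ ?_
    · rw [rePart_mk, hr]; exact e1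
    · rw [imPart_mk, hi]; exact e2

lemma mem_fibC {F : Fib I M} {p : M} {z : CGT I p} :
    z ∈ fibC I F p ↔ rePart I p z ∈ F p ∧ imPart I p z ∈ F p := by
  constructor
  · intro h
    rw [fibC, Submodule.baseChange_eq_span] at h
    induction h using Submodule.span_induction with
    | mem x hx =>
      obtain ⟨y, hy, rfl⟩ := hx
      change rePart I p ((1 : ℂ) ⊗ₜ[ℝ] y) ∈ F p ∧ imPart I p ((1 : ℂ) ⊗ₜ[ℝ] y) ∈ F p
      rw [rePart_tmul, imPart_tmul]
      exact ⟨(F p).smul_mem _ hy, (F p).smul_mem _ hy⟩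
    | zero => rw [map_zero, map_zero]; exact ⟨(F p).zero_mem, (F p).zero_mem⟩
    | add x y _ _ hx hy =>
      rw [map_add, map_add]; exact ⟨(F p).add_mem hx.1 hy.1, (F p).add_mem hx.2 hy.2⟩
    | smul c x _ hx =>
      rw [rePart_smul, imPart_smul]
      exact ⟨(F p).sub_mem ((F p).smul_mem _ hx.1) ((F p).smul_mem _ hx.2),
        (F p).add_mem ((F p).smul_mem _ hx.2) ((F p).smul_mem _ hx.1)⟩
  · rintro ⟨h1, h2⟩
    rw [← tmul_rePart_add_imPart p z]
    exact Submodule.add_mem _ (Submodule.tmul_mem_baseChange_of_mem _ h1)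
      (Submodule.tmul_mem_baseChange_of_mem _ h2)

/-- The pair of the real and the imaginary part of a complex section. -/
def toPair (s : CSec I M) : GSec I M × GSec I M :=
  (fun p => rePart I p (s p), fun p => imPart I p (s p))

/-- The complex section with given real and imaginary parts. -/
def ofPair (s : GSec I M × GSec I M) : CSec I M :=
  fun p => (1 : ℂ) ⊗ₜ[ℝ] s.1 p + Complex.I ⊗ₜ[ℝ] s.2 p

lemma toPair_ofPair (s : GSec I M × GSec I M) : toPair (ofPair s) = s :=
  Prod.ext (funext fun p => rePart_mk p _ _) (funext fun p => imPart_mk p _ _)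

lemma ofPair_toPair (s : CSec I M) : ofPair (toPair s) = s :=
  funext fun p => tmul_rePart_add_imPart p (s p)

lemma toPair_add (s t : CSec I M) : toPair (s + t) = toPair s + toPair t :=
  Prod.ext (funext fun _ => map_add _ _ _) (funext fun _ => map_add _ _ _)

lemma toPair_toC (x : GSec I M) : toPair (toC I M x) = (x, 0) := by
  refine Prod.ext (funext fun p => ?_) (funext fun p => ?_)
  · change rePart I p ((1 : ℂ) ⊗ₜ[ℝ] x p) = _
    rw [rePart_tmul]; simp
  · change imPart I p ((1 : ℂ) ⊗ₜ[ℝ] x p) = _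
    rw [imPart_tmul]; simp

lemma toPair_cdorfmanOn (s t : CSec I M) :
    toPair (cdorfmanOn univ s t) = br (toPair s) (toPair t) := by
  refine Prod.ext (funext fun p => ?_) (funext fun p => ?_)
  · simp only [toPair, cdorfmanOn, mem_univ, if_true]
    exact rePart_mk p _ _
  · simp only [toPair, cdorfmanOn, mem_univ, if_true]
    exact imPart_mk p _ _

lemma toC_injective : Function.Injective (toC I M) := by
  intro x y h
  have := congrArg toPair h
  rw [toPair_toC, toPair_toC] at this
  exact congrArg Prod.fst this

variable [IsManifold I ∞ M]

/-- The smooth sections of a family of subspaces of pairs, as a `C^∞(M)`-module. -/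
def pairSecs (T : ∀ p : M, Submodule ℝ (GT I p × GT I p)) :
    Submodule (smoothFun (M := M) I ℝ univ) (GSec I M × GSec I M) where
  carrier := {s | SmoothOn univ s.1 ∧ SmoothOn univ s.2 ∧ ∀ p, ev s p ∈ T p}
  zero_mem' := ⟨SmoothOn.zero I univ, SmoothOn.zero I univ, fun p => (T p).zero_mem⟩
  add_mem' hs ht := ⟨hs.1.add ht.1, hs.2.1.add ht.2.1, fun p => (T p).add_mem (hs.2.2 p) (ht.2.2 p)⟩
  smul_mem' c _ hs := ⟨hs.1.smul c.2, hs.2.1.smul c.2, fun p => (T p).smul_mem (c.1 p) (hs.2.2 p)⟩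

/-- The smooth sections of `L_J`, as pairs. -/
abbrev eigSecs (J : EndFib I M) : Submodule (smoothFun (M := M) I ℝ univ) (GSec I M × GSec I M) :=
  pairSecs fun p => eigPair (J p)

lemma mem_csecs_univ {T : ∀ p : M, Submodule ℂ (CGT I p)} {s : CSec I M} :
    s ∈ csecs I univ T ↔
      SmoothOn univ (toPair s).1 ∧ SmoothOn univ (toPair s).2 ∧ ∀ p, s p ∈ T p := by
  constructor
  · intro h; exact ⟨h.1.1, h.1.2, fun p => h.2.1 p (mem_univ p)⟩
  · intro h; exact ⟨⟨h.1, h.2.1⟩, fun p _ => h.2.2 p, fun p hp => absurd (mem_univ p) hp⟩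

lemma mem_csecs_eigL {J : EndFib I M} {s : CSec I M} :
    s ∈ csecs I univ (eigL J) ↔ toPair s ∈ eigSecs J := by
  rw [mem_csecs_univ]
  exact and_congr_right fun _ => and_congr_right fun _ => forall_congr' fun p => mem_eigL

lemma mem_secs_univ {F : Fib I M} {x : GSec I M} :
    x ∈ secs I univ F ↔ SmoothOn univ x ∧ ∀ p, x p ∈ F p := by
  constructor
  · intro h; exact ⟨h.1, fun p => h.2.1 p (mem_univ p)⟩
  · intro h; exact ⟨h.1, fun p _ => h.2 p, fun p hp => absurd (mem_univ p) hp⟩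

lemma toC_mem_csecs_top {v : GSec I M} :
    toC I M v ∈ csecs I univ (fun _ => ⊤) ↔ SmoothOn univ v := by
  rw [mem_csecs_univ, toPair_toC]
  exact ⟨fun h => h.1, fun h => ⟨h, SmoothOn.zero I univ, fun _ => trivial⟩⟩

variable [FiniteDimensional ℝ E] [T2Space M]

lemma dorfman_zero_left {y : GSec I M} (hy : SmoothOn univ y) :
    dorfman (0 : GSec I M) y = 0 := by
  funext p
  have h := dorfman_add_left (SmoothOn.zero I univ) (SmoothOn.zero I univ) hy p
  rw [add_zero] at h
  exact left_eq_add.1 h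

lemma dorfman_zero_right {x : GSec I M} (hx : SmoothOn univ x) :
    dorfman x (0 : GSec I M) = 0 := by
  funext p
  have h := dorfman_add_right hx (SmoothOn.zero I univ) (SmoothOn.zero I univ) p
  rw [add_zero] at h
  exact left_eq_add.1 h

/-- Integrability of `J`, in terms of pairs. Smoothness of brackets is automatic, so that only the
pointwise condition remains. -/
lemma isCRF_iff {F : Fib I M} {J : EndFib I M} :
    IsCRF I F J ↔ IsSGF I F J ∧
      ∀ s ∈ eigSecs J, ∀ t ∈ eigSecs J, ∀ p, ev (br s t) p ∈ eigPair (J p) := by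
  constructor
  · intro h
    refine ⟨h.toIsSGF, fun s hs t ht => ?_⟩
    rw [← toPair_ofPair s] at hs ⊢
    rw [← toPair_ofPair t] at ht ⊢
    have := h.closed _ (mem_csecs_eigL.2 hs) _ (mem_csecs_eigL.2 ht)
    rw [mem_csecs_eigL, toPair_cdorfmanOn] at this
    exact this.2.2
  · rintro ⟨h, hc⟩
    refine ⟨h, fun s hs t ht => ?_⟩
    rw [mem_csecs_eigL] at hs ht ⊢
    rw [toPair_cdorfmanOn]
    exact ⟨(hs.1.dorfman ht.1).sub (hs.2.1.dorfman ht.2.1),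
      (hs.1.dorfman ht.2.1).add (hs.2.1.dorfman ht.1), hc _ hs _ ht⟩

/-- A real section normalizes `L_J` if it is smooth and its brackets with the real and imaginary
parts of sections of `L_J` are again those of sections of `L_J`. -/
lemma toC_mem_normalizerSGF {J : EndFib I M} {v : GSec I M} :
    toC I M v ∈ normalizerSGF I J ↔ SmoothOn univ v ∧
      ∀ s ∈ eigSecs J, ∀ p, (dorfman v s.1 p, dorfman v s.2 p) ∈ eigPair (J p) := by
  have h1 : toC I M v ∈ normalizerSGF I J ↔ SmoothOn univ v ∧
      ∀ s, toPair s ∈ eigSecs J → br (v, 0) (toPair s) ∈ eigSecs J := by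
    refine and_congr toC_mem_csecs_top (forall_congr' fun s => ?_)
    change (s ∈ csecs I univ (eigL J) → _ ∈ csecs I univ (eigL J)) ↔ _
    rw [mem_csecs_eigL, mem_csecs_eigL, toPair_cdorfmanOn, toPair_toC]
  refine h1.trans (and_congr_right fun hv => ?_)
  have key : ∀ s ∈ eigSecs J, br (v, 0) s = (dorfman v s.1, dorfman v s.2) := by
    intro s hs
    simp only [br]
    rw [dorfman_zero_left hs.1, dorfman_zero_left hs.2.1, sub_zero, add_zero]
  constructor
  · intro h s hs p
    have := h (ofPair s) (by rwa [toPair_ofPair])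
    rw [toPair_ofPair, key s hs] at this
    exact this.2.2 p
  · intro h s hs
    rw [key _ hs]
    exact ⟨hv.dorfman hs.1, hv.dorfman hs.2.1, h _ hs⟩

/-- A real section normalizes the real subbundle `F` if it is smooth and brackets with it preserve
sections of `F`. -/
lemma toC_mem_normalizerFib {F : Fib I M} {v : GSec I M} :
    toC I M v ∈ normalizerFib I univ F ↔ SmoothOn univ v ∧
      ∀ y, SmoothOn univ y → (∀ p, y p ∈ F p) → ∀ p, dorfman v y p ∈ F p := by
  refine (and_congr toC_mem_csecs_top Iff.rfl).trans (and_congr_right fun hv => ?_)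
  have key : ∀ y, SmoothOn univ y →
      cdorfmanOn univ (toC I M v) (toC I M y) = toC I M (dorfman v y) := by
    intro y hy
    rw [← ofPair_toPair (cdorfmanOn univ (toC I M v) (toC I M y)), toPair_cdorfmanOn, toPair_toC,
      toPair_toC, ← ofPair_toPair (toC I M (dorfman v y)), toPair_toC]
    simp only [br]
    rw [dorfman_zero_left hy, dorfman_zero_left (SmoothOn.zero I univ), dorfman_zero_right hv,
      sub_zero, add_zero]
  constructor
  · intro h y hy hyF
    obtain ⟨w, hw, e⟩ := h _ ⟨y, mem_secs_univ.2 ⟨hy, hyF⟩, rfl⟩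
    rw [key y hy] at e
    rw [← toC_injective e]
    exact (mem_secs_univ.1 hw).2
  · rintro h _ ⟨y, hy, rfl⟩
    have hy' := mem_secs_univ.1 hy
    exact ⟨dorfman v y, mem_secs_univ.2 ⟨hv.dorfman hy'.1, h y hy'.1 hy'.2⟩, (key y hy'.1).symm⟩

end Pairs

/-! ### Brackets of sections of `L_J` -/

section Closure

variable {E : Type*} [NormedAddCommGroup E] [NormedSpace ℝ E]
  {H : Type*} [TopologicalSpace H] {I : ModelWithCorners ℝ E H}
  {M : Type*} [TopologicalSpace M] [ChartedSpace H M] [IsManifold I ∞ M]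

/-- The fibrewise content of a split generalized `F`-structure. -/
lemma IsSGF.isSGFAt {F : Fib I M} {J : EndFib I M} (h : IsSGF I F J) (p : M) :
    IsSGFAt (inn I p) (F p) (J p) where
  split := by
    obtain ⟨k, hk⟩ := h.split
    obtain ⟨U, -, hp, e, -, he⟩ := hk.frame p
    obtain ⟨hi, hs⟩ := he p hp
    refine ⟨k, inn_comm p, ?_, ?_, hk.signature p⟩
    · rw [← hs]; exact FiniteDimensional.span_of_finite ℝ (finite_range _)
    · rw [← hs, finrank_span_eq_card hi, Fintype.card_fin]
  mem := h.mem p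
  zero := h.zero p
  skew_on := h.skew p
  orth := h.orth p

lemma IsSplit.isSplitSub {F : Fib I M} (h : IsSplit I F) :
    ∃ k, ∀ p, IsSplitSub (inn I p) k (F p) := by
  obtain ⟨k, hk⟩ := h
  refine ⟨k, fun p => ?_⟩
  obtain ⟨U, -, hp, e, -, he⟩ := hk.frame p
  obtain ⟨hi, hs⟩ := he p hp
  refine ⟨inn_comm p, ?_, ?_, hk.signature p⟩
  · rw [← hs]; exact FiniteDimensional.span_of_finite ℝ (finite_range _)
  · rw [← hs, finrank_span_eq_card hi, Fintype.card_fin]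

lemma IsSGF.smooth_univ {F : Fib I M} {J : EndFib I M} (h : IsSGF I F J) {x : GSec I M}
    (hx : SmoothOn univ x) : SmoothOn univ (fun p => J p (x p) : GSec I M) :=
  h.smooth univ isOpen_univ x hx

/-- The section `-J(Jg) - √-1 Jg` of `L_J`. It is globally defined for every section `g` of `𝕋M`,
and equal to `g - √-1 Jg` where `g` lies in the subbundle on which `J` lives. -/
def eigSec (J : EndFib I M) (g : GSec I M) : GSec I M × GSec I M :=
  (-(fun p => J p (J p (g p)) : GSec I M), -(fun p => J p (g p) : GSec I M))

lemma IsSGF.eigSec_mem {F : Fib I M} {J : EndFib I M} (h : IsSGF I F J) {g : GSec I M}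
    (hg : SmoothOn univ g) : eigSec J g ∈ eigSecs J :=
  ⟨(h.smooth_univ (h.smooth_univ hg)).neg, (h.smooth_univ hg).neg,
    fun p => (h.isSGFAt p).mem_eigPair_map (g p)⟩

variable [FiniteDimensional ℝ E] [T2Space M]

/-- Every element of the fibre of `L_J` extends to a global section of `L_J`. -/
lemma IsSGF.exists_eigSec {F : Fib I M} {J : EndFib I M} (h : IsSGF I F J) {p : M}
    {u : GT I p × GT I p} (hu : u ∈ eigPair (J p)) : ∃ s ∈ eigSecs J, ev s p = u := by
  obtain ⟨g, hg, e⟩ := exists_section p u.1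
  refine ⟨_, h.eigSec_mem hg, ?_⟩
  refine Prod.ext ?_ ?_
  · change -(J p (J p (g p))) = u.1
    rw [e, hu.1, map_neg, neg_neg, hu.2]
  · change -(J p (g p)) = u.2
    rw [e, hu.1, neg_neg]

omit [FiniteDimensional ℝ E] [T2Space M] in
/-- The bracket of complex sections is local. -/
lemma br_congr {s s' t t' : GSec I M × GSec I M} {p : M} (hs : ∀ᶠ q in nhds p, ev s q = ev s' q)
    (ht : ∀ᶠ q in nhds p, ev t q = ev t' q) : ev (br s t) p = ev (br s' t') p := by
  have hs1 : ∀ᶠ q in nhds p, s.1 q = s'.1 q := hs.mono fun q h => congrArg Prod.fst h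
  have hs2 : ∀ᶠ q in nhds p, s.2 q = s'.2 q := hs.mono fun q h => congrArg Prod.snd h
  have ht1 : ∀ᶠ q in nhds p, t.1 q = t'.1 q := ht.mono fun q h => congrArg Prod.fst h
  have ht2 : ∀ᶠ q in nhds p, t.2 q = t'.2 q := ht.mono fun q h => congrArg Prod.snd h
  refine Prod.ext ?_ ?_
  · change dorfman s.1 t.1 p - dorfman s.2 t.2 p = dorfman s'.1 t'.1 p - dorfman s'.2 t'.2 p
    rw [dorfman_congr hs1 ht1, dorfman_congr hs2 ht2]
  · change dorfman s.1 t.2 p + dorfman s.2 t.1 p = dorfman s'.1 t'.2 p + dorfman s'.2 t'.1 p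
    rw [dorfman_congr hs1 ht2, dorfman_congr hs2 ht1]

section Leibniz

variable {T T' : ∀ p : M, Submodule ℝ (GT I p × GT I p)} {s s' t t' : GSec I M × GSec I M}

lemma br_add_left (hs : s ∈ pairSecs T) (hs' : s' ∈ pairSecs T) (ht : t ∈ pairSecs T') (p : M) :
    ev (br (s + s') t) p = ev (br s t) p + ev (br s' t) p := by
  refine Prod.ext ?_ ?_
  · change dorfman (s.1 + s'.1) t.1 p - dorfman (s.2 + s'.2) t.2 p =
      dorfman s.1 t.1 p - dorfman s.2 t.2 p + (dorfman s'.1 t.1 p - dorfman s'.2 t.2 p)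
    rw [dorfman_add_left hs.1 hs'.1 ht.1, dorfman_add_left hs.2.1 hs'.2.1 ht.2.1]; abel
  · change dorfman (s.1 + s'.1) t.2 p + dorfman (s.2 + s'.2) t.1 p =
      dorfman s.1 t.2 p + dorfman s.2 t.1 p + (dorfman s'.1 t.2 p + dorfman s'.2 t.1 p)
    rw [dorfman_add_left hs.1 hs'.1 ht.2.1, dorfman_add_left hs.2.1 hs'.2.1 ht.1]; abel

lemma br_add_right (hs : s ∈ pairSecs T) (ht : t ∈ pairSecs T') (ht' : t' ∈ pairSecs T') (p : M) :
    ev (br s (t + t')) p = ev (br s t) p + ev (br s t') p := by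
  refine Prod.ext ?_ ?_
  · change dorfman s.1 (t.1 + t'.1) p - dorfman s.2 (t.2 + t'.2) p =
      dorfman s.1 t.1 p - dorfman s.2 t.2 p + (dorfman s.1 t'.1 p - dorfman s.2 t'.2 p)
    rw [dorfman_add_right hs.1 ht.1 ht'.1, dorfman_add_right hs.2.1 ht.2.1 ht'.2.1]; abel
  · change dorfman s.1 (t.2 + t'.2) p + dorfman s.2 (t.1 + t'.1) p =
      dorfman s.1 t.2 p + dorfman s.2 t.1 p + (dorfman s.1 t'.2 p + dorfman s.2 t'.1 p)
    rw [dorfman_add_right hs.1 ht.2.1 ht'.2.1, dorfman_add_right hs.2.1 ht.1 ht'.1]; abel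

lemma br_smul_right (hs : s ∈ pairSecs T) (ht : t ∈ pairSecs T') {f : M → ℝ}
    (hc : ContMDiff I 𝓘(ℝ, ℝ) ∞ f) (p : M) : ev (br s (f • t.1, f • t.2)) p = f p • ev (br s t) p +
      (mvfderiv I f p (s.1 p).1 • ev t p +
        mvfderiv I f p (s.2 p).1 • (-(ev t p).2, (ev t p).1)) := by
  refine Prod.ext ?_ ?_
  · change dorfman s.1 (f • t.1) p - dorfman s.2 (f • t.2) p =
      f p • (dorfman s.1 t.1 p - dorfman s.2 t.2 p) +
      (mvfderiv I f p (s.1 p).1 • t.1 p + mvfderiv I f p (s.2 p).1 • -(t.2 p))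
    rw [dorfman_smul_right hs.1 ht.1 hc, dorfman_smul_right hs.2.1 ht.2.1 hc, smul_sub, smul_neg]
    abel
  · change dorfman s.1 (f • t.2) p + dorfman s.2 (f • t.1) p =
      f p • (dorfman s.1 t.2 p + dorfman s.2 t.1 p) +
      (mvfderiv I f p (s.1 p).1 • t.2 p + mvfderiv I f p (s.2 p).1 • t.1 p)
    rw [dorfman_smul_right hs.1 ht.2.1 hc, dorfman_smul_right hs.2.1 ht.1 hc, smul_add]
    abel

/-- The Leibniz rule in the first argument, at a point where the complex bilinear product of the two
sections vanishes. -/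
lemma br_smul_left (hs : s ∈ pairSecs T) (ht : t ∈ pairSecs T') {f : M → ℝ}
    (hc : ContMDiff I 𝓘(ℝ, ℝ) ∞ f) (p : M) (h1 : inn I p (s.1 p) (t.1 p) = inn I p (s.2 p) (t.2 p))
    (h2 : inn I p (s.1 p) (t.2 p) = - inn I p (s.2 p) (t.1 p)) :
    ev (br (f • s.1, f • s.2) t) p = f p • ev (br s t) p -
      (mvfderiv I f p (t.1 p).1 • ev s p +
        mvfderiv I f p (t.2 p).1 • (-(ev s p).2, (ev s p).1)) := by
  refine Prod.ext ?_ ?_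
  · change dorfman (f • s.1) t.1 p - dorfman (f • s.2) t.2 p =
      f p • (dorfman s.1 t.1 p - dorfman s.2 t.2 p) -
      (mvfderiv I f p (t.1 p).1 • s.1 p + mvfderiv I f p (t.2 p).1 • -(s.2 p))
    rw [dorfman_smul_left hs.1 ht.1 hc, dorfman_smul_left hs.2.1 ht.2.1 hc, smul_sub, smul_neg, h1]
    abel
  · change dorfman (f • s.1) t.2 p + dorfman (f • s.2) t.1 p =
      f p • (dorfman s.1 t.2 p + dorfman s.2 t.1 p) -
      (mvfderiv I f p (t.1 p).1 • s.2 p + mvfderiv I f p (t.2 p).1 • s.1 p)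
    rw [dorfman_smul_left hs.1 ht.2.1 hc, dorfman_smul_left hs.2.1 ht.1 hc, h2]
    module

end Leibniz

omit [FiniteDimensional ℝ E] [T2Space M] in
/-- On the isotropic subbundle `L_J` the bracket is skew. -/
lemma IsSGF.br_swap {F : Fib I M} {J : EndFib I M} (h : IsSGF I F J) {s t : GSec I M × GSec I M}
    (hs : s ∈ eigSecs J) (ht : t ∈ eigSecs J) (p : M) : ev (br s t) p = -ev (br t s) p := by
  have hi := fun q => (h.isSGFAt q).isotropic (hs.2.2 q) (ht.2.2 q)
  have e1 : (fun q => inn I q (s.1 q) (t.1 q)) = fun q => inn I q (s.2 q) (t.2 q) :=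
    funext fun q => (hi q).1
  have e2 : (fun q => inn I q (s.1 q) (t.2 q)) = fun q => inn I q (-s.2 q) (t.1 q) :=
    funext fun q => by rw [map_neg, LinearMap.neg_apply]; exact (hi q).2
  have d11 := dorfman_add_swap hs.1 ht.1 p
  have d22 := dorfman_add_swap hs.2.1 ht.2.1 p
  have d12 := dorfman_add_swap hs.1 ht.2.1 p
  have d21 := dorfman_add_swap hs.2.1 ht.1 p
  rw [e1] at d11
  have e3 := diffSec_add (I := I) (hs.1.contMDiff_inn ht.2.1) (hs.2.1.contMDiff_inn ht.1) p
  have e4 : ((fun q => inn I q (s.1 q) (t.2 q)) + fun q => inn I q (s.2 q) (t.1 q)) =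
      fun _ => 0 := by
    funext q
    change inn I q (s.1 q) (t.2 q) + inn I q (s.2 q) (t.1 q) = 0
    rw [show inn I q (s.1 q) (t.2 q) = -inn I q (s.2 q) (t.1 q) from (hi q).2, neg_add_cancel]
  -- `[s, t] + [t, s] = 2 d⟨s, t⟩`, and `⟨s, t⟩ = 0` in real and imaginary parts
  have e5 : diffSec I (fun _ : M => (0 : ℝ)) p = 0 := by
    simp [diffSec, mvfderiv_const]
  rw [e4, e5] at e3
  refine Prod.ext ?_ ?_
  · change dorfman s.1 t.1 p - dorfman s.2 t.2 p = -(dorfman t.1 s.1 p - dorfman t.2 s.2 p)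
    rw [← d22] at d11
    rw [← sub_eq_zero] at d11 ⊢
    rw [← d11]
    abel
  · change dorfman s.1 t.2 p + dorfman s.2 t.1 p = -(dorfman t.1 s.2 p + dorfman t.2 s.1 p)
    rw [← sub_eq_zero]
    calc _ = (dorfman s.1 t.2 p + dorfman t.2 s.1 p) + (dorfman s.2 t.1 p + dorfman t.1 s.2 p) := by
          abel
      _ = _ := by rw [d12, d21, ← smul_add, ← e3, smul_zero]

/-- If the sections of `L_J` are spanned near `q` over the smooth functions by elements of `𝒢`, then
it is enough to locate the brackets of elements of `𝒢`: as `L_J` is isotropic, the further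
terms of the Leibniz rules are combinations of the generators. -/
theorem IsSGF.br_mem {F : Fib I M} {J : EndFib I M} (h : IsSGF I F J) {q : M}
    {𝒢 : Set (GSec I M × GSec I M)} (h𝒢 : ∀ G ∈ 𝒢, G ∈ eigSecs J)
    (hgen : ∀ s ∈ eigSecs J, ∃ s' ∈ Submodule.span (smoothFun (M := M) I ℝ univ) 𝒢,
      ∀ᶠ r in nhds q, ev s r = ev s' r)
    {T : Submodule ℝ (GT I q × GT I q)} (hT : ∀ u ∈ T, (-u.2, u.1) ∈ T)
    (hev : ∀ G ∈ 𝒢, ev G q ∈ T) (hbr : ∀ G ∈ 𝒢, ∀ G' ∈ 𝒢, ev (br G G') q ∈ T)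
    {s t : GSec I M × GSec I M} (hs : s ∈ eigSecs J) (ht : t ∈ eigSecs J) :
    ev (br s t) q ∈ T := by
  obtain ⟨s', hs', es⟩ := hgen s hs
  obtain ⟨t', ht', et⟩ := hgen t ht
  rw [br_congr es et]
  have hle : Submodule.span (smoothFun (M := M) I ℝ univ) 𝒢 ≤ eigSecs J := Submodule.span_le.2 h𝒢
  have hspan : ∀ s ∈ Submodule.span (smoothFun (M := M) I ℝ univ) 𝒢, ev s q ∈ T := by
    intro s hs
    induction hs using Submodule.span_induction with
    | mem x hx => exact hev x hx
    | zero => exact T.zero_mem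
    | add x y _ _ hx hy => exact T.add_mem hx hy
    | smul c x _ hx => exact T.smul_mem (c.1 q) hx
  have hz : (0 : GSec I M × GSec I M) ∈ eigSecs J := Submodule.zero_mem _
  clear es et hs ht
  induction hs', ht' using Submodule.span_induction₂ with
  | mem_mem x y hx hy => exact hbr x hx y hy
  | zero_left y hy =>
    have e := br_add_left hz hz (hle hy) q
    rw [add_zero] at e
    rw [left_eq_add.1 e]; exact T.zero_mem
  | zero_right x hx =>
    have e := br_add_right (hle hx) hz hz q
    rw [add_zero] at e
    rw [left_eq_add.1 e]; exact T.zero_mem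
  | add_left x y z hx hy hz h1 h2 =>
    rw [br_add_left (hle hx) (hle hy) (hle hz)]; exact T.add_mem h1 h2
  | add_right x y z hx hy hz h1 h2 =>
    rw [br_add_right (hle hx) (hle hy) (hle hz)]; exact T.add_mem h1 h2
  | smul_left c x y hx hy h1 =>
    have hi := (h.isSGFAt q).isotropic ((hle hx).2.2 q) ((hle hy).2.2 q)
    change ev (br (c.1 • x.1, c.1 • x.2) y) q ∈ T
    rw [br_smul_left (hle hx) (hle hy) (contMDiffOn_univ.1 c.2) q hi.1 hi.2]
    exact T.sub_mem (T.smul_mem _ h1)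
      (T.add_mem (T.smul_mem _ (hspan x hx)) (T.smul_mem _ (hT _ (hspan x hx))))
  | smul_right c x y hx hy h1 =>
    change ev (br x (c.1 • y.1, c.1 • y.2)) q ∈ T
    rw [br_smul_right (hle hx) (hle hy) (contMDiffOn_univ.1 c.2) q]
    exact T.add_mem (T.smul_mem _ h1)
      (T.add_mem (T.smul_mem _ (hspan y hy)) (T.smul_mem _ (hT _ (hspan y hy))))

end Closure

/-! ### Frames and Gram matrices -/

/-- A basis of `V`, as a family of elements of the ambient space. -/
lemma exists_fin_spanning {X : Type*} [AddCommGroup X] [Module ℝ X] (V : Submodule ℝ X)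
    [Module.Finite ℝ V] : ∃ x : Fin (Module.finrank ℝ V) → X, (∀ i, x i ∈ V) ∧
      ∀ v ∈ V, ∃ c : Fin (Module.finrank ℝ V) → ℝ, v = ∑ i, c i • x i := by
  let b := Module.finBasis ℝ V
  refine ⟨fun i => b i, fun i => (b i).2, fun v hv => ⟨b.repr ⟨v, hv⟩, ?_⟩⟩
  have e := congrArg Subtype.val (b.sum_repr ⟨v, hv⟩)
  simp only [AddSubmonoidClass.coe_finsetSum, Submodule.coe_smul] at e
  exact e.symm

/-- A spanning family of vectors of the right cardinality has an invertible Gram matrix. -/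
lemma IsSplitSub.det_gram_ne_zero {W : Type*} [AddCommGroup W] [Module ℝ W]
    {B : LinearMap.BilinForm ℝ W} {k : ℕ} {S : Submodule ℝ W} (h : IsSplitSub B k S) {n : ℕ}
    (hn : n = Module.finrank ℝ S) {x : Fin n → W} (hx : ∀ i, x i ∈ S)
    (hspan : ∀ f ∈ S, ∃ c : Fin n → ℝ, f = ∑ i, c i • x i) :
    (Matrix.of fun i j => B (x i) (x j)).det ≠ 0 := by
  have := h.finite
  have hS : Submodule.span ℝ (range x) = S := by
    refine le_antisymm (Submodule.span_le.2 (range_subset_iff.2 hx)) fun f hf => ?_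
    obtain ⟨c, hc⟩ := hspan f hf
    exact (Submodule.mem_span_range_iff_exists_fun ℝ).2 ⟨c, hc.symm⟩
  have hli : LinearIndependent ℝ x := by
    rw [linearIndependent_iff_card_eq_finrank_span, Fintype.card_fin, Set.finrank, hS, hn]
  intro h0
  obtain ⟨c, hc0, hc⟩ := Matrix.exists_mulVec_eq_zero_iff.2 h0
  refine hc0 (funext (Fintype.linearIndependent_iff.1 hli c ?_))
  refine h.eq_zero (Submodule.sum_mem _ fun i _ => Submodule.smul_mem _ _ (hx i)) fun y hy => ?_
  obtain ⟨d, rfl⟩ := hspan y hy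
  simp only [map_sum, map_smul, smul_eq_mul]
  refine Finset.sum_eq_zero fun i _ => ?_
  have := congrFun hc i
  simp only [Matrix.mulVec, dotProduct, Matrix.of_apply, Pi.zero_apply] at this
  rw [← mul_zero (d i), ← this]
  congr 1
  rw [LinearMap.sum_apply]
  exact Finset.sum_congr rfl fun j _ => by
    rw [LinearMap.smul_apply, smul_eq_mul, mul_comm, h.symm]

/-- Expansion with respect to a family with invertible Gram matrix. -/
lemma sum_gram_inv {W : Type*} [AddCommGroup W] [Module ℝ W]
    {B : LinearMap.BilinForm ℝ W} (hB : ∀ x y, B x y = B y x) {n : ℕ} {x : Fin n → W}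
    (h0 : (Matrix.of fun i j => B (x i) (x j)).det ≠ 0) (c : Fin n → ℝ) (i : Fin n) :
    B (∑ l, c l • x l) (∑ j, (Matrix.of fun i j => B (x i) (x j))⁻¹ i j • x j) = c i := by
  set G : Matrix (Fin n) (Fin n) ℝ := Matrix.of fun i j => B (x i) (x j) with hG
  have h1 : G⁻¹ * G = 1 := Matrix.nonsing_inv_mul _ (isUnit_iff_ne_zero.2 h0)
  have h2 : (G⁻¹ * G).mulVec c i = c i := by rw [h1, Matrix.one_mulVec]
  rw [← Matrix.mulVec_mulVec] at h2
  rw [← h2, map_sum]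
  simp only [Matrix.mulVec, dotProduct]
  refine Finset.sum_congr rfl fun j _ => ?_
  rw [map_smul, smul_eq_mul, hB, map_sum]
  congr 1
  exact Finset.sum_congr rfl fun l _ => by rw [map_smul, smul_eq_mul, mul_comm]; rfl

section Frames

variable {E : Type*} [NormedAddCommGroup E] [NormedSpace ℝ E]
  {H : Type*} [TopologicalSpace H] {I : ModelWithCorners ℝ E H}
  {M : Type*} [TopologicalSpace M] [ChartedSpace H M]

section Matrix

variable {ι : Type*} [Fintype ι] [DecidableEq ι]

lemma contMDiff_det {G : M → Matrix ι ι ℝ} (hG : ∀ i j, ContMDiff I 𝓘(ℝ, ℝ) ∞ (fun p => G p i j)) :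
    ContMDiff I 𝓘(ℝ, ℝ) ∞ (fun p => (G p).det) := by
  simp only [Matrix.det_apply']
  refine contMDiff_finsetSum fun σ _ => ContMDiff.mul contMDiff_const ?_
  exact contMDiff_finsetProd fun i _ => hG _ _

/-- By Cramer's rule, the inverse of a smooth family of invertible matrices is smooth. -/
lemma contMDiff_inv_apply {G : M → Matrix ι ι ℝ}
    (hG : ∀ i j, ContMDiff I 𝓘(ℝ, ℝ) ∞ (fun p => G p i j)) (h0 : ∀ p, (G p).det ≠ 0) (i j : ι) :
    ContMDiff I 𝓘(ℝ, ℝ) ∞ (fun p => (G p)⁻¹ i j) := by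
  have e : (fun p => (G p)⁻¹ i j) = fun p => ((G p).det)⁻¹ * (G p).adjugate i j := by
    funext p
    simp [Matrix.inv_def]
  rw [e]
  refine ContMDiff.mul ((contMDiff_det hG).inv₀ h0) ?_
  simp only [Matrix.adjugate_apply]
  refine contMDiff_det fun k l => ?_
  by_cases hk : k = j
  · subst hk
    simp only [Matrix.updateRow_self]
    exact contMDiff_const
  · simp only [Matrix.updateRow_ne hk]
    exact hG k l

end Matrix

variable [IsManifold I ∞ M]

/-- Global sections `x i` generating the family `A`, with coefficient functionals given by the inner
products with the sections `y i`. -/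
structure IsFrame (A : Fib I M) {n : ℕ} (x y : Fin n → GSec I M) : Prop where
  smooth : ∀ i, SmoothOn univ (x i)
  mem : ∀ i p, x i p ∈ A p
  smooth' : ∀ i, SmoothOn univ (y i)
  eq_sum : ∀ p, ∀ e ∈ A p, e = ∑ i, inn I p e (y i p) • x i p

variable [FiniteDimensional ℝ E] [T2Space M]

/-- Elements of the fibres of a split structure extend to global sections. -/
lemma IsSplit.exists_section {F : Fib I M} (h : IsSplit I F) {p : M} {f : GT I p} (hf : f ∈ F p) :
    ∃ y, y ∈ secs I univ F ∧ y p = f := by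
  obtain ⟨k, hk⟩ := h
  obtain ⟨U, hU, hp, e, hes, he⟩ := hk.frame p
  rw [← (he p hp).2] at hf
  obtain ⟨c, rfl⟩ := (Submodule.mem_span_range_iff_exists_fun ℝ).1 hf
  have hs : SmoothOn U (∑ i, c i • e i) := SmoothOn.sum _ fun i => (hes i).const_smul (c i)
  obtain ⟨χ, hχ, hχs, hsupp, h1⟩ := hs.exists_global hU hp
  refine ⟨_, mem_secs_univ.2 ⟨hχs, fun q => ?_⟩, ?_⟩
  · by_cases hq : q ∈ U
    · refine (F q).smul_mem _ ?_
      rw [Finset.sum_apply, ← (he q hq).2]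
      exact Submodule.sum_mem _ fun i _ => Submodule.smul_mem _ _ (Submodule.subset_span ⟨i, rfl⟩)
    · have : χ q = 0 := image_eq_zero_of_notMem_tsupport fun h => hq (hsupp h)
      change χ q • _ ∈ F q
      rw [this, zero_smul]
      exact (F q).zero_mem
  · change χ p • (∑ i, c i • e i) p = _
    rw [h1.self_of_nhds, one_smul, Finset.sum_apply]
    rfl

/-- A framing of a split structure is a frame; the coefficient functionals come from the inverse of
the Gram matrix. -/
theorem IsFraming.exists_isFrame {F : Fib I M} {V : Submodule ℝ (GSec I M)}
    (h : IsFraming I univ F V) (hF : IsSplit I F) :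
    ∃ (n : ℕ) (x y : Fin n → GSec I M), IsFrame F x y ∧ ∀ i, x i ∈ V := by
  have := h.finite
  obtain ⟨k, hk⟩ := hF.isSplitSub
  obtain ⟨x, hxV, hVx⟩ := exists_fin_spanning V
  have hx : ∀ i, SmoothOn univ (x i) ∧ ∀ p, x i p ∈ F p := fun i =>
    mem_secs_univ.1 (h.le _ (hxV i))
  -- the values at `p` of a basis of `V` span the fibre, because `V` generates the global sections
  have hspan : ∀ p, ∀ f ∈ F p, ∃ c : Fin (Module.finrank ℝ V) → ℝ, f = ∑ i, c i • x i p := by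
    intro p f hf
    obtain ⟨y, hy, rfl⟩ := hF.exists_section hf
    rw [← h.span] at hy
    clear hf
    induction hy using Submodule.span_induction with
    | mem y hy =>
      obtain ⟨c, rfl⟩ := hVx y hy
      exact ⟨c, by simp [Finset.sum_apply]⟩
    | zero => exact ⟨0, by simp⟩
    | add y z _ _ hy hz =>
      obtain ⟨c, hc⟩ := hy
      obtain ⟨d, hd⟩ := hz
      refine ⟨c + d, ?_⟩
      rw [Pi.add_apply, hc, hd, ← Finset.sum_add_distrib]
      exact Finset.sum_congr rfl fun i _ => (add_smul _ _ _).symm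
    | smul f y _ hy =>
      obtain ⟨c, hc⟩ := hy
      refine ⟨f.1 p • c, ?_⟩
      change f.1 p • y p = _
      rw [hc, Finset.smul_sum]
      exact Finset.sum_congr rfl fun i _ => smul_smul _ _ _
  let G : M → Matrix (Fin (Module.finrank ℝ V)) (Fin (Module.finrank ℝ V)) ℝ :=
    fun p => Matrix.of fun i j => inn I p (x i p) (x j p)
  have hG : ∀ p, (G p).det ≠ 0 := fun p =>
    (hk p).det_gram_ne_zero (h.rank p (mem_univ p)) (fun i => (hx i).2 p) (hspan p)
  refine ⟨_, x, fun i => ∑ j, (fun p => (G p)⁻¹ i j) • x j, ⟨fun i => (hx i).1, fun i => (hx i).2,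
    fun i => SmoothOn.sum _ fun j => SmoothOn.smul ?_ (hx j).1, fun p e he => ?_⟩, hxV⟩
  · exact (contMDiff_inv_apply (fun i j => (hx i).1.contMDiff_inn (hx j).1) hG i j).contMDiffOn
  · obtain ⟨c, rfl⟩ := hspan p e he
    refine Finset.sum_congr rfl fun i _ => ?_
    congr 1
    rw [Finset.sum_apply]
    exact (sum_gram_inv (inn_comm p) (hG p) c i).symm

end Frames

/-! ### Admissible triples -/

section ComplexFrames

variable {E : Type*} [NormedAddCommGroup E] [NormedSpace ℝ E]
  {H : Type*} [TopologicalSpace H] {I : ModelWithCorners ℝ E H}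
  {M : Type*} [TopologicalSpace M] [ChartedSpace H M]

variable [IsManifold I ∞ M] {A : Fib I M} {n : ℕ} {x y : Fin n → GSec I M}

lemma mem_csecs_fibC {s : CSec I M} : s ∈ csecs I univ (fibC I A) ↔
    SmoothOn univ (toPair s).1 ∧ SmoothOn univ (toPair s).2 ∧
      ∀ p, (toPair s).1 p ∈ A p ∧ (toPair s).2 p ∈ A p := by
  rw [mem_csecs_univ]
  exact and_congr_right fun _ => and_congr_right fun _ => forall_congr' fun p => mem_fibC

lemma toC_mem_csecs_fibC {v : GSec I M} (hv : SmoothOn univ v) (hA : ∀ p, v p ∈ A p) :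
    toC I M v ∈ csecs I univ (fibC I A) := by
  rw [mem_csecs_fibC, toPair_toC]
  exact ⟨hv, SmoothOn.zero I univ, fun p => ⟨hA p, (A p).zero_mem⟩⟩

/-- The multiplication of sections by functions, stated separately to shorten the search for it. -/
instance csecsSMul (T : ∀ p : M, Submodule ℂ (CGT I p)) :
    SMul (smoothFun (M := M) I ℂ univ) (csecs I univ T) :=
  (Submodule.module (csecs I univ T)).toSMul

namespace IsFrame

/-- The coefficients of a complex section in a frame. -/
def coef (h : IsFrame A x y) (e : csecs I univ (fibC I A)) (i : Fin n) :
    smoothFun (M := M) I ℂ univ :=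
  ⟨fun p => ⟨inn I p ((toPair (e : CSec I M)).1 p) (y i p),
      inn I p ((toPair (e : CSec I M)).2 p) (y i p)⟩, by
    have h1 := ((mem_csecs_fibC.1 e.2).1.contMDiff_inn (h.smooth' i))
    have h2 := ((mem_csecs_fibC.1 e.2).2.1.contMDiff_inn (h.smooth' i))
    have e : (fun p => (⟨inn I p ((toPair (e : CSec I M)).1 p) (y i p),
      inn I p ((toPair (e : CSec I M)).2 p) (y i p)⟩ : ℂ)) = fun p =>
        Complex.equivRealProdCLM.symm (inn I p ((toPair (e : CSec I M)).1 p) (y i p),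
      inn I p ((toPair (e : CSec I M)).2 p) (y i p)) := by
      funext p; simp [Complex.ext_iff]
    change ContMDiffOn I 𝓘(ℝ, ℂ) ∞ _ univ
    rw [e]
    exact (Complex.equivRealProdCLM.symm.contDiff.contMDiff.comp
      (h1.prodMk_space h2)).contMDiffOn⟩

/-- The elements of a frame as complex sections. -/
def sec (h : IsFrame A x y) (i : Fin n) : csecs I univ (fibC I A) :=
  ⟨toC I M (x i), toC_mem_csecs_fibC (h.smooth i) (h.mem i)⟩

/-- The expansion of a complex section in a frame. -/
lemma sum_coef (h : IsFrame A x y) (e : csecs I univ (fibC I A)) :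
    e = ∑ i, h.coef e i • h.sec i := by
  refine Subtype.ext (funext fun p => ?_)
  have he := (mem_csecs_fibC.1 e.2).2.2 p
  have e1 : ((∑ i, h.coef e i • h.sec i : csecs I univ (fibC I A)) : CSec I M) p =
      ∑ i, (h.coef e i).1 p • toC I M (x i) p := by
    rw [AddSubmonoidClass.coe_finsetSum, Finset.sum_apply]
    rfl
  rw [e1]
  refine CGT.ext ?_ ?_
  · rw [map_sum]
    refine (h.eq_sum p _ he.1).trans (Finset.sum_congr rfl fun i _ => ?_)
    rw [rePart_smul]
    change _ = _ • (toPair (toC I M (x i))).1 p - _ • (toPair (toC I M (x i))).2 p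
    rw [toPair_toC]
    simp [coef]
  · rw [map_sum]
    refine (h.eq_sum p _ he.2).trans (Finset.sum_congr rfl fun i _ => ?_)
    rw [imPart_smul]
    change _ = _ • (toPair (toC I M (x i))).2 p + _ • (toPair (toC I M (x i))).1 p
    rw [toPair_toC]
    simp [coef]

/-- A module homomorphism is determined by its values on a frame. -/
lemma map_eq_sum (h : IsFrame A x y) {T : ∀ p : M, Submodule ℂ (CGT I p)}
    (φ : csecs I univ (fibC I A) →ₗ[smoothFun (M := M) I ℂ univ] csecs I univ T)
    (e : csecs I univ (fibC I A)) :
    (φ e : CSec I M) = ∑ i, (h.coef e i).1 • (φ (h.sec i) : CSec I M) := by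
  have h1 : φ e = ∑ i, h.coef e i • φ (h.sec i) := by
    conv_lhs => rw [h.sum_coef e]
    rw [map_sum]
    exact Finset.sum_congr rfl fun i _ => map_smul _ _ _
  rw [h1, AddSubmonoidClass.coe_finsetSum]
  rfl

/-- Module homomorphisms between spaces of sections are pointwise: if a section vanishes at `p`, so
do its coefficients in a frame, and hence its image. -/
lemma apply_eq_zero (h : IsFrame A x y) {T : ∀ p : M, Submodule ℂ (CGT I p)}
    (φ : csecs I univ (fibC I A) →ₗ[smoothFun (M := M) I ℂ univ] csecs I univ T)
    {e : csecs I univ (fibC I A)} {p : M} (he : (e : CSec I M) p = 0) :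
    (φ e : CSec I M) p = 0 := by
  rw [h.map_eq_sum, Finset.sum_apply]
  refine Finset.sum_eq_zero fun i _ => ?_
  have h3 : (h.coef e i).1 p = 0 := by
    change (⟨inn I p (rePart I p ((e : CSec I M) p)) (y i p),
      inn I p (imPart I p ((e : CSec I M) p)) (y i p)⟩ : ℂ) = 0
    rw [he]
    simp [Complex.ext_iff]
  exact (congrArg (· • (φ (h.sec i) : CSec I M) p) h3).trans (zero_smul _ _)

end IsFrame

omit [IsManifold I ∞ M] in
/-- A real module of pairs which contains `s` and `√-1 s` contains the multiples of `s` by complex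
functions. -/
lemma toPair_smul_mem {N : Submodule (smoothFun (M := M) I ℝ univ) (GSec I M × GSec I M)}
    (c : smoothFun (M := M) I ℂ univ) {s : CSec I M} (h1 : toPair s ∈ N)
    (h2 : (-(toPair s).2, (toPair s).1) ∈ N) : toPair (c.1 • s) ∈ N := by
  let a : smoothFun (M := M) I ℝ univ :=
    ⟨fun p => (c.1 p).re, Complex.reCLM.contMDiff.comp_contMDiffOn c.2⟩
  let b : smoothFun (M := M) I ℝ univ :=
    ⟨fun p => (c.1 p).im, Complex.imCLM.contMDiff.comp_contMDiffOn c.2⟩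
  have h := N.add_mem (N.smul_mem a h1) (N.smul_mem b h2)
  refine (congrArg (· ∈ N) (Prod.ext (funext fun p => ?_) (funext fun p => ?_))).mpr h
  · refine (rePart_smul I p (c.1 p) (s p)).trans ?_
    change _ = (c.1 p).re • rePart I p (s p) + (c.1 p).im • -imPart I p (s p)
    rw [smul_neg, sub_eq_add_neg]
  · exact imPart_smul I p (c.1 p) (s p)

omit [IsManifold I ∞ M] in
/-- The real and imaginary parts of the elements of `V ⊗ ℂ` are in `V`. -/
lemma mem_framC {V : Submodule ℝ (GSec I M)} {s : CSec I M} (hs : s ∈ framC I V) :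
    (toPair s).1 ∈ V ∧ (toPair s).2 ∈ V := by
  induction hs using Submodule.span_induction with
  | mem s hs =>
    obtain ⟨v, hv, rfl⟩ := hs
    rw [toPair_toC]
    exact ⟨hv, V.zero_mem⟩
  | zero =>
    have : toPair (0 : CSec I M) = 0 :=
      Prod.ext (funext fun _ => map_zero _) (funext fun _ => map_zero _)
    rw [this]
    exact ⟨V.zero_mem, V.zero_mem⟩
  | add s t _ _ hs ht => rw [toPair_add]; exact ⟨V.add_mem hs.1 ht.1, V.add_mem hs.2 ht.2⟩
  | smul c s _ hs =>
    have e1 : (toPair (c • s)).1 = c.re • (toPair s).1 - c.im • (toPair s).2 :=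
      funext fun p => rePart_smul I p c (s p)
    have e2 : (toPair (c • s)).2 = c.re • (toPair s).2 + c.im • (toPair s).1 :=
      funext fun p => imPart_smul I p c (s p)
    rw [e1, e2]
    exact ⟨V.sub_mem (V.smul_mem _ hs.1) (V.smul_mem _ hs.2),
      V.add_mem (V.smul_mem _ hs.2) (V.smul_mem _ hs.1)⟩

omit [IsManifold I ∞ M] in
lemma toC_mem_framC {V : Submodule ℝ (GSec I M)} {v : GSec I M} (hv : v ∈ V) :
    toC I M v ∈ framC I V := Submodule.subset_span ⟨v, hv, rfl⟩

end ComplexFrames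

section Admissible

variable {E' : Type*} [NormedAddCommGroup E'] [NormedSpace ℝ E']
  {H' : Type*} [TopologicalSpace H'] {I' : ModelWithCorners ℝ E' H'}
  {N : Type*} [TopologicalSpace N] [ChartedSpace H' N] [IsManifold I' ∞ N]
  {E : Type*} [NormedAddCommGroup E] [NormedSpace ℝ E]
  {H : Type*} [TopologicalSpace H] {I : ModelWithCorners ℝ E H}
  {M : Type*} [TopologicalSpace M] [ChartedSpace H M] [IsManifold I ∞ M]
  {E₂ : Type*} [NormedAddCommGroup E₂] [NormedSpace ℝ E₂]
  {H₂ : Type*} [TopologicalSpace H₂] {I₂ : ModelWithCorners ℝ E₂ H₂}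
  {M₂ : Type*} [TopologicalSpace M₂] [ChartedSpace H₂ M₂] [IsManifold I₂ ∞ M₂]

/-- The pull-back of a frame is a frame. -/
lemma IsFrame.pull [FiniteDimensional ℝ E] [T2Space M] (P : Factor I' N I M) {A : Fib I M} {n : ℕ}
    {x y : Fin n → GSec I M} (h : IsFrame A x y) :
    IsFrame (P.pullFib A) (fun i => P.pullSec (x i)) (fun i => P.pullSec (y i)) where
  smooth i := P.smoothOn_pullSec (h.smooth i)
  mem i q := Submodule.mem_map_of_mem (h.mem i _)
  smooth' i := P.smoothOn_pullSec (h.smooth' i)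
  eq_sum := by
    rintro q _ ⟨f, hf, rfl⟩
    have e := congrArg (P.pull q) (h.eq_sum _ f hf)
    refine e.trans ?_
    rw [map_sum]
    refine Finset.sum_congr rfl fun i _ => ?_
    rw [map_smul, P.pullSec_apply, P.pullSec_apply, P.inn_pull]

variable (P : Factor I' N I M) (Q : Factor I' N I₂ M₂)
  (V₁ : Submodule ℝ (GSec I M)) (V₂ : Submodule ℝ (GSec I₂ M₂)) (Ψ : EndFib I' N)

/-- The sections of `L_Ψ` with real and imaginary parts in `π₁^* V₁ ⊕ π₂^* V₂`. -/
def genSet : Set (GSec I' N × GSec I' N) :=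
  {s | s ∈ eigSecs Ψ ∧ ∃ v ∈ V₁, ∃ v' ∈ V₁, ∃ a ∈ V₂, ∃ a' ∈ V₂,
    s = (P.pullSec v + Q.pullSec a, P.pullSec v' + Q.pullSec a')}

/-- What is used of the admissibility of `(π₁^* V₁, π₂^* V₂, Ψ)`. Every element of `V₁`, as a real
section on the first factor, is the first component of a section of `L_Ψ` whose second component is
in `V₂ ⊗ ℂ`, and conversely; such sections generate `L_Ψ`; and `L_Ψ` meets the pull-backs from
either factor trivially. The two factors play symmetric roles. -/
structure IsTransversal : Prop where
  exists_right : ∀ v ∈ V₁, ∃ a ∈ V₂, ∃ b ∈ V₂, (P.pullSec v + Q.pullSec a, Q.pullSec b) ∈ eigSecs Ψ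
  exists_left : ∀ w ∈ V₂, ∃ a ∈ V₁, ∃ b ∈ V₁, (Q.pullSec w + P.pullSec a, P.pullSec b) ∈ eigSecs Ψ
  span : eigSecs Ψ ≤ Submodule.span _ (genSet P Q V₁ V₂ Ψ)
  eq_zero_left : ∀ q u w, (P.pull q u, P.pull q w) ∈ eigPair (Ψ q) → u = 0 ∧ w = 0
  eq_zero_right : ∀ q u w, (Q.pull q u, Q.pull q w) ∈ eigPair (Ψ q) → u = 0 ∧ w = 0

variable {P Q V₁ V₂ Ψ}

lemma genSet_symm : genSet P Q V₁ V₂ Ψ = genSet Q P V₂ V₁ Ψ := by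
  ext s
  refine and_congr_right fun _ => ⟨?_, ?_⟩
  · rintro ⟨v, hv, v', hv', a, ha, a', ha', rfl⟩
    exact ⟨a, ha, a', ha', v, hv, v', hv', by rw [add_comm, add_comm (P.pullSec v')]⟩
  · rintro ⟨v, hv, v', hv', a, ha, a', ha', rfl⟩
    exact ⟨a, ha, a', ha', v, hv, v', hv', by rw [add_comm, add_comm (Q.pullSec v')]⟩

lemma IsTransversal.symm (h : IsTransversal P Q V₁ V₂ Ψ) : IsTransversal Q P V₂ V₁ Ψ where
  exists_right := h.exists_left
  exists_left := h.exists_right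
  span := by rw [← genSet_symm]; exact h.span
  eq_zero_left := h.eq_zero_right
  eq_zero_right := h.eq_zero_left

lemma Factor.IsCompl.eq_zero_of_add (h : P.IsCompl Q) {q : N} {x u : GT I (P.base q)}
    {y : GT I₂ (Q.base q)} (e : P.pull q x + Q.pull q y = P.pull q u) : x = u ∧ y = 0 := by
  have e1 := congrArg (P.push q) e
  have e2 := congrArg (Q.push q) e
  rw [map_add, P.push_pull, h.symm.push_pull, P.push_pull, add_zero] at e1
  rw [map_add, Q.push_pull, h.push_pull, h.push_pull, zero_add] at e2
  exact ⟨e1, e2⟩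

/-- Admissibility exhibits `L_Ψ` as the graph of an isomorphism `φ` with `φ(V₁ ⊗ ℂ) = V₂ ⊗ ℂ`. By
linearity over functions it is generated by the `v + φ(v)` with `v ∈ V₁`, and as `φ` and its inverse
are pointwise, an element of `L_Ψ` one of whose components vanishes is zero. -/
theorem IsAdmissible.isTransversal [FiniteDimensional ℝ E'] [T2Space N] [FiniteDimensional ℝ E]
    [T2Space M] [FiniteDimensional ℝ E₂] [T2Space M₂] (hPQ : P.IsCompl Q)
    {F₁ : Fib I M} {F₂ : Fib I₂ M₂}
    (hF₁ : IsSplit I F₁) (hF₂ : IsSplit I₂ F₂)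
    (hV₁ : IsFraming I univ F₁ V₁) (hV₂ : IsFraming I₂ univ F₂ V₂) {F : Fib I' N}
    (hΨ : IsSGF I' F Ψ)
    (h : IsAdmissible I' (P.pullFib F₁) (Q.pullFib F₂) (V₁.map P.pullSec) (V₂.map Q.pullSec) Ψ) :
    IsTransversal P Q V₁ V₂ Ψ := by
  obtain ⟨φ, hφ, hL⟩ := h
  obtain ⟨n, x, y, hxy, hx⟩ := hV₁.exists_isFrame hF₁
  obtain ⟨n₂, x₂, y₂, hxy₂, hx₂⟩ := hV₂.exists_isFrame hF₂
  have hf₁ := hxy.pull P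
  have hf₂ := hxy₂.pull Q
  -- the sections of `L_Ψ` are the `e + φ(e)`
  have hmem : ∀ e : csecs I' univ (fibC I' (P.pullFib F₁)),
      toPair ((e : CSec I' N) + (φ e : CSec I' N)) ∈ eigSecs Ψ := fun e => by
    rw [← mem_csecs_eigL]
    exact hL.symm.le ⟨e, rfl⟩
  have hex : ∀ s ∈ eigSecs Ψ, ∃ e : csecs I' univ (fibC I' (P.pullFib F₁)),
      s = toPair ((e : CSec I' N) + (φ e : CSec I' N)) := fun s hs => by
    rw [← toPair_ofPair s, ← mem_csecs_eigL] at hs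
    obtain ⟨e, he⟩ := hL.le hs
    exact ⟨e, by rw [← he, toPair_ofPair]⟩
  -- `φ` takes `v ∈ V₁` to an element of `V₂ ⊗ ℂ`
  have hv : ∀ v ∈ V₁, ∃ e : csecs I' univ (fibC I' (P.pullFib F₁)),
      (e : CSec I' N) = toC I' N (P.pullSec v) ∧ ∃ a ∈ V₂, ∃ b ∈ V₂,
      toPair (φ e : CSec I' N) = (Q.pullSec a, Q.pullSec b) := by
    intro v hv
    have hv' := mem_secs_univ.1 (hV₁.le v hv)
    have hm : toC I' N (P.pullSec v) ∈ csecs I' univ (fibC I' (P.pullFib F₁)) :=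
      toC_mem_csecs_fibC (P.smoothOn_pullSec hv'.1) fun q => Submodule.mem_map_of_mem (hv'.2 _)
    refine ⟨⟨_, hm⟩, rfl, ?_⟩
    have h1 : (φ ⟨_, hm⟩ : CSec I' N) ∈ framC I' (V₂.map Q.pullSec) :=
      hφ.le ⟨_, toC_mem_framC (Submodule.mem_map_of_mem hv), rfl⟩
    obtain ⟨⟨a, ha, ea⟩, b, hb, eb⟩ := mem_framC h1
    exact ⟨a, ha, b, hb, Prod.ext ea.symm eb.symm⟩
  refine ⟨?_, ?_, ?_, ?_, ?_⟩
  · intro v hv'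
    obtain ⟨e, he, a, ha, b, hb, hab⟩ := hv v hv'
    refine ⟨a, ha, b, hb, ?_⟩
    have := hmem e
    rw [toPair_add, hab, he, toPair_toC, Prod.mk_add_mk, zero_add] at this
    exact this
  · intro w hw
    obtain ⟨e, he, hew⟩ := hφ.symm.le (toC_mem_framC (Submodule.mem_map_of_mem hw))
    obtain ⟨⟨a, ha, ea⟩, b, hb, eb⟩ := mem_framC he
    refine ⟨a, ha, b, hb, ?_⟩
    have := hmem e
    rw [hew, toPair_add, toPair_toC, ← Prod.mk.eta (p := toPair (e : CSec I' N)), ← ea, ← eb,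
      Prod.mk_add_mk, add_zero, add_comm] at this
    exact this
  · intro s hs
    obtain ⟨e, rfl⟩ := hex s hs
    -- `e + φ(e)` is a combination of the `x i + φ(x i)`, where `x` is a basis of `V₁`
    have h1 : (e : CSec I' N) + (φ e : CSec I' N) =
        ∑ i, (hf₁.coef e i).1 • ((hf₁.sec i : CSec I' N) + (φ (hf₁.sec i) : CSec I' N)) := by
      refine (congrArg₂ (· + ·) (hf₁.map_eq_sum LinearMap.id e)
        (hf₁.map_eq_sum φ.toLinearMap e)).trans ?_
      beta_reduce
      rw [← Finset.sum_add_distrib]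
      exact Finset.sum_congr rfl fun i _ => (smul_add _ _ _).symm
    rw [h1]
    have h0 : ∀ g : Fin n → CSec I' N, toPair (∑ i, g i) = ∑ i, toPair (g i) := fun g =>
      map_sum (⟨⟨toPair, Prod.ext (funext fun _ => map_zero _) (funext fun _ => map_zero _)⟩,
        toPair_add⟩ : CSec I' N →+ GSec I' N × GSec I' N) g Finset.univ
    rw [h0]
    refine Submodule.sum_mem _ fun i _ => ?_
    obtain ⟨e, he, a, ha, b, hb, hab⟩ := hv (x i) (hx i)
    obtain rfl : e = hf₁.sec i := Subtype.ext he
    have h3 := hmem (hf₁.sec i)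
    have h4 : toPair ((hf₁.sec i : CSec I' N) + (φ (hf₁.sec i) : CSec I' N)) =
        (P.pullSec (x i) + Q.pullSec a, Q.pullSec b) := by
      rw [toPair_add, hab, he, toPair_toC, Prod.mk_add_mk, zero_add]
    -- coefficients are complex, so `√-1 (x i + φ(x i))` has to be a generator as well
    refine toPair_smul_mem _ (Submodule.subset_span ?_) (Submodule.subset_span ?_)
    · refine ⟨h3, x i, hx i, 0, V₁.zero_mem, a, ha, b, hb, ?_⟩
      rw [h4, map_zero, zero_add]
    · rw [h4] at h3 ⊢
      refine ⟨⟨h3.2.1.neg, h3.1, fun q => eigPair_I_smul (h3.2.2 q)⟩, 0, V₁.zero_mem, x i, hx i,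
        -b, V₂.neg_mem hb, a, ha, ?_⟩
      rw [map_zero, zero_add, map_neg]
  · intro q u w huw
    obtain ⟨s, hs, es⟩ := hΨ.exists_eigSec huw
    obtain ⟨e, rfl⟩ := hex s hs
    obtain ⟨⟨f, -, hf⟩, g, -, hg⟩ := (mem_csecs_fibC.1 e.2).2.2 q
    obtain ⟨⟨f', -, hf'⟩, g', -, hg'⟩ := (mem_csecs_fibC.1 (φ e).2).2.2 q
    rw [toPair_add] at es
    have e1 : P.pull q f + Q.pull q f' = P.pull q u := by
      rw [hf, hf']; exact congrArg Prod.fst es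
    have e2 : P.pull q g + Q.pull q g' = P.pull q w := by
      rw [hg, hg']; exact congrArg Prod.snd es
    have e0 : (φ e : CSec I' N) q = 0 := by
      refine CGT.ext ?_ ?_
      · rw [map_zero]
        exact hf'.symm.trans (by rw [(hPQ.eq_zero_of_add e1).2, map_zero])
      · rw [map_zero]
        exact hg'.symm.trans (by rw [(hPQ.eq_zero_of_add e2).2, map_zero])
    have e0' : (e : CSec I' N) q = 0 := by
      have := hf₂.apply_eq_zero φ.symm.toLinearMap e0
      rwa [LinearEquiv.coe_coe, LinearEquiv.symm_apply_apply] at this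
    have z1 : P.pull q f = 0 := hf.trans ((congrArg (rePart I' q) e0').trans (map_zero _))
    have z2 : P.pull q g = 0 := hg.trans ((congrArg (imPart I' q) e0').trans (map_zero _))
    rw [(hPQ.eq_zero_of_add e1).1] at z1
    rw [(hPQ.eq_zero_of_add e2).1] at z2
    exact ⟨P.pull_injective q (z1.trans (map_zero _).symm),
      P.pull_injective q (z2.trans (map_zero _).symm)⟩
  · intro q u w huw
    obtain ⟨s, hs, es⟩ := hΨ.exists_eigSec huw
    obtain ⟨e, rfl⟩ := hex s hs
    obtain ⟨⟨f, -, hf⟩, g, -, hg⟩ := (mem_csecs_fibC.1 e.2).2.2 q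
    obtain ⟨⟨f', -, hf'⟩, g', -, hg'⟩ := (mem_csecs_fibC.1 (φ e).2).2.2 q
    rw [toPair_add] at es
    have e1 : Q.pull q f' + P.pull q f = Q.pull q u := by
      rw [add_comm, hf, hf']; exact congrArg Prod.fst es
    have e2 : Q.pull q g' + P.pull q g = Q.pull q w := by
      rw [add_comm, hg, hg']; exact congrArg Prod.snd es
    have e0 : (e : CSec I' N) q = 0 := by
      refine CGT.ext ?_ ?_
      · rw [map_zero]
        exact hf.symm.trans (by rw [(hPQ.symm.eq_zero_of_add e1).2, map_zero])
      · rw [map_zero]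
        exact hg.symm.trans (by rw [(hPQ.symm.eq_zero_of_add e2).2, map_zero])
    have e0' : (φ e : CSec I' N) q = 0 := hf₁.apply_eq_zero φ.toLinearMap e0
    have z1 : Q.pull q f' = 0 := hf'.trans ((congrArg (rePart I' q) e0').trans (map_zero _))
    have z2 : Q.pull q g' = 0 := hg'.trans ((congrArg (imPart I' q) e0').trans (map_zero _))
    rw [(hPQ.symm.eq_zero_of_add e1).1] at z1
    rw [(hPQ.symm.eq_zero_of_add e2).1] at z2
    exact ⟨Q.pull_injective q (z1.trans (map_zero _).symm),
      Q.pull_injective q (z2.trans (map_zero _).symm)⟩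

end Admissible

/-! ### Sums and pull-backs of split structures -/

section SplitConstructions

variable {E' : Type*} [NormedAddCommGroup E'] [NormedSpace ℝ E']
  {H' : Type*} [TopologicalSpace H'] {I' : ModelWithCorners ℝ E' H'}
  {N : Type*} [TopologicalSpace N] [ChartedSpace H' N] [IsManifold I' ∞ N]
  {E : Type*} [NormedAddCommGroup E] [NormedSpace ℝ E]
  {H : Type*} [TopologicalSpace H] {I : ModelWithCorners ℝ E H}
  {M : Type*} [TopologicalSpace M] [ChartedSpace H M] [IsManifold I ∞ M]

/-- The orthogonal sum of split structures is a split structure. -/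
lemma IsSplit.sup {F F' : Fib I M} (h : IsSplit I F) (h' : IsSplit I F') (ho : Orthogonal F F') :
    IsSplit I (fun p => F p ⊔ F' p) := by
  obtain ⟨k, hk⟩ := h.isSplitSub
  obtain ⟨l, hl⟩ := h'.isSplitSub
  obtain ⟨k', hk'⟩ := h
  obtain ⟨l', hl'⟩ := h'
  refine ⟨k' + l', fun p => ?_, fun p => ?_⟩
  · obtain ⟨U, hU, hp, e, hes, he⟩ := hk'.frame p
    obtain ⟨U', hU', hp', e', hes', he'⟩ := hl'.frame p
    -- a local frame of the sum is the concatenation of two local frames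
    let σ : Fin (2 * (k' + l')) ≃ Fin (2 * k') ⊕ Fin (2 * l') :=
      (finCongr (mul_add 2 k' l')).trans finSumFinEquiv.symm
    refine ⟨U ∩ U', hU.inter hU', ⟨hp, hp'⟩, fun i => Sum.elim e e' (σ i), fun i => ?_, ?_⟩
    · change SmoothOn _ (Sum.elim e e' (σ i))
      rcases σ i with j | j
      · exact (hes j).mono inter_subset_left
      · exact (hes' j).mono inter_subset_right
    · rintro q ⟨hq, hq'⟩
      have e1 : (fun i => Sum.elim e e' (σ i) q) =
          Sum.elim (fun i => e i q) (fun i => e' i q) ∘ σ := by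
        funext i
        rw [Function.comp_apply]
        rcases σ i with j | j <;> rfl
      rw [e1]
      constructor
      · refine LinearIndependent.comp ?_ σ σ.injective
        refine (he q hq).1.sum_type (he' q hq').1 ?_
        rw [(he q hq).2, (he' q hq').2]
        exact (hk q).disjoint (ho q)
      · rw [σ.surjective.range_comp, Sum.elim_range, Submodule.span_union, (he q hq).2,
          (he' q hq').2]
  · have h1 := (hk p).sup (hl p) (ho p)
    have e1 : k = k' := (hk p).signature.1.symm.trans (hk'.signature p).1
    have e2 : l = l' := (hl p).signature.1.symm.trans (hl'.signature p).1
    rw [← e1, ← e2]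
    exact h1.signature

variable [FiniteDimensional ℝ E] [T2Space M]

/-- The pull-back of a split structure is a split structure. -/
lemma IsSplit.pullFib (P : Factor I' N I M) {F : Fib I M} (h : IsSplit I F) :
    IsSplit I' (P.pullFib F) := by
  obtain ⟨k, hk⟩ := h.isSplitSub
  obtain ⟨k', hk'⟩ := h
  refine ⟨k', fun q => ?_, fun q => ?_⟩
  · obtain ⟨U, hU, hp, e, hes, he⟩ := hk'.frame (P.base q)
    -- cut off the frame, as pull-backs of globally smooth sections are known to be smooth
    obtain ⟨χ, hχ, h1, hs⟩ := exists_bump (I := I) (hU.mem_nhds hp)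
    obtain ⟨U', hU'1, hU', hp'⟩ := mem_nhds_iff.1 (Filter.inter_mem (hU.mem_nhds hp) h1)
    refine ⟨P.base ⁻¹' U', hU'.preimage P.contMDiff.continuous, hp',
      fun i => P.pullSec (χ • e i), fun i =>
        (P.smoothOn_pullSec ((hes i).cutoff hU hχ hs)).mono (subset_univ _), fun r hr => ?_⟩
    have hr' := hU'1 hr
    have e1 : (fun i => P.pullSec (χ • e i) r) = P.pull r ∘ fun i => e i (P.base r) := by
      funext i
      change P.pull r (χ (P.base r) • e i (P.base r)) = P.pull r (e i (P.base r))
      rw [show χ (P.base r) = 1 from hr'.2, one_smul]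
    rw [e1]
    constructor
    · exact (he _ hr'.1).1.map' _ (LinearMap.ker_eq_bot.2 (P.pull_injective r))
    · rw [range_comp, ← Submodule.map_span, (he _ hr'.1).2]
      rfl
  · have e1 : k = k' := (hk (P.base q)).signature.1.symm.trans (hk'.signature _).1
    rw [← e1]
    exact ((hk (P.base q)).map (inn_comm q) (P.pull q) (P.inn_pull q)
      (P.pull_injective q)).signature

/-- Near `q`, the pull-back of an endomorphism is expressed by pull-backs of sections. The sections
do not depend on the endomorphism. -/
lemma Factor.exists_pullEnd_eq (P : Factor I' N I M) (q : N) :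
    ∃ (ι : Type) (_ : Fintype ι) (g h : ι → GSec I M), (∀ k, SmoothOn univ (g k)) ∧
      (∀ k, SmoothOn univ (h k)) ∧ ∀ (J : EndFib I M), ∀ᶠ r in nhds q, ∀ x : GT I' r,
        P.pullEnd J r x =
          ∑ k, inn I' r x (P.pullSec (h k) r) • P.pull r (J (P.base r) (g k (P.base r))) := by
  obtain ⟨ι, hι, g, h, hg, hh, e⟩ := exists_frame (I := I) (P.base q)
  refine ⟨ι, hι, g, h, hg, hh, fun J => ?_⟩
  filter_upwards [P.contMDiff.continuous.continuousAt.tendsto.eventually e] with r hr x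
  rw [P.pullEnd_apply]
  conv_lhs => rw [hr (P.push r x), map_sum, map_sum]
  refine Finset.sum_congr rfl fun k _ => ?_
  rw [map_smul, map_smul, P.inn_push, P.pullSec_apply]

lemma Factor.smoothOn_pullEnd (P : Factor I' N I M) {J : EndFib I M}
    (hJ : ∀ x : GSec I M, SmoothOn univ x → SmoothOn univ (fun p => J p (x p) : GSec I M))
    {x : GSec I' N} (hx : SmoothOn univ x) :
    SmoothOn univ (fun q => P.pullEnd J q (x q) : GSec I' N) := by
  refine smoothOn_of_local fun q _ => ?_
  obtain ⟨ι, _, g, h, hg, hh, e⟩ := P.exists_pullEnd_eq q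
  refine ⟨∑ k, (fun r => inn I' r (x r) (P.pullSec (h k) r)) •
    P.pullSec (fun p => J p (g k p)), SmoothOn.sum _ fun k => SmoothOn.smul
      (hx.contMDiffOn_inn (P.smoothOn_pullSec (hh k))) (P.smoothOn_pullSec (hJ _ (hg k))), ?_⟩
  filter_upwards [e J] with r hr
  rw [hr, Finset.sum_apply]
  rfl

end SplitConstructions

/-! ### The Morimoto product, pointwise -/

section Morimoto

variable {E' : Type*} [NormedAddCommGroup E'] [NormedSpace ℝ E']
  {H' : Type*} [TopologicalSpace H'] {I' : ModelWithCorners ℝ E' H'}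
  {N : Type*} [TopologicalSpace N] [ChartedSpace H' N] [IsManifold I' ∞ N]
  {E : Type*} [NormedAddCommGroup E] [NormedSpace ℝ E]
  {H : Type*} [TopologicalSpace H] {I : ModelWithCorners ℝ E H}
  {M : Type*} [TopologicalSpace M] [ChartedSpace H M] [IsManifold I ∞ M]
  {E₂ : Type*} [NormedAddCommGroup E₂] [NormedSpace ℝ E₂]
  {H₂ : Type*} [TopologicalSpace H₂] {I₂ : ModelWithCorners ℝ E₂ H₂}
  {M₂ : Type*} [TopologicalSpace M₂] [ChartedSpace H₂ M₂] [IsManifold I₂ ∞ M₂]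

/-- Pull-back of complex sections, encoded as pairs. -/
def Factor.pullPair (P : Factor I' N I M) (s : GSec I M × GSec I M) : GSec I' N × GSec I' N :=
  (P.pullSec s.1, P.pullSec s.2)

/-- The sum of the pull-backs of two families of subspaces from the two factors. -/
def box (P : Factor I' N I M) (Q : Factor I' N I₂ M₂) (F₁ : Fib I M) (F₂ : Fib I₂ M₂) : Fib I' N :=
  fun q => P.pullFib F₁ q ⊔ Q.pullFib F₂ q

/-- The Morimoto product `π₁^* J₁ ⊕ π₂^* J₂ ⊕ Ψ`; each summand is extended by zero to the orthogonal
complement of the subbundle on which it lives. -/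
def morimoto (P : Factor I' N I M) (Q : Factor I' N I₂ M₂) (J₁ : EndFib I M) (J₂ : EndFib I₂ M₂)
    (Ψ : EndFib I' N) : EndFib I' N :=
  fun q => P.pullEnd J₁ q + Q.pullEnd J₂ q + Ψ q

/-- The part of an external Morimoto datum which is used below, for two complementary factors
of a manifold. -/
structure IsMorimoto (P : Factor I' N I M) (Q : Factor I' N I₂ M₂) (F₁ F₁' : Fib I M)
    (F₂ F₂' : Fib I₂ M₂) (J₁ : EndFib I M) (J₂ : EndFib I₂ M₂) (V₁ : Submodule ℝ (GSec I M))
    (V₂ : Submodule ℝ (GSec I₂ M₂)) (Ψ : EndFib I' N) : Prop where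
  compl : P.IsCompl Q
  split₁' : IsSplit I F₁'
  split₂' : IsSplit I₂ F₂'
  orthogonal₁ : Orthogonal F₁ F₁'
  orthogonal₂ : Orthogonal F₂ F₂'
  sgf₁ : IsSGF I F₁ J₁
  sgf₂ : IsSGF I₂ F₂ J₂
  framing₁ : IsFraming I univ F₁' V₁
  framing₂ : IsFraming I₂ univ F₂' V₂
  sgf : IsSGF I' (box P Q F₁' F₂') Ψ
  normalizes₁ : ∀ v ∈ V₁, ∀ y, SmoothOn univ y → (∀ p, y p ∈ F₁ p ⊔ F₁' p) →
    ∀ p, dorfman v y p ∈ F₁ p ⊔ F₁' p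
  normalizes₂ : ∀ v ∈ V₂, ∀ y, SmoothOn univ y → (∀ p, y p ∈ F₂ p ⊔ F₂' p) →
    ∀ p, dorfman v y p ∈ F₂ p ⊔ F₂' p
  transversal : IsTransversal P Q V₁ V₂ Ψ

lemma box_symm (P : Factor I' N I M) (Q : Factor I' N I₂ M₂) (F₁ : Fib I M) (F₂ : Fib I₂ M₂) :
    box P Q F₁ F₂ = box Q P F₂ F₁ := funext fun _ => sup_comm _ _

lemma morimoto_symm (P : Factor I' N I M) (Q : Factor I' N I₂ M₂) (J₁ : EndFib I M)
    (J₂ : EndFib I₂ M₂) (Ψ : EndFib I' N) : morimoto P Q J₁ J₂ Ψ = morimoto Q P J₂ J₁ Ψ :=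
  funext fun q => congrArg (· + Ψ q) (add_comm (P.pullEnd J₁ q) (Q.pullEnd J₂ q))

namespace IsMorimoto

variable {P : Factor I' N I M} {Q : Factor I' N I₂ M₂} {F₁ F₁' : Fib I M}
  {F₂ F₂' : Fib I₂ M₂} {J₁ : EndFib I M} {J₂ : EndFib I₂ M₂} {V₁ : Submodule ℝ (GSec I M)}
  {V₂ : Submodule ℝ (GSec I₂ M₂)} {Ψ : EndFib I' N}

lemma symm (h : IsMorimoto P Q F₁ F₁' F₂ F₂' J₁ J₂ V₁ V₂ Ψ) :
    IsMorimoto Q P F₂ F₂' F₁ F₁' J₂ J₁ V₂ V₁ Ψ where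
  compl := h.compl.symm
  split₁' := h.split₂'
  split₂' := h.split₁'
  orthogonal₁ := h.orthogonal₂
  orthogonal₂ := h.orthogonal₁
  sgf₁ := h.sgf₂
  sgf₂ := h.sgf₁
  framing₁ := h.framing₂
  framing₂ := h.framing₁
  sgf := by rw [box_symm]; exact h.sgf
  normalizes₁ := h.normalizes₂
  normalizes₂ := h.normalizes₁
  transversal := h.transversal.symm

section Pointwise

/-- `Ψ` vanishes on the pull-back of `F₁`, which is orthogonal to `F₁' ⊞ F₂'`. -/
lemma psi_pull (h : IsMorimoto P Q F₁ F₁' F₂ F₂' J₁ J₂ V₁ V₂ Ψ) {q : N} {f : GT I (P.base q)}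
    (hf : f ∈ F₁ (P.base q)) : Ψ q (P.pull q f) = 0 := by
  refine h.sgf.zero q _ fun y hy => ?_
  obtain ⟨_, ⟨a, ha, rfl⟩, _, ⟨b, hb, rfl⟩, rfl⟩ := Submodule.mem_sup.1 hy
  rw [map_add, P.inn_pull, h.compl.inn_pull, add_zero, h.orthogonal₁ _ f hf a ha]

lemma psi_pullEnd (h : IsMorimoto P Q F₁ F₁' F₂ F₂' J₁ J₂ V₁ V₂ Ψ) (q : N) (x : GT I' q) :
    Ψ q (P.pullEnd J₁ q x) = 0 := h.psi_pull (h.sgf₁.mem _ _)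

/-- `J₁` vanishes on the first components of elements of `F₁' ⊞ F₂'`. -/
lemma end_push (h : IsMorimoto P Q F₁ F₁' F₂ F₂' J₁ J₂ V₁ V₂ Ψ) {q : N} {y : GT I' q}
    (hy : y ∈ box P Q F₁' F₂' q) : J₁ (P.base q) (P.push q y) = 0 := by
  obtain ⟨_, ⟨a, ha, rfl⟩, _, ⟨b, hb, rfl⟩, rfl⟩ := Submodule.mem_sup.1 hy
  rw [map_add, P.push_pull, h.compl.symm.push_pull, add_zero]
  exact (h.sgf₁.isSGFAt _).zero_of_orthogonal (h.orthogonal₁ _) ha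

lemma pullEnd_box (h : IsMorimoto P Q F₁ F₁' F₂ F₂' J₁ J₂ V₁ V₂ Ψ) {q : N} {y : GT I' q}
    (hy : y ∈ box P Q F₁' F₂' q) : P.pullEnd J₁ q y = 0 := by
  rw [P.pullEnd_apply, h.end_push hy, map_zero]

lemma morimoto_apply (q : N) (x : GT I' q) : morimoto P Q J₁ J₂ Ψ q x =
    P.pullEnd J₁ q x + Q.pullEnd J₂ q x + Ψ q x := rfl

lemma psi_morimoto (h : IsMorimoto P Q F₁ F₁' F₂ F₂' J₁ J₂ V₁ V₂ Ψ) (q : N) (x : GT I' q) :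
    Ψ q (morimoto P Q J₁ J₂ Ψ q x) = Ψ q (Ψ q x) := by
  rw [morimoto_apply, map_add, map_add, h.psi_pullEnd, h.symm.psi_pullEnd, zero_add, zero_add]

/-- The Morimoto product is `Ψ` on `F₁' ⊞ F₂'`. -/
lemma morimoto_box (h : IsMorimoto P Q F₁ F₁' F₂ F₂' J₁ J₂ V₁ V₂ Ψ) {q : N} {y : GT I' q}
    (hy : y ∈ box P Q F₁' F₂' q) : morimoto P Q J₁ J₂ Ψ q y = Ψ q y := by
  rw [morimoto_apply, h.pullEnd_box hy, h.symm.pullEnd_box (by rwa [box_symm]), zero_add, zero_add]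

lemma morimoto_pull (h : IsMorimoto P Q F₁ F₁' F₂ F₂' J₁ J₂ V₁ V₂ Ψ) (q : N)
    (x : GT I (P.base q)) :
    morimoto P Q J₁ J₂ Ψ q (P.pull q x) = P.pull q (J₁ (P.base q) x) + Ψ q (P.pull q x) := by
  rw [morimoto_apply, P.pullEnd_apply, Q.pullEnd_apply, P.push_pull, h.compl.push_pull, map_zero,
    map_zero, add_zero]

/-- `L_Ψ` is contained in `L_J` for the Morimoto product `J`. -/
lemma eigPair_le (h : IsMorimoto P Q F₁ F₁' F₂ F₂' J₁ J₂ V₁ V₂ Ψ) {q : N} {u : GT I' q × GT I' q}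
    (hu : u ∈ eigPair (Ψ q)) : u ∈ eigPair (morimoto P Q J₁ J₂ Ψ q) := by
  obtain ⟨h1, h2⟩ := (h.sgf.isSGFAt q).mem_of_mem_eigPair hu
  exact ⟨by rw [h.morimoto_box h1, hu.1], by rw [h.morimoto_box h2, hu.2]⟩

/-- The part of `L_J` in `(F₁' ⊞ F₂') ⊗ ℂ` is `L_Ψ`. -/
lemma eigPair_of_box (h : IsMorimoto P Q F₁ F₁' F₂ F₂' J₁ J₂ V₁ V₂ Ψ) {q : N}
    {u : GT I' q × GT I' q} (hu : u ∈ eigPair (morimoto P Q J₁ J₂ Ψ q))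
    (h1 : u.1 ∈ box P Q F₁' F₂' q) (h2 : u.2 ∈ box P Q F₁' F₂' q) : u ∈ eigPair (Ψ q) :=
  ⟨by rw [← h.morimoto_box h1, hu.1], by rw [← h.morimoto_box h2, hu.2]⟩

/-- The pull-back of `L_{J₁}` is contained in `L_J`. -/
lemma eigPair_pull (h : IsMorimoto P Q F₁ F₁' F₂ F₂' J₁ J₂ V₁ V₂ Ψ) {q : N}
    {n m : GT I (P.base q)} (hu : (n, m) ∈ eigPair (J₁ (P.base q))) :
    (P.pull q n, P.pull q m) ∈ eigPair (morimoto P Q J₁ J₂ Ψ q) := by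
  obtain ⟨h1, h2⟩ := (h.sgf₁.isSGFAt _).mem_of_mem_eigPair hu
  constructor
  · rw [h.morimoto_pull, h.psi_pull h1, hu.1, map_neg, add_zero]
  · rw [h.morimoto_pull, h.psi_pull h2, hu.2, add_zero]

/-- As `L_Ψ` is a graph, the pull-backs from one factor in `L_J` come from `L_{J₁}`. -/
lemma eigPair_of_pull (h : IsMorimoto P Q F₁ F₁' F₂ F₂' J₁ J₂ V₁ V₂ Ψ) {q : N}
    {n m : GT I (P.base q)} (hu : (P.pull q n, P.pull q m) ∈ eigPair (morimoto P Q J₁ J₂ Ψ q)) :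
    (n, m) ∈ eigPair (J₁ (P.base q)) := by
  have e1 : P.pull q (-(m + J₁ (P.base q) n)) = Ψ q (P.pull q n) := by
    have := hu.1
    simp only [] at this
    rw [h.morimoto_pull] at this
    rw [map_neg, map_add, neg_add, ← this]
    abel
  have e2 : P.pull q (n - J₁ (P.base q) m) = Ψ q (P.pull q m) := by
    have := hu.2
    simp only [] at this
    rw [h.morimoto_pull] at this
    rw [map_sub]
    nth_rewrite 1 [← this]
    abel
  -- the defects of `J₁ n = -m` and `J₁ m = n` form an element of `L_Ψ`, pulled back from `M`
  have h0 : (P.pull q (-(m + J₁ (P.base q) n)), P.pull q (n - J₁ (P.base q) m)) ∈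
      eigPair (Ψ q) := by
    rw [e1, e2]
    constructor
    · simp only []
      rw [← h.psi_morimoto, hu.1, map_neg]
    · simp only []
      rw [← h.psi_morimoto, hu.2]
  obtain ⟨z1, z2⟩ := h.transversal.eq_zero_left q _ _ h0
  constructor
  · exact (neg_eq_of_add_eq_zero_right (neg_eq_zero.1 z1)).symm
  · exact (sub_eq_zero.1 z2).symm

lemma box_le (q : N) :
    box P Q F₁' F₂' q ≤ box P Q (fun p => F₁ p ⊔ F₁' p) (fun p => F₂ p ⊔ F₂' p) q :=
  sup_le_sup (Submodule.map_mono le_sup_right) (Submodule.map_mono le_sup_right)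

lemma pullEnd_skew (h : IsMorimoto P Q F₁ F₁' F₂ F₂' J₁ J₂ V₁ V₂ Ψ) (q : N) (x y : GT I' q) :
    inn I' q (P.pullEnd J₁ q x) y = - inn I' q x (P.pullEnd J₁ q y) := by
  rw [P.pullEnd_apply, P.pullEnd_apply, ← P.inn_push, inn_comm q (P.pull q _), ← P.inn_push,
    inn_comm _ (P.push q y), (h.sgf₁.isSGFAt _).skew]

lemma morimoto_skew (h : IsMorimoto P Q F₁ F₁' F₂ F₂' J₁ J₂ V₁ V₂ Ψ) (q : N) (x y : GT I' q) :
    inn I' q (morimoto P Q J₁ J₂ Ψ q x) y = - inn I' q x (morimoto P Q J₁ J₂ Ψ q y) := by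
  rw [morimoto_apply, morimoto_apply]
  simp only [map_add, LinearMap.add_apply]
  rw [h.pullEnd_skew, h.symm.pullEnd_skew, (h.sgf.isSGFAt q).skew]
  ring

lemma morimoto_sq_pull (h : IsMorimoto P Q F₁ F₁' F₂ F₂' J₁ J₂ V₁ V₂ Ψ) {q : N}
    {f : GT I (P.base q)} (hf : f ∈ F₁ (P.base q)) :
    morimoto P Q J₁ J₂ Ψ q (morimoto P Q J₁ J₂ Ψ q (P.pull q f)) = -P.pull q f := by
  rw [h.morimoto_pull, h.psi_pull hf, add_zero, h.morimoto_pull, h.psi_pull (h.sgf₁.mem _ _),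
    add_zero, (h.sgf₁.isSGFAt _).sq hf, map_neg]

lemma morimoto_sq_box (h : IsMorimoto P Q F₁ F₁' F₂ F₂' J₁ J₂ V₁ V₂ Ψ) {q : N} {y : GT I' q}
    (hy : y ∈ box P Q F₁' F₂' q) :
    morimoto P Q J₁ J₂ Ψ q (morimoto P Q J₁ J₂ Ψ q y) = -y := by
  rw [h.morimoto_box hy, h.morimoto_box (h.sgf.mem _ _), (h.sgf.isSGFAt _).sq hy]

lemma morimoto_sq (h : IsMorimoto P Q F₁ F₁' F₂ F₂' J₁ J₂ V₁ V₂ Ψ) {q : N} {y : GT I' q}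
    (hy : y ∈ box P Q (fun p => F₁ p ⊔ F₁' p) (fun p => F₂ p ⊔ F₂' p) q) :
    morimoto P Q J₁ J₂ Ψ q (morimoto P Q J₁ J₂ Ψ q y) = -y := by
  obtain ⟨_, ⟨a, ha, rfl⟩, _, ⟨b, hb, rfl⟩, rfl⟩ := Submodule.mem_sup.1 hy
  obtain ⟨a₁, ha₁, a₂, ha₂, rfl⟩ := Submodule.mem_sup.1 ha
  obtain ⟨b₁, hb₁, b₂, hb₂, rfl⟩ := Submodule.mem_sup.1 hb
  have e2 := h.symm.morimoto_sq_pull hb₁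
  rw [← morimoto_symm] at e2
  have e3 := h.morimoto_sq_box (Submodule.mem_sup_left (Submodule.mem_map_of_mem ha₂) :
    P.pull q a₂ ∈ box P Q F₁' F₂' q)
  have e4 := h.morimoto_sq_box (Submodule.mem_sup_right (Submodule.mem_map_of_mem hb₂) :
    Q.pull q b₂ ∈ box P Q F₁' F₂' q)
  simp only [map_add]
  rw [h.morimoto_sq_pull ha₁, e2, e3, e4]
  abel

end Pointwise

lemma smooth_left (h : IsMorimoto P Q F₁ F₁' F₂ F₂' J₁ J₂ V₁ V₂ Ψ) {v : GSec I M} (hv : v ∈ V₁) :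
    SmoothOn univ v := (h.framing₁.le v hv).1

lemma mem_left (h : IsMorimoto P Q F₁ F₁' F₂ F₂' J₁ J₂ V₁ V₂ Ψ) {v : GSec I M} (hv : v ∈ V₁)
    (p : M) : v p ∈ F₁' p := (mem_secs_univ.1 (h.framing₁.le v hv)).2 p

lemma eigSecs_le (h : IsMorimoto P Q F₁ F₁' F₂ F₂' J₁ J₂ V₁ V₂ Ψ) {s : GSec I' N × GSec I' N}
    (hs : s ∈ eigSecs Ψ) : s ∈ eigSecs (morimoto P Q J₁ J₂ Ψ) :=
  ⟨hs.1, hs.2.1, fun q => h.eigPair_le (hs.2.2 q)⟩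

variable [FiniteDimensional ℝ E] [T2Space M] in
lemma pullPair_mem (h : IsMorimoto P Q F₁ F₁' F₂ F₂' J₁ J₂ V₁ V₂ Ψ) {s : GSec I M × GSec I M}
    (hs : s ∈ eigSecs J₁) : P.pullPair s ∈ eigSecs (morimoto P Q J₁ J₂ Ψ) :=
  ⟨P.smoothOn_pullSec hs.1, P.smoothOn_pullSec hs.2.1, fun _ => h.eigPair_pull (hs.2.2 _)⟩

end IsMorimoto

end Morimoto

/-! ### Integrability of the Morimoto product: necessary conditions -/

section MorimotoClosed

variable {E' : Type*} [NormedAddCommGroup E'] [NormedSpace ℝ E'] [FiniteDimensional ℝ E']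
  {H' : Type*} [TopologicalSpace H'] {I' : ModelWithCorners ℝ E' H'} [I'.Boundaryless]
  {N : Type*} [TopologicalSpace N] [ChartedSpace H' N] [IsManifold I' ∞ N] [T2Space N]
  {E : Type*} [NormedAddCommGroup E] [NormedSpace ℝ E] [FiniteDimensional ℝ E]
  {H : Type*} [TopologicalSpace H] {I : ModelWithCorners ℝ E H} [I.Boundaryless]
  {M : Type*} [TopologicalSpace M] [ChartedSpace H M] [IsManifold I ∞ M] [T2Space M]
  {E₂ : Type*} [NormedAddCommGroup E₂] [NormedSpace ℝ E₂] [FiniteDimensional ℝ E₂]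
  {H₂ : Type*} [TopologicalSpace H₂] {I₂ : ModelWithCorners ℝ E₂ H₂} [I₂.Boundaryless]
  {M₂ : Type*} [TopologicalSpace M₂] [ChartedSpace H₂ M₂] [IsManifold I₂ ∞ M₂] [T2Space M₂]

namespace Factor

variable {P : Factor I' N I M} {Q : Factor I' N I₂ M₂}

omit [I₂.Boundaryless] in
lemma IsCompl.br_pullPair (h : P.IsCompl Q) {s t : GSec I M × GSec I M}
    (hs : SmoothOn univ s.1) (hs' : SmoothOn univ s.2) (ht : SmoothOn univ t.1)
    (ht' : SmoothOn univ t.2) (q : N) : ev (br (P.pullPair s) (P.pullPair t)) q =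
      (P.pull q (ev (br s t) (P.base q)).1, P.pull q (ev (br s t) (P.base q)).2) := by
  refine Prod.ext ?_ ?_
  · change dorfman (P.pullSec s.1) (P.pullSec t.1) q - dorfman (P.pullSec s.2) (P.pullSec t.2) q =
      P.pull q (dorfman s.1 t.1 (P.base q) - dorfman s.2 t.2 (P.base q))
    rw [h.dorfman_pullSec hs ht, h.dorfman_pullSec hs' ht', map_sub]
  · change dorfman (P.pullSec s.1) (P.pullSec t.2) q + dorfman (P.pullSec s.2) (P.pullSec t.1) q =
      P.pull q (dorfman s.1 t.2 (P.base q) + dorfman s.2 t.1 (P.base q))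
    rw [h.dorfman_pullSec hs ht', h.dorfman_pullSec hs' ht, map_add]

lemma IsCompl.br_pullPair_pullPair (h : P.IsCompl Q) {s : GSec I M × GSec I M}
    {t : GSec I₂ M₂ × GSec I₂ M₂}
    (hs : SmoothOn univ s.1) (hs' : SmoothOn univ s.2) (ht : SmoothOn univ t.1)
    (ht' : SmoothOn univ t.2) (q : N) : ev (br (P.pullPair s) (Q.pullPair t)) q = 0 := by
  refine Prod.ext ?_ ?_
  · change dorfman (P.pullSec s.1) (Q.pullSec t.1) q - dorfman (P.pullSec s.2) (Q.pullSec t.2) q = 0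
    rw [h.dorfman_pullSec_pullSec hs ht, h.dorfman_pullSec_pullSec hs' ht', sub_zero]
  · change dorfman (P.pullSec s.1) (Q.pullSec t.2) q + dorfman (P.pullSec s.2) (Q.pullSec t.1) q = 0
    rw [h.dorfman_pullSec_pullSec hs ht', h.dorfman_pullSec_pullSec hs' ht, add_zero]

/-- As mixed brackets vanish, only the first component of a section acts on pull-backs from the
first factor. -/
lemma IsCompl.dorfman_add_pullSec (h : P.IsCompl Q) {v c : GSec I M} {a : GSec I₂ M₂}
    (hv : SmoothOn univ v) (ha : SmoothOn univ a) (hc : SmoothOn univ c) (q : N) :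
    dorfman (P.pullSec v + Q.pullSec a) (P.pullSec c) q = P.pull q (dorfman v c (P.base q)) := by
  rw [dorfman_add_left (P.smoothOn_pullSec hv) (Q.smoothOn_pullSec ha) (P.smoothOn_pullSec hc),
    h.dorfman_pullSec hv hc, h.symm.dorfman_pullSec_pullSec ha hc, add_zero]

lemma IsCompl.br_add_pullPair (h : P.IsCompl Q) {v v' : GSec I M} {a a' : GSec I₂ M₂}
    {s : GSec I M × GSec I M} (hv : SmoothOn univ v) (hv' : SmoothOn univ v')
    (ha : SmoothOn univ a) (ha' : SmoothOn univ a') (hs : SmoothOn univ s.1)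
    (hs' : SmoothOn univ s.2) (q : N) :
    ev (br (P.pullSec v + Q.pullSec a, P.pullSec v' + Q.pullSec a') (P.pullPair s)) q =
      (P.pull q (dorfman v s.1 (P.base q) - dorfman v' s.2 (P.base q)),
        P.pull q (dorfman v s.2 (P.base q) + dorfman v' s.1 (P.base q))) := by
  refine Prod.ext ?_ ?_
  · change dorfman (P.pullSec v + Q.pullSec a) (P.pullSec s.1) q -
      dorfman (P.pullSec v' + Q.pullSec a') (P.pullSec s.2) q = _
    rw [h.dorfman_add_pullSec hv ha hs, h.dorfman_add_pullSec hv' ha' hs', ← map_sub]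
  · change dorfman (P.pullSec v + Q.pullSec a) (P.pullSec s.2) q +
      dorfman (P.pullSec v' + Q.pullSec a') (P.pullSec s.1) q = _
    rw [h.dorfman_add_pullSec hv ha hs', h.dorfman_add_pullSec hv' ha' hs, ← map_add]

lemma IsCompl.dorfman_add_add (h : P.IsCompl Q) {v c : GSec I M} {a b : GSec I₂ M₂}
    (hv : SmoothOn univ v) (ha : SmoothOn univ a) (hc : SmoothOn univ c) (hb : SmoothOn univ b)
    (q : N) :
    dorfman (P.pullSec v + Q.pullSec a) (P.pullSec c + Q.pullSec b) q =
      P.pull q (dorfman v c (P.base q)) + Q.pull q (dorfman a b (Q.base q)) := by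
  have e := h.symm.dorfman_add_pullSec ha hv hb q
  rw [add_comm] at e
  rw [dorfman_add_right ((P.smoothOn_pullSec hv).add (Q.smoothOn_pullSec ha))
    (P.smoothOn_pullSec hc) (Q.smoothOn_pullSec hb), h.dorfman_add_pullSec hv ha hc, e]

end Factor

namespace IsMorimoto

variable {P : Factor I' N I M} {Q : Factor I' N I₂ M₂} {F₁ F₁' : Fib I M}
  {F₂ F₂' : Fib I₂ M₂} {J₁ : EndFib I M} {J₂ : EndFib I₂ M₂} {V₁ : Submodule ℝ (GSec I M)}
  {V₂ : Submodule ℝ (GSec I₂ M₂)} {Ψ : EndFib I' N}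

section Necessity

variable (h : IsMorimoto P Q F₁ F₁' F₂ F₂' J₁ J₂ V₁ V₂ Ψ)
  (hJ : ∀ s ∈ eigSecs (morimoto P Q J₁ J₂ Ψ), ∀ t ∈ eigSecs (morimoto P Q J₁ J₂ Ψ), ∀ q,
    ev (br s t) q ∈ eigPair (morimoto P Q J₁ J₂ Ψ q))
include h hJ

omit [I₂.Boundaryless] in
/-- `L_{J₁}` is closed: brackets of its pull-backs are pull-backs which lie in `L_J`. -/
lemma closed_left : ∀ s ∈ eigSecs J₁, ∀ t ∈ eigSecs J₁, ∀ p, ev (br s t) p ∈ eigPair (J₁ p) := by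
  intro s hs t ht p
  obtain ⟨q, rfl⟩ := P.surjective p
  have h1 := hJ _ (h.pullPair_mem hs) _ (h.pullPair_mem ht) q
  rw [h.compl.br_pullPair hs.1 hs.2.1 ht.1 ht.2.1] at h1
  exact h.eigPair_of_pull h1

/-- `V₁` normalizes `L_{J₁}`: for `v ∈ V₁` there is a section `v + φ(v)` of `L_Ψ ⊆ L_J` with `φ(v)`
from the second factor, so that its bracket with the pull-back of a section `s` of `L_{J₁}` is the
pull-back of `[v, s]`. -/
lemma framing_normalizes_left : ∀ v ∈ V₁, ∀ s ∈ eigSecs J₁, ∀ p,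
    (dorfman v s.1 p, dorfman v s.2 p) ∈ eigPair (J₁ p) := by
  intro v hv s hs p
  obtain ⟨q, rfl⟩ := P.surjective p
  obtain ⟨a, ha, b, hb, hab⟩ := h.transversal.exists_right v hv
  have h1 := hJ _ (h.eigSecs_le hab) _ (h.pullPair_mem hs) q
  have h2 := h.compl.br_add_pullPair (h.smooth_left hv) (SmoothOn.zero I univ)
    (h.symm.smooth_left ha) (h.symm.smooth_left hb) hs.1 hs.2.1 q
  rw [map_zero, zero_add, dorfman_zero_left hs.1, dorfman_zero_left hs.2.1] at h2
  rw [h2] at h1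
  simp only [Pi.zero_apply, sub_zero, add_zero] at h1
  exact h.eigPair_of_pull h1

/-- `V₁` normalizes `F₁'`: by assumption it normalizes `F₁ ⊕ F₁'`, and by invariance of the inner
product brackets with `v ∈ V₁`, which preserve `F₁`, preserve its orthogonal complement. -/
lemma dorfman_mem_left : ∀ v ∈ V₁, ∀ y, SmoothOn univ y → (∀ p, y p ∈ F₁' p) → ∀ p,
    dorfman v y p ∈ F₁' p := by
  intro v hv y hy hyF p
  have hsv := h.smooth_left hv
  obtain ⟨f, hf, f', hf', e⟩ := Submodule.mem_sup.1
    (h.normalizes₁ v hv y hy (fun p => Submodule.mem_sup_right (hyF p)) p)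
  have hS := h.sgf₁.isSGFAt p
  obtain ⟨k, hk⟩ := hS.split
  -- the component in `F₁` vanishes because it is orthogonal to `F₁`
  suffices h0 : f = 0 by
    rw [← e, h0, zero_add]; exact hf'
  refine hk.eq_zero hf fun g hg => ?_
  obtain ⟨z, hz, ez⟩ := exists_section p g
  have hs := h.sgf₁.eigSec_mem hz
  -- the section `-J₁ J₁ z` of `F₁` has the value `g` at `p`
  have ec : (eigSec J₁ z).1 p = g := by
    change -(J₁ p (J₁ p (z p))) = g
    rw [ez, hS.sq hg, neg_neg]
  have h1 := (h.sgf₁.isSGFAt p).mem_of_mem_eigPair (h.framing_normalizes_left hJ v hv _ hs p)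
  have h2 := anchor_inn hsv hy hs.1 p
  have h3 : (fun q => inn I q (y q) ((eigSec J₁ z).1 q)) = fun _ => 0 := by
    funext q
    rw [inn_comm]
    exact h.orthogonal₁ q _ ((h.sgf₁.isSGFAt q).mem_of_mem_eigPair (hs.2.2 q)).1 _ (hyF q)
  have h4 : inn I p (y p) (dorfman v (eigSec J₁ z).1 p) = 0 := by
    rw [inn_comm]
    exact h.orthogonal₁ p _ h1.1 _ (hyF p)
  rw [h3, mvfderiv_const, h4, ← e, ec, map_add, LinearMap.add_apply, inn_comm p f' g,
    h.orthogonal₁ p g hg f' hf', add_zero, add_zero] at h2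
  exact h2.symm

lemma isNormalPair_left : IsNormalPair I F₁ F₁' J₁ V₁ where
  split := h.split₁'
  orthogonal := h.orthogonal₁
  crf := isCRF_iff.2 ⟨h.sgf₁, h.closed_left hJ⟩
  framing := h.framing₁
  normalizes v hv := ⟨toC_mem_normalizerSGF.2 ⟨h.smooth_left hv, h.framing_normalizes_left hJ v hv⟩,
    toC_mem_normalizerFib.2 ⟨h.smooth_left hv, h.dorfman_mem_left hJ v hv⟩⟩

lemma dorfman_mem_right : ∀ v ∈ V₂, ∀ y, SmoothOn univ y → (∀ p, y p ∈ F₂' p) → ∀ p,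
    dorfman v y p ∈ F₂' p := by
  rw [morimoto_symm] at hJ
  exact h.symm.dorfman_mem_left hJ

lemma isNormalPair_right : IsNormalPair I₂ F₂ F₂' J₂ V₂ := by
  rw [morimoto_symm] at hJ
  exact h.symm.isNormalPair_left hJ

/-- `L_Ψ` is closed: its generators have components in `V₁` and `V₂`, so that their brackets stay in
`F₁' ⊞ F₂'`, where `L_J` is `L_Ψ`. -/
lemma isCRF_psi : IsCRF I' (box P Q F₁' F₂') Ψ := by
  refine isCRF_iff.2 ⟨h.sgf, fun s hs t ht q => ?_⟩
  have hmem : ev (br s t) q ∈ (box P Q F₁' F₂' q).prod (box P Q F₁' F₂' q) := by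
    refine h.sgf.br_mem (𝒢 := genSet P Q V₁ V₂ Ψ)
      (T := (box P Q F₁' F₂' q).prod (box P Q F₁' F₂' q)) (fun G hG => hG.1)
      (fun s hs => ⟨s, h.transversal.span hs, Filter.Eventually.of_forall fun _ => rfl⟩)
      (fun u hu => Submodule.mem_prod.2 ⟨Submodule.neg_mem _ hu.2, hu.1⟩)
      (fun G hG => (h.sgf.isSGFAt q).mem_of_mem_eigPair (hG.1.2.2 q)) ?_ hs ht
    rintro _ ⟨-, v, hv, v', hv', a, ha, a', ha', rfl⟩ _ ⟨-, w, hw, w', hw', b, hb, b', hb', rfl⟩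
    have key : ∀ v ∈ V₁, ∀ a ∈ V₂, ∀ w ∈ V₁, ∀ b ∈ V₂,
        dorfman (P.pullSec v + Q.pullSec a) (P.pullSec w + Q.pullSec b) q ∈ box P Q F₁' F₂' q := by
      intro v hv a ha w hw b hb
      rw [h.compl.dorfman_add_add (h.smooth_left hv) (h.symm.smooth_left ha) (h.smooth_left hw)
        (h.symm.smooth_left hb)]
      exact Submodule.add_mem_sup
        (Submodule.mem_map_of_mem (h.dorfman_mem_left hJ v hv w (h.smooth_left hw)
          (h.mem_left hw) _))
        (Submodule.mem_map_of_mem (h.dorfman_mem_right hJ a ha b (h.symm.smooth_left hb)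
          (h.symm.mem_left hb) _))
    exact ⟨Submodule.sub_mem _ (key v hv a ha w hw b hb) (key v' hv' a' ha' w' hw' b' hb'),
      Submodule.add_mem _ (key v hv a ha w' hw' b' hb') (key v' hv' a' ha' w hw b hb)⟩
  exact h.eigPair_of_box (hJ s (h.eigSecs_le hs) t (h.eigSecs_le ht) q) hmem.1 hmem.2

end Necessity

end IsMorimoto
end MorimotoClosed

/-! ### Integrability of the Morimoto product: sufficient conditions -/

section MorimotoSufficient

variable {E' : Type*} [NormedAddCommGroup E'] [NormedSpace ℝ E'] [FiniteDimensional ℝ E']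
  {H' : Type*} [TopologicalSpace H'] {I' : ModelWithCorners ℝ E' H'}
  {N : Type*} [TopologicalSpace N] [ChartedSpace H' N] [IsManifold I' ∞ N] [T2Space N]
  {E : Type*} [NormedAddCommGroup E] [NormedSpace ℝ E] [FiniteDimensional ℝ E]
  {H : Type*} [TopologicalSpace H] {I : ModelWithCorners ℝ E H}
  {M : Type*} [TopologicalSpace M] [ChartedSpace H M] [IsManifold I ∞ M] [T2Space M]
  {E₂ : Type*} [NormedAddCommGroup E₂] [NormedSpace ℝ E₂] [FiniteDimensional ℝ E₂]
  {H₂ : Type*} [TopologicalSpace H₂] {I₂ : ModelWithCorners ℝ E₂ H₂}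
  {M₂ : Type*} [TopologicalSpace M₂] [ChartedSpace H₂ M₂] [IsManifold I₂ ∞ M₂] [T2Space M₂]

namespace IsMorimoto

variable {P : Factor I' N I M} {Q : Factor I' N I₂ M₂} {F₁ F₁' : Fib I M}
  {F₂ F₂' : Fib I₂ M₂} {J₁ : EndFib I M} {J₂ : EndFib I₂ M₂} {V₁ : Submodule ℝ (GSec I M)}
  {V₂ : Submodule ℝ (GSec I₂ M₂)} {Ψ : EndFib I' N}

/-- The Morimoto product is a split generalized `F`-structure. -/
lemma isSGF_morimoto (h : IsMorimoto P Q F₁ F₁' F₂ F₂' J₁ J₂ V₁ V₂ Ψ) :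
    IsSGF I' (box P Q (fun p => F₁ p ⊔ F₁' p) (fun p => F₂ p ⊔ F₂' p))
      (morimoto P Q J₁ J₂ Ψ) where
  split := by
    refine IsSplit.sup ((h.sgf₁.split.sup h.split₁' h.orthogonal₁).pullFib P)
      ((h.sgf₂.split.sup h.split₂' h.orthogonal₂).pullFib Q) ?_
    rintro q _ ⟨a, -, rfl⟩ _ ⟨b, -, rfl⟩
    exact h.compl.inn_pull q a b
  mem q x := by
    refine Submodule.add_mem _ (Submodule.add_mem _ ?_ ?_) (box_le q (h.sgf.mem q x))
    · exact Submodule.mem_sup_left (Submodule.mem_map_of_mem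
        (Submodule.mem_sup_left (h.sgf₁.mem _ _)))
    · exact Submodule.mem_sup_right (Submodule.mem_map_of_mem
        (Submodule.mem_sup_left (h.sgf₂.mem _ _)))
  zero q x hx := by
    rw [morimoto_apply, h.sgf.zero q x fun y hy => hx y (box_le q hy), P.pullEnd_apply,
      Q.pullEnd_apply, h.sgf₁.zero, h.sgf₂.zero, map_zero, map_zero, add_zero, add_zero]
    · intro y hy
      rw [Q.inn_push]
      exact hx _ (Submodule.mem_sup_right (Submodule.mem_map_of_mem (Submodule.mem_sup_left hy)))
    · intro y hy
      rw [P.inn_push]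
      exact hx _ (Submodule.mem_sup_left (Submodule.mem_map_of_mem (Submodule.mem_sup_left hy)))
  skew q x _ y _ := h.morimoto_skew q x y
  orth q x _ y hy := by rw [h.morimoto_skew, h.morimoto_sq hy, map_neg, neg_neg]
  smooth U hU x hx := by
    refine smoothOn_end (fun x hx => ?_) hU hx
    exact ((P.smoothOn_pullEnd (fun y hy => h.sgf₁.smooth_univ hy) hx).add
      (Q.smoothOn_pullEnd (fun y hy => h.sgf₂.smooth_univ hy) hx)).add (h.sgf.smooth_univ hx)

/-- The sections of `L_J` obtained from the two factors and from `L_Ψ`, for the Morimoto product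
`J`. -/
def gens (P : Factor I' N I M) (Q : Factor I' N I₂ M₂) (J₁ : EndFib I M) (J₂ : EndFib I₂ M₂)
    (V₁ : Submodule ℝ (GSec I M)) (V₂ : Submodule ℝ (GSec I₂ M₂)) (Ψ : EndFib I' N) :
    Set (GSec I' N × GSec I' N) :=
  {s | ∃ t ∈ eigSecs J₁, s = P.pullPair t} ∪ {s | ∃ t ∈ eigSecs J₂, s = Q.pullPair t} ∪
    genSet P Q V₁ V₂ Ψ

omit [FiniteDimensional ℝ E'] [T2Space N] in
lemma gens_subset (h : IsMorimoto P Q F₁ F₁' F₂ F₂' J₁ J₂ V₁ V₂ Ψ) :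
    ∀ G ∈ gens P Q J₁ J₂ V₁ V₂ Ψ, G ∈ eigSecs (morimoto P Q J₁ J₂ Ψ) := by
  rintro _ ((⟨t, ht, rfl⟩ | ⟨t, ht, rfl⟩) | hG)
  · exact h.pullPair_mem ht
  · rw [morimoto_symm]; exact h.symm.pullPair_mem ht
  · exact h.eigSecs_le hG.1

omit [FiniteDimensional ℝ E'] [T2Space N] [FiniteDimensional ℝ E₂] [T2Space M₂] in
/-- The component in the first factor of a section of `L_J` is locally a combination of pull-backs
of sections of `L_{J₁}`. -/
lemma exists_span_left (h : IsMorimoto P Q F₁ F₁' F₂ F₂' J₁ J₂ V₁ V₂ Ψ)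
    {s : GSec I' N × GSec I' N} (hs : s ∈ eigSecs (morimoto P Q J₁ J₂ Ψ)) (q : N) :
    ∃ s' ∈ Submodule.span (smoothFun (M := N) I' ℝ univ) {s | ∃ t ∈ eigSecs J₁, s = P.pullPair t},
      ∀ᶠ r in nhds q, (P.pullEnd J₁ r (s.2 r), -P.pullEnd J₁ r (s.1 r)) = ev s' r := by
  obtain ⟨ι, _, g, k, hg, hk, e⟩ := P.exists_pullEnd_eq q
  -- a shortcut for the search of the scalar multiplication
  let _ : SMul (smoothFun (M := N) I' ℝ univ) (GSec I' N × GSec I' N) :=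
    (inferInstance : Module (smoothFun (M := N) I' ℝ univ) (GSec I' N × GSec I' N)).toSMul
  let c : ι → smoothFun (M := N) I' ℝ univ := fun i =>
    ⟨fun r => inn I' r (s.1 r) (P.pullSec (k i) r),
      hs.1.contMDiffOn_inn (P.smoothOn_pullSec (hk i))⟩
  refine ⟨∑ i, c i • P.pullPair (eigSec J₁ (g i)), Submodule.sum_mem _ fun i _ =>
    Submodule.smul_mem _ _ (Submodule.subset_span ⟨_, h.sgf₁.eigSec_mem (hg i), rfl⟩), ?_⟩
  filter_upwards [e J₁, e (fun p => J₁ p ∘ₗ J₁ p)] with r h1 h2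
  -- as `s.2 = -J s.1`, the first component is determined by `s.1`
  have hJ2 : P.pullEnd J₁ r (s.2 r) = -P.pullEnd (fun p => J₁ p ∘ₗ J₁ p) r (s.1 r) := by
    have e1 : s.2 r = -morimoto P Q J₁ J₂ Ψ r (s.1 r) :=
      neg_eq_iff_eq_neg.1 (hs.2.2 r).1.symm
    rw [e1, morimoto_apply, map_neg, map_add, map_add, h.pullEnd_box (h.sgf.mem _ _), add_zero]
    simp only [P.pullEnd_apply, Q.pullEnd_apply, P.push_pull, h.compl.symm.push_pull, map_zero,
      add_zero, LinearMap.comp_apply]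
  rw [hJ2, h1, h2]
  refine Prod.ext ?_ ?_
  · change _ = (∑ i, c i • P.pullPair (eigSec J₁ (g i))).1 r
    rw [Prod.fst_sum, Finset.sum_apply, ← Finset.sum_neg_distrib]
    refine Finset.sum_congr rfl fun i _ => ?_
    change _ = inn I' r (s.1 r) (P.pullSec (k i) r) • P.pull r (-(J₁ _ (J₁ _ (g i (P.base r)))))
    rw [map_neg, smul_neg]
    rfl
  · dsimp only
    change _ = (∑ i, c i • P.pullPair (eigSec J₁ (g i))).2 r
    rw [Prod.snd_sum, Finset.sum_apply, ← Finset.sum_neg_distrib]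
    refine Finset.sum_congr rfl fun i _ => ?_
    change _ = inn I' r (s.1 r) (P.pullSec (k i) r) • P.pull r (-(J₁ _ (g i (P.base r))))
    rw [map_neg, smul_neg]

omit [FiniteDimensional ℝ E'] [T2Space N] in
/-- Locally, sections of `L_J` are combinations of the generators: a section `s` of `L_J` is
`-√-1 J s`, and the three summands of `J` give the three kinds of generators. -/
lemma exists_span (h : IsMorimoto P Q F₁ F₁' F₂ F₂' J₁ J₂ V₁ V₂ Ψ)
    {s : GSec I' N × GSec I' N} (hs : s ∈ eigSecs (morimoto P Q J₁ J₂ Ψ)) (q : N) :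
    ∃ s' ∈ Submodule.span (smoothFun (M := N) I' ℝ univ) (gens P Q J₁ J₂ V₁ V₂ Ψ),
      ∀ᶠ r in nhds q, ev s r = ev s' r := by
  obtain ⟨s₁, hs₁, e₁⟩ := h.exists_span_left hs q
  have hs' := hs
  rw [morimoto_symm] at hs'
  obtain ⟨s₂, hs₂, e₂⟩ := h.symm.exists_span_left hs' q
  let s₃ : GSec I' N × GSec I' N := (fun r => Ψ r (s.2 r), -fun r => Ψ r (s.1 r))
  have hs₃ : s₃ ∈ eigSecs Ψ := by
    refine ⟨h.sgf.smooth_univ hs.2.1, (h.sgf.smooth_univ hs.1).neg, fun r => ⟨?_, ?_⟩⟩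
    · change Ψ r (Ψ r (s.2 r)) = -(-Ψ r (s.1 r))
      rw [neg_neg, ← h.psi_morimoto, show morimoto P Q J₁ J₂ Ψ r (s.2 r) = s.1 r from (hs.2.2 r).2]
    · change Ψ r (-Ψ r (s.1 r)) = Ψ r (s.2 r)
      rw [map_neg, ← h.psi_morimoto,
        show morimoto P Q J₁ J₂ Ψ r (s.1 r) = -s.2 r from (hs.2.2 r).1, map_neg, neg_neg]
  refine ⟨s₁ + s₂ + s₃, Submodule.add_mem _ (Submodule.add_mem _
    (Submodule.span_mono (fun _ h => Or.inl (Or.inl h)) hs₁)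
    (Submodule.span_mono (fun _ h => Or.inl (Or.inr h)) hs₂))
    (Submodule.span_mono (fun _ h => Or.inr h) (h.transversal.span hs₃)), ?_⟩
  filter_upwards [e₁, e₂] with r h1 h2
  rw [ev_add, ev_add, ← h1, ← h2]
  refine Prod.ext ?_ ?_
  · change s.1 r = P.pullEnd J₁ r (s.2 r) + Q.pullEnd J₂ r (s.2 r) + Ψ r (s.2 r)
    exact (hs.2.2 r).2.symm
  · change s.2 r = -P.pullEnd J₁ r (s.1 r) + -Q.pullEnd J₂ r (s.1 r) + -Ψ r (s.1 r)
    rw [← neg_add, ← neg_add]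
    exact neg_eq_iff_eq_neg.1 (hs.2.2 r).1.symm

section Sufficiency

variable [I'.Boundaryless] [I.Boundaryless] [I₂.Boundaryless]

/-- Brackets of generators `v + a` of `L_Ψ` with pull-backs of sections `t` of `L_{J₁}` are
pull-backs of `[v, t]`, hence in `L_J` if `V₁` normalizes `L_{J₁}`. -/
lemma br_gen_pullPair (h : IsMorimoto P Q F₁ F₁' F₂ F₂' J₁ J₂ V₁ V₂ Ψ)
    (h₁ : IsNormalPair I F₁ F₁' J₁ V₁) {G : GSec I' N × GSec I' N} (hG : G ∈ genSet P Q V₁ V₂ Ψ)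
    {t : GSec I M × GSec I M} (ht : t ∈ eigSecs J₁) (q : N) :
    ev (br G (P.pullPair t)) q ∈ eigPair (morimoto P Q J₁ J₂ Ψ q) := by
  obtain ⟨-, v, hv, v', hv', a, ha, a', ha', rfl⟩ := hG
  rw [h.compl.br_add_pullPair (h.smooth_left hv) (h.smooth_left hv') (h.symm.smooth_left ha)
    (h.symm.smooth_left ha') ht.1 ht.2.1]
  have hn : ∀ v ∈ V₁, (dorfman v t.1 (P.base q), dorfman v t.2 (P.base q)) ∈
      eigPair (J₁ (P.base q)) := fun v hv =>
    (toC_mem_normalizerSGF.1 (h₁.normalizes v hv).1).2 t ht _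
  have := h.eigPair_pull (Submodule.add_mem _ (hn v hv) (eigPair_I_smul (hn v' hv')))
  rwa [← sub_eq_add_neg] at this

/-- If both pairs are normal and `Ψ` is integrable, so is the Morimoto product: it is enough to
consider brackets of generators. -/
theorem isCRF_morimoto (h : IsMorimoto P Q F₁ F₁' F₂ F₂' J₁ J₂ V₁ V₂ Ψ)
    (h₁ : IsNormalPair I F₁ F₁' J₁ V₁) (h₂ : IsNormalPair I₂ F₂ F₂' J₂ V₂)
    (hΨ : IsCRF I' (box P Q F₁' F₂') Ψ) :
    IsCRF I' (box P Q (fun p => F₁ p ⊔ F₁' p) (fun p => F₂ p ⊔ F₂' p))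
      (morimoto P Q J₁ J₂ Ψ) := by
  have hJ := h.isSGF_morimoto
  refine isCRF_iff.2 ⟨hJ, fun s hs t ht q => ?_⟩
  have swap : ∀ {s t : GSec I' N × GSec I' N}, s ∈ eigSecs (morimoto P Q J₁ J₂ Ψ) →
      t ∈ eigSecs (morimoto P Q J₁ J₂ Ψ) → ev (br s t) q ∈ eigPair (morimoto P Q J₁ J₂ Ψ q) →
      ev (br t s) q ∈ eigPair (morimoto P Q J₁ J₂ Ψ q) := fun hs ht h => by
    rw [hJ.br_swap ht hs]
    exact Submodule.neg_mem _ h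
  refine hJ.br_mem h.gens_subset (fun s hs => h.exists_span hs q) (fun u hu => eigPair_I_smul hu)
    (fun G hG => (h.gens_subset G hG).2.2 q) ?_ hs ht
  have hpull : ∀ {t : GSec I M × GSec I M}, t ∈ eigSecs J₁ →
    P.pullPair t ∈ eigSecs (morimoto P Q J₁ J₂ Ψ) := fun ht => h.pullPair_mem ht
  have hpull₂ : ∀ {t : GSec I₂ M₂ × GSec I₂ M₂}, t ∈ eigSecs J₂ →
    Q.pullPair t ∈ eigSecs (morimoto P Q J₁ J₂ Ψ) := fun ht =>
      h.gens_subset _ (Or.inl (Or.inr ⟨_, ht, rfl⟩))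
  have hgen : ∀ {G}, G ∈ genSet P Q V₁ V₂ Ψ → G ∈ eigSecs (morimoto P Q J₁ J₂ Ψ) := fun hG =>
    h.eigSecs_le hG.1
  have hright : ∀ {G}, G ∈ genSet P Q V₁ V₂ Ψ → ∀ {t}, t ∈ eigSecs J₂ →
      ev (br G (Q.pullPair t)) q ∈ eigPair (morimoto P Q J₁ J₂ Ψ q) := by
    intro G hG t ht
    rw [morimoto_symm]
    rw [genSet_symm] at hG
    exact h.symm.br_gen_pullPair h₂ hG ht q
  -- nine cases, according to the kinds of the two generators
  rintro _ ((⟨s, hs, rfl⟩ | ⟨s, hs, rfl⟩) | hG) _ ((⟨t, ht, rfl⟩ | ⟨t, ht, rfl⟩) | hG')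
  · rw [h.compl.br_pullPair hs.1 hs.2.1 ht.1 ht.2.1]
    exact h.eigPair_pull ((isCRF_iff.1 h₁.crf).2 s hs t ht _)
  · rw [h.compl.br_pullPair_pullPair hs.1 hs.2.1 ht.1 ht.2.1]
    exact Submodule.zero_mem _
  · exact swap (hgen hG') (hpull hs) (h.br_gen_pullPair h₁ hG' hs q)
  · rw [h.compl.symm.br_pullPair_pullPair hs.1 hs.2.1 ht.1 ht.2.1]
    exact Submodule.zero_mem _
  · rw [h.compl.symm.br_pullPair hs.1 hs.2.1 ht.1 ht.2.1, morimoto_symm]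
    exact h.symm.eigPair_pull ((isCRF_iff.1 h₂.crf).2 s hs t ht _)
  · exact swap (hgen hG') (hpull₂ hs) (hright hG' hs)
  · exact h.br_gen_pullPair h₁ hG ht q
  · exact hright hG ht
  · exact h.eigPair_le ((isCRF_iff.1 hΨ).2 _ hG.1 _ hG'.1 q)

end Sufficiency

end IsMorimoto
end MorimotoSufficient

end GenGeom

end

theorem mainTheorem2
    {E₁ : Type*} [NormedAddCommGroup E₁] [NormedSpace ℝ E₁] [FiniteDimensional ℝ E₁]
    {H₁ : Type*} [TopologicalSpace H₁] (I₁ : ModelWithCorners ℝ E₁ H₁) [I₁.Boundaryless]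
    {M₁ : Type*} [TopologicalSpace M₁] [ChartedSpace H₁ M₁] [IsManifold I₁ ∞ M₁]
    [T2Space M₁] [SecondCountableTopology M₁] [Nonempty M₁]
    {E₂ : Type*} [NormedAddCommGroup E₂] [NormedSpace ℝ E₂] [FiniteDimensional ℝ E₂]
    {H₂ : Type*} [TopologicalSpace H₂] (I₂ : ModelWithCorners ℝ E₂ H₂) [I₂.Boundaryless]
    {M₂ : Type*} [TopologicalSpace M₂] [ChartedSpace H₂ M₂] [IsManifold I₂ ∞ M₂]
    [T2Space M₂] [SecondCountableTopology M₂] [Nonempty M₂]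
    (F₁ F₁' : GenGeom.Fib I₁ M₁) (F₂ F₂' : GenGeom.Fib I₂ M₂)
    (J₁ : GenGeom.EndFib I₁ M₁) (J₂ : GenGeom.EndFib I₂ M₂)
    (V₁ : Submodule ℝ (GenGeom.GSec I₁ M₁)) (V₂ : Submodule ℝ (GenGeom.GSec I₂ M₂))
    (Ψ : GenGeom.EndFib (I₁.prod I₂) (M₁ × M₂))
    (hD : GenGeom.IsAdaptableExternalMorimotoDatum I₁ I₂ F₁ F₁' F₂ F₂' J₁ J₂ V₁ V₂ Ψ) :
    GenGeom.IsCRF (I₁.prod I₂)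
        (GenGeom.boxSum I₁ I₂ (fun p => F₁ p ⊔ F₁' p) (fun p => F₂ p ⊔ F₂' p))
        (GenGeom.morimotoProduct I₁ I₂ J₁ J₂ Ψ) ↔
      (GenGeom.IsNormalPair I₁ F₁ F₁' J₁ V₁ ∧ GenGeom.IsNormalPair I₂ F₂ F₂' J₂ V₂) ∧
        GenGeom.IsCRF (I₁.prod I₂) (GenGeom.boxSum I₁ I₂ F₁' F₂') Ψ := by
  have hc := GenGeom.isCompl_fst_snd I₁ M₁ I₂ M₂
  have h : GenGeom.IsMorimoto (GenGeom.fstFactor I₁ M₁ I₂ M₂) (GenGeom.sndFactor I₁ M₁ I₂ M₂)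
      F₁ F₁' F₂ F₂' J₁ J₂ V₁ V₂ Ψ :=
    { compl := hc
      split₁' := hD.split₁'
      split₂' := hD.split₂'
      orthogonal₁ := hD.orthogonal₁
      orthogonal₂ := hD.orthogonal₂
      sgf₁ := hD.sgf₁
      sgf₂ := hD.sgf₂
      framing₁ := hD.framing₁
      framing₂ := hD.framing₂
      sgf := hD.sgf
      normalizes₁ := fun v hv => (GenGeom.toC_mem_normalizerFib.1 (hD.normalizes₁ v hv)).2
      normalizes₂ := fun v hv => (GenGeom.toC_mem_normalizerFib.1 (hD.normalizes₂ v hv)).2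
      transversal := GenGeom.IsAdmissible.isTransversal hc hD.split₁' hD.split₂' hD.framing₁
        hD.framing₂ hD.sgf hD.admissible }
  constructor
  · intro hJ
    have hJ' := (GenGeom.isCRF_iff.1 hJ).2
    exact ⟨⟨h.isNormalPair_left hJ', h.isNormalPair_right hJ'⟩, h.isCRF_psi hJ'⟩
  · rintro ⟨⟨h₁, h₂⟩, hΨ⟩
    exact h.isCRF_morimoto h₁ h₂ hΨ
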